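/- Let $(p_{k,\ell})_{(k,\ell)\in\mathbb Z^2}$ be nonnegative weights with $\sum p_{k,\ell}=1$ such that: (H1) $p_{k,\ell}=0$ if $k\ge 2$ or $\ell\ge 2$; (H2) if $|x|=|y|=1$ and $|\sum p_{k,\ell}x^ky^\ell|=1$, then $x=y=1$; (H3) $\sum (k^2+\ell^2)p_{k,\ell}<\infty$; (H4) $\sum k\,p_{k,\ell}=\sum \ell\, p_{k,\ell}=0$. For $|x|,|y|\le 1$ let $$K(x,y)=xy-\sum p_{k,\ell}\,x^{1-k}y^{1-\ell},\qquad \mathcal K=\{(x,y)\in\mathbb C^2: K(x,y)=0,\ |x|=|y|\le 1\}.$$ Let $\mathcal C$ be the unit circle and $\mathcal C^+$ the open unit disk, and let $\eta:\mathcal C\to\overline{\mathcal C^+}$ be the continuous function with $\eta(1)=1$ such that, for every $s\in\mathcal C$, $\eta(s)$ is a root of $\eta\mapsto K(\eta s,\eta s^{-1})$ (if $p_{1,1}=0$: of this function divided by $\eta$). Put $\mathcal S_1=\{\eta(s)s: s\in\mathcal C\}$ and $\mathcal S_2=\{\eta(s)s^{-1}: s\in\mathcal C\}$. Assume (K1)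 the curves $\mathcal S_1$ and $\mathcal S_2$ are non-self-intersecting (each being run through once by $s\in\mathcal C$ if $p_{1,1}\neq0$, and by $s$ in a half circle if $p_{1,1}=0$); $\eta(s)s$ and $\eta(s)s^{-1}$ move on them in opposite orientations; and the derivatives of $\eta(s)s$ and $\eta(s)s^{-1}$ along $\mathcal C$, where they exist, do not vanish at any $s\in\mathcal C\setminus\{\pm1\}$ if $p_{1,1}=0$, and at any $s\in\mathcal C\setminus\{1\}$ if $p_{1,1}\ne 0$. Denote by $\mathcal S_i^+$ and $\mathcal S_i^-$ the interior and the exterior of the Jordan curve $\mathcal S_i$. Let $X$ be the function on $\mathcal S_2$ with $(X(y),y)\in\mathcal K$ for all $y\in\mathcal S_2$, and $Y$ the function on $\mathcal S_1$ with $(x,Y(x))\in\mathcal K$ for all $x\in\mathcal S_1$. Then $X$ is a bijection from $\mathcal S_2$ onto $\mathcal S_1$ with inverse $Y$, and: (i) $X$ continues analytically and single-valuedly, without branch points, to $\mathcal S_2^-\cap\mathcal C^+$: there is a function which equals $X$ on $\mathcal S_2$, is continuous on $\mathcal S_2\cup(\mathcal S_2^-\cap\mathcal C^+)$, is analytic on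 an open set containing $(\mathcal S_2\setminus\{1\})\cup(\mathcal S_2^-\cap\mathcal C^+)$, and on $\mathcal S_2^-\cap\mathcal C^+$ takes values in $\mathcal C^+$ and satisfies $K(X(y),y)=0$. In the same sense, $Y$ continues analytically and single-valuedly to $\mathcal S_1^-\cap\mathcal C^+$, with $K(x,Y(x))=0$ there. (ii) $K(x,y)\neq 0$ for all $(x,y)\in\mathcal S_1^+\times\mathcal S_2^+$. -/

import Mathlib

namespace QuadrantWalk

/-- Transition weights `p k l` of a lattice walk on `ℤ²`: nonnegative, summing to one, with
jumps at most one unit in the positive directions, strongly aperiodic, with finite second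
moments and zero drift. -/
structure IsWalk (p : ℤ → ℤ → ℝ) : Prop where
  nonneg : ∀ k l, 0 ≤ p k l
  sum_one : HasSum (fun z : ℤ × ℤ => p z.1 z.2) 1
  small_positive_jumps : ∀ k l, 2 ≤ k ∨ 2 ≤ l → p k l = 0
  aperiodic : ∀ x y : ℂ, ‖x‖ = 1 → ‖y‖ = 1 →
    ‖∑' z : ℤ × ℤ, (p z.1 z.2 : ℂ) * x ^ z.1 * y ^ z.2‖ = 1 → x = 1 ∧ y = 1
  moments : Summable (fun z : ℤ × ℤ => ((z.1 : ℝ) ^ 2 + (z.2 : ℝ) ^ 2) * p z.1 z.2)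
  drift_fst : HasSum (fun z : ℤ × ℤ => (z.1 : ℝ) * p z.1 z.2) 0
  drift_snd : HasSum (fun z : ℤ × ℤ => (z.2 : ℝ) * p z.1 z.2) 0

/-- The kernel `K(x,y) = xy - ∑ p k l x^(1-k) y^(1-l)`. For a walk only terms with `k, l ≤ 1`
occur, so this is a power series, absolutely convergent on the closed bidisk. -/
noncomputable def kernel (p : ℤ → ℤ → ℝ) (x y : ℂ) : ℂ :=
  x * y - ∑' z : ℤ × ℤ, (p z.1 z.2 : ℂ) * x ^ (1 - z.1) * y ^ (1 - z.2)

/-- `η - ∑ p k l η^(1-k-l) s^(l-k)`. When `p 1 1 = 0` all exponents of `η` that occur are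
nonnegative, and `kernel p (η s) (η s⁻¹)` is `η` times this series. -/
noncomputable def reducedKernel (p : ℤ → ℤ → ℝ) (η s : ℂ) : ℂ :=
  η - ∑' z : ℤ × ℤ, (p z.1 z.2 : ℂ) * η ^ (1 - z.1 - z.2) * s ^ (z.2 - z.1)

/-- The zero set `{K(x,y) = 0, |x| = |y| ≤ 1}` of the kernel. -/
def zeroSet (p : ℤ → ℤ → ℝ) : Set (ℂ × ℂ) :=
  {z | kernel p z.1 z.2 = 0 ∧ ‖z.1‖ = ‖z.2‖ ∧ ‖z.2‖ ≤ 1}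

/-- `η` is the root function on the unit circle: continuous, with `η(1) = 1` and, for `|s| = 1`,
`η(s)` is a root of modulus at most one of `η ↦ K(η s, η s⁻¹)`; if `p 1 1 = 0`, so that `0` is
a root for every `s`, then it is the root that remains after division by `η`.
Values off the unit circle are irrelevant. -/
structure IsRootFunction (p : ℤ → ℤ → ℝ) (η : ℂ → ℂ) : Prop where
  continuousOn : ContinuousOn η (Metric.sphere 0 1)
  map_one : η 1 = 1
  norm_le : ∀ s : ℂ, ‖s‖ = 1 → ‖η s‖ ≤ 1
  root : ∀ s : ℂ, ‖s‖ = 1 → kernel p (η s * s) (η s * s⁻¹) = 0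
  reduced_root : p 1 1 = 0 → ∀ s : ℂ, ‖s‖ = 1 → reducedKernel p (η s) s = 0

/-- The curve `S₁ = {η(s) s : |s| = 1}`. -/
def S₁ (η : ℂ → ℂ) : Set ℂ := (fun s => η s * s) '' Metric.sphere 0 1

/-- The curve `S₂ = {η(s) s⁻¹ : |s| = 1}`. -/
def S₂ (η : ℂ → ℂ) : Set ℂ := (fun s => η s * s⁻¹) '' Metric.sphere 0 1

/-- The parametrization `φ ↦ η(s) s`, `s = exp(iφ)`, of `S₁`. -/
noncomputable def curve₁ (η : ℂ → ℂ) (φ : ℝ) : ℂ :=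
  η (Complex.exp (φ * Complex.I)) * Complex.exp (φ * Complex.I)

/-- The parametrization `φ ↦ η(s) s⁻¹`, `s = exp(iφ)`, of `S₂`. -/
noncomputable def curve₂ (η : ℂ → ℂ) (φ : ℝ) : ℂ :=
  η (Complex.exp (φ * Complex.I)) * (Complex.exp (φ * Complex.I))⁻¹

/-- The length of the parameter interval on which `curve₁` and `curve₂` run through `S₁` and
`S₂` once: if `p 1 1 = 0` then `η(-s) = -η(s)` and half of the circle suffices. -/
noncomputable def period (p : ℤ → ℤ → ℝ) : ℝ :=
  open Classical in if p 1 1 = 0 then Real.pi else 2 * Real.pi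

/-- The interior of a closed curve: the points in bounded components of its complement. -/
def inside (S : Set ℂ) : Set ℂ :=
  {w | w ∉ S ∧ Bornology.IsBounded (connectedComponentIn Sᶜ w)}

/-- The exterior of a closed curve: the points in unbounded components of its complement. -/
def outside (S : Set ℂ) : Set ℂ :=
  {w | w ∉ S ∧ ¬ Bornology.IsBounded (connectedComponentIn Sᶜ w)}

/-- The closed curve `c` on `[0, L]` has winding number `n` around `w`: a continuous argument
of `c - w` increases by `2πn`. -/
def HasWindingNumber (c : ℝ → ℂ) (L : ℝ) (w : ℂ) (n : ℤ) : Prop :=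
  ∃ θ : ℝ → ℝ, ContinuousOn θ (Set.Icc 0 L) ∧
    (∀ t ∈ Set.Icc 0 L, c t - w = (‖c t - w‖ : ℂ) * Complex.exp (θ t * Complex.I)) ∧
    θ L - θ 0 = 2 * Real.pi * n

/-- The Jordan curve `c` on `[0, L]` is run through counterclockwise (`ε = 1`) or clockwise
(`ε = -1`): its winding number around every interior point is `ε`. -/
def HasOrientation (c : ℝ → ℂ) (L : ℝ) (ε : ℤ) : Prop :=
  ∀ w ∈ inside (c '' Set.Icc 0 L), HasWindingNumber c L w ε

/-- `S₁` and `S₂` are non-self-intersecting, `η(s) s` and `η(s) s⁻¹` move on them in opposite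
orientations, and the derivatives of these two functions along the unit circle do not vanish,
wherever they exist, at any `s ∉ {1, -1}` if `p 1 1 = 0`, and at any `s ≠ 1` otherwise. -/
structure CurveCondition (p : ℤ → ℤ → ℝ) (η : ℂ → ℂ) : Prop where
  simple₁ : ∀ s t : ℂ, ‖s‖ = 1 → ‖t‖ = 1 → η s * s = η t * t →
    s = t ∨ (p 1 1 = 0 ∧ s = -t)
  simple₂ : ∀ s t : ℂ, ‖s‖ = 1 → ‖t‖ = 1 → η s * s⁻¹ = η t * t⁻¹ →
    s = t ∨ (p 1 1 = 0 ∧ s = -t)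
  opposite_orientations : ∃ ε : ℤ, (ε = 1 ∨ ε = -1) ∧
    HasOrientation (curve₁ η) (period p) ε ∧ HasOrientation (curve₂ η) (period p) (-ε)
  deriv_ne_zero₁ : ∀ φ : ℝ, Complex.exp (φ * Complex.I) ≠ 1 →
    (p 1 1 = 0 → Complex.exp (φ * Complex.I) ≠ -1) →
    ∀ v : ℂ, HasDerivAt (curve₁ η) v φ → v ≠ 0
  deriv_ne_zero₂ : ∀ φ : ℝ, Complex.exp (φ * Complex.I) ≠ 1 →
    (p 1 1 = 0 → Complex.exp (φ * Complex.I) ≠ -1) →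
    ∀ v : ℂ, HasDerivAt (curve₂ η) v φ → v ≠ 0

/-- `F` on the closed curve `S` (through `1`) continues analytically, as a single-valued
function without branch points, to the part of the exterior of `S` in the open unit disk:
there is a function `G`, equal to `F` on `S`, continuous on the union of `S` and that region,
and analytic on an open set containing the region and `S \ {1}`. On the region the values of
`G` have modulus less than one and satisfy `R (G z) z`. -/
def ContinuesOutside (S : Set ℂ) (F : ℂ → ℂ) (R : ℂ → ℂ → Prop) : Prop :=
  ∃ (W : Set ℂ) (G : ℂ → ℂ), IsOpen W ∧ (outside S ∩ Metric.ball 0 1) ∪ (S \ {1}) ⊆ W ∧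
    AnalyticOnNhd ℂ G W ∧ ContinuousOn G ((outside S ∩ Metric.ball 0 1) ∪ S) ∧
    Set.EqOn G F S ∧
    ∀ z ∈ outside S ∩ Metric.ball 0 1, ‖G z‖ < 1 ∧ R (G z) z

end QuadrantWalk

/-!
The argument works with the ratio `u = x / y`. One has
`kernel p (u * y) y = y ^ defect p * ratioKernel p u y`, and for fixed `y` in the open unit disc the
function `ratioKernel p · y` is holomorphic on a neighbourhood of the closed unit disc. The zeros of
the kernel with `|x| ≤ |y|` are the zeros of this function with `|u| ≤ 1`, and `S₂` consists of the
points `y` for which there is a zero with `|u| = 1`: the zeros over `u = s ^ 2` in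
the closed disc are `y = η(s) s⁻¹` and, if `p 1 1 ≠ 0`, also `y = η(-s) (-s)⁻¹`.

*Counting roots.* For `|u| = 1`, divide `ratioKernel p u` by the linear factors of its zeros in `y`.
The cofactor (`kernelDiff₁` or `kernelDiff₂`) has no zeros in the disc: if `p 1 1 = 0` because zero
drift makes it a perturbation of `u` by terms of total size less than one, and if `p 1 1 ≠ 0` by
Rouché's theorem. So, when `u` runs through the unit circle, the factors wind as often as the curve
`S₂` winds around `y`, and the cofactor winds once. By the argument principle the number of roots in
the disc is one plus the winding number of `S₂` around `y` (`circleWinding_ratioKernel`): one root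
in the exterior, and none in the interior if `S₂` is run through clockwise.

*Orientation.* Both curves, parametrized by `η(s) s⁻¹` and `η(s⁻¹) s⁻¹`, are indeed run through
clockwise. They have the same orientation by hypothesis, and for at least one of them some point
close to the origin has no roots (`orientation_eq_neg_one`), which rules out the positive sign.

*On the curve.* A point of `S₂` other than `1` has a root `u₀` with `|u₀| = 1`. Since the curve is
locally the graph of an analytic function of `u` with nonvanishing derivative, `u₀` is a simple
root. A second root in the disc would persist at nearby points off the curve for which `u₀` has
moved into the disc, against the number of roots
(`ratioKernel_curvePoint_ne_zero_of_norm_lt`). Therefore the root in the closed disc is unique and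
simple on the whole set in question, depends analytically on `y`, and `y ↦ y u(y)` is the
continuation of `X`. Near `1` it is continuous because all roots tend to `1`. The assertions on `Y`
follow by exchanging the coordinates, and zeros of the kernel on the product of the interiors are
excluded by the count of roots, applied to `x / y` or `y / x`, whichever is in the closed disc.
-/

namespace QuadrantWalk

open Set Filter Topology Metric
open scoped Real

/-! ### Winding numbers of closed curves around the origin -/

/-- The closed curve `c` on `[0, T]` avoids the origin and has winding number `n` around it: a
continuous logarithm of `c` increases by `2πin`. -/
def HasLogWinding (c : ℝ → ℂ) (T : ℝ) (n : ℤ) : Prop :=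
  ∃ g : ℝ → ℂ, ContinuousOn g (Icc 0 T) ∧ (∀ t ∈ Icc 0 T, c t = Complex.exp (g t)) ∧
    g T - g 0 = n * (2 * π * Complex.I)

theorem HasLogWinding.congr {c d : ℝ → ℂ} {T : ℝ} {n : ℤ} (h : HasLogWinding c T n)
    (hcd : ∀ t ∈ Icc 0 T, d t = c t) : HasLogWinding d T n := by
  obtain ⟨g, hg, hc, hn⟩ := h
  exact ⟨g, hg, fun t ht => (hcd t ht).trans (hc t ht), hn⟩

theorem exists_continuousOn_log {c : ℝ → ℂ} {T : ℝ} (hT : 0 ≤ T)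
    (hc : ContinuousOn c (Icc 0 T)) (h0 : ∀ t ∈ Icc 0 T, c t ≠ 0) :
    ∃ g : ℝ → ℂ, ContinuousOn g (Icc 0 T) ∧ ∀ t ∈ Icc 0 T, c t = Complex.exp (g t) := by
  have hcont : Continuous (IccExtend hT ((Icc 0 T).domRestrict c)) :=
    (continuousOn_iff_continuous_domRestrict.mp hc).Icc_extend'
  obtain ⟨g, hg, hge⟩ := Complex.exists_continuousOn_eqOn_exp_comp (X := ℝ) (U := univ)
    (g := IccExtend hT ((Icc 0 T).domRestrict c)) (by
      have := (convex_univ (𝕜 := ℝ) (E := ℝ)).contractibleSpace ⟨0, mem_univ _⟩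
      exact SimplyConnectedSpace.ofContractible _) isOpen_univ hcont.continuousOn (by
      rintro ⟨t, -, ht⟩
      exact h0 _ (projIcc 0 T hT t).2 ht)
  refine ⟨g, hg.mono (subset_univ _), fun t ht => ?_⟩
  have := hge (mem_univ t)
  simp only [Function.comp] at this
  rw [this, IccExtend_of_mem _ _ ht]; rfl

theorem exists_hasLogWinding {c : ℝ → ℂ} {T : ℝ} (hT : 0 ≤ T)
    (hc : ContinuousOn c (Icc 0 T)) (h0 : ∀ t ∈ Icc 0 T, c t ≠ 0) (hcl : c T = c 0) :
    ∃ n, HasLogWinding c T n := by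
  obtain ⟨g, hg, hge⟩ := exists_continuousOn_log hT hc h0
  have h : Complex.exp (g T) = Complex.exp (g 0) := by
    rw [← hge T ⟨hT, le_rfl⟩, ← hge 0 ⟨le_rfl, hT⟩, hcl]
  obtain ⟨n, hn⟩ := Complex.exp_eq_exp_iff_exists_int.mp h
  exact ⟨n, g, hg, hge, by rw [hn]; ring⟩

theorem HasLogWinding.mul {c d : ℝ → ℂ} {T : ℝ} {n m : ℤ} (hc : HasLogWinding c T n)
    (hd : HasLogWinding d T m) : HasLogWinding (fun t => c t * d t) T (n + m) := by
  obtain ⟨g, hg, hge, hn⟩ := hc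
  obtain ⟨k, hk, hke, hm⟩ := hd
  refine ⟨fun t => g t + k t, hg.add hk, fun t ht => ?_, ?_⟩
  · simp only [Complex.exp_add, hge t ht, hke t ht]
  · push_cast; linear_combination hn + hm

theorem HasLogWinding.ne_zero {c : ℝ → ℂ} {T : ℝ} {n : ℤ} (hc : HasLogWinding c T n) {t : ℝ}
    (ht : t ∈ Icc 0 T) : c t ≠ 0 := by
  obtain ⟨g, hg, hge, hn⟩ := hc
  rw [hge t ht]; exact Complex.exp_ne_zero _

theorem hasLogWinding_zero_of_re_pos {c : ℝ → ℂ} {T : ℝ} (hc : ContinuousOn c (Icc 0 T))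
    (h0 : ∀ t ∈ Icc 0 T, 0 < (c t).re) (hcl : c T = c 0) : HasLogWinding c T 0 := by
  refine ⟨fun t => Complex.log (c t), hc.clog fun t ht => Or.inl (h0 t ht), fun t ht => ?_, ?_⟩
  · rw [Complex.exp_log]
    intro h
    have := h0 t ht
    simp [h] at this
  · simp [hcl]

theorem hasLogWinding_const {a : ℂ} (ha : a ≠ 0) (T : ℝ) : HasLogWinding (fun _ => a) T 0 :=
  ⟨fun _ => Complex.log a, continuousOn_const, fun _ _ => (Complex.exp_log ha).symm, by simp⟩

theorem HasLogWinding.unique {c : ℝ → ℂ} {T : ℝ} (hT : 0 ≤ T) {n m : ℤ}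
    (hn : HasLogWinding c T n) (hm : HasLogWinding c T m) : n = m := by
  obtain ⟨g, hg, hge, hn⟩ := hn
  obtain ⟨k, hk, hke, hm⟩ := hm
  -- the difference of two logarithms is a continuous function with values in `2πiℤ`
  have hint : ∀ t ∈ Icc 0 T, ∃ j : ℤ, g t - k t = j * (2 * π * Complex.I) := by
    intro t ht
    obtain ⟨j, hj⟩ := Complex.exp_eq_exp_iff_exists_int.mp ((hge t ht).symm.trans (hke t ht))
    exact ⟨j, by rw [hj]; ring⟩
  choose! j hj using hint
  have hcj : ContinuousOn (fun t => (j t : ℝ)) (Icc 0 T) := by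
    have h1 : ContinuousOn (fun t => (g t - k t).im / (2 * π)) (Icc 0 T) :=
      (Complex.continuous_im.comp_continuousOn (hg.sub hk)).div_const _
    refine h1.congr fun t ht => ?_
    have hpi := Real.pi_ne_zero
    simp only [hj t ht]
    simp
  have hcj' : ContinuousOn j (Icc 0 T) :=
    (Int.isClosedEmbedding_coe_real.isInducing.continuousOn_iff).mpr hcj
  have hjc : j T = j 0 := isPreconnected_Icc.constant hcj' ⟨hT, le_rfl⟩ ⟨le_rfl, hT⟩
  have h1 := hj T ⟨hT, le_rfl⟩
  have h2 := hj 0 ⟨le_rfl, hT⟩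
  rw [hjc] at h1
  have h3 : ((n : ℂ) - m) * (2 * π * Complex.I) = 0 := by linear_combination h1 - h2 - hn + hm
  have h4 := (mul_eq_zero.mp h3).resolve_right Complex.two_pi_I_ne_zero
  exact_mod_cast sub_eq_zero.mp h4

theorem hasLogWinding_exp : HasLogWinding (fun t => Complex.exp (t * Complex.I)) (2 * π) 1 :=
  ⟨fun t => t * Complex.I, by fun_prop, fun _ _ => rfl, by push_cast; ring⟩

/-- Dog on a leash: a curve that stays closer to `c` than `c` is to the origin winds like `c`. -/
theorem HasLogWinding.of_norm_sub_lt {c d : ℝ → ℂ} {T : ℝ} {n : ℤ}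
    (hc : HasLogWinding c T n) (hcc : ContinuousOn c (Icc 0 T)) (hcl : c T = c 0)
    (hd : ContinuousOn d (Icc 0 T)) (hdl : d T = d 0)
    (h : ∀ t ∈ Icc 0 T, ‖d t - c t‖ < ‖c t‖) : HasLogWinding d T n := by
  have h0 : ∀ t ∈ Icc 0 T, c t ≠ 0 := fun t ht => hc.ne_zero ht
  have h1 : HasLogWinding (fun t => d t / c t) T 0 := by
    refine hasLogWinding_zero_of_re_pos (hd.div hcc h0) (fun t ht => ?_) (by rw [hcl, hdl])
    have h2 : ‖d t / c t - 1‖ < 1 := by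
      rw [div_sub_one (h0 t ht), norm_div, div_lt_one (norm_pos_iff.mpr (h0 t ht))]
      exact h t ht
    have h3 := (Complex.abs_re_le_norm (d t / c t - 1)).trans_lt h2
    rw [abs_lt] at h3
    simp only [Complex.sub_re, Complex.one_re] at h3
    linarith [h3.1]
  have h4 := hc.mul h1
  rw [add_zero] at h4
  refine h4.congr fun t ht => ?_
  rw [mul_div_cancel₀ _ (h0 t ht)]

/-- Homotopy invariance of the winding number, over any preconnected space of parameters. -/
theorem HasLogWinding.homotopy {X : Type*} [TopologicalSpace X] {F : X → ℝ → ℂ} {S : Set X}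
    {T : ℝ} (hT : 0 ≤ T) (hS : IsPreconnected S)
    (hF : ContinuousOn (Function.uncurry F) (S ×ˢ Icc 0 T))
    (h0 : ∀ x ∈ S, ∀ t ∈ Icc 0 T, F x t ≠ 0) (hcl : ∀ x ∈ S, F x T = F x 0) {n : ℤ} {x y : X}
    (hx : x ∈ S) (hy : y ∈ S) (hn : HasLogWinding (F x) T n) : HasLogWinding (F y) T n := by
  have hFc : ∀ x ∈ S, ContinuousOn (F x) (Icc 0 T) := fun x hx =>
    hF.comp (f := fun t => (x, t)) (by fun_prop) fun t ht => ⟨hx, ht⟩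
  have hex : ∀ x ∈ S, ∃ n, HasLogWinding (F x) T n := fun x hx =>
    exists_hasLogWinding hT (hFc x hx) (h0 x hx) (hcl x hx)
  choose! ν hν using hex
  have hνc : ContinuousOn ν S := by
    intro x hx
    obtain ⟨t₀, ht₀, hmin⟩ := isCompact_Icc.exists_isMinOn (nonempty_Icc.mpr hT) (hFc x hx).norm
    have hpos : 0 < ‖F x t₀‖ := norm_pos_iff.mpr (h0 x hx t₀ ht₀)
    obtain ⟨v, hv, hvu⟩ := isCompact_Icc.mem_uniformity_of_prod hF hx (dist_mem_uniformity hpos)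
    have h1 : ∀ᶠ y in 𝓝[S] x, ν y = ν x := by
      filter_upwards [hv, self_mem_nhdsWithin] with y hyv hyS
      refine (hν y hyS).unique hT ((hν x hx).of_norm_sub_lt (hFc x hx) (hcl x hx) (hFc y hyS)
        (hcl y hyS) fun t ht => ?_)
      rw [← dist_eq_norm]
      exact lt_of_lt_of_le (hvu y hyv t ht) (hmin ht)
    exact (tendsto_congr' h1).mpr tendsto_const_nhds
  have h2 : ν x = ν y := hS.constant hνc hx hy
  rw [(hν x hx).unique hT hn] at h2
  rw [h2]; exact hν y hy

theorem HasWindingNumber.hasLogWinding {c : ℝ → ℂ} {L : ℝ} {w : ℂ} {n : ℤ}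
    (h : HasWindingNumber c L w n) (hc : ContinuousOn c (Icc 0 L)) (hcl : c L = c 0)
    (h0 : ∀ t ∈ Icc 0 L, c t ≠ w) : HasLogWinding (fun t => c t - w) L n := by
  obtain ⟨θ, hθ, hθe, hθn⟩ := h
  have h0' : ∀ t ∈ Icc 0 L, ‖c t - w‖ ≠ 0 := fun t ht =>
    norm_ne_zero_iff.mpr (sub_ne_zero.mpr (h0 t ht))
  refine ⟨fun t => (Real.log ‖c t - w‖ : ℝ) + θ t * Complex.I, ?_, fun t ht => ?_, ?_⟩
  · have h1 : ContinuousOn (fun t => Real.log ‖c t - w‖) (Icc 0 L) :=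
      (hc.sub continuousOn_const).norm.log h0'
    exact (Complex.continuous_ofReal.comp_continuousOn h1).add
      ((Complex.continuous_ofReal.comp_continuousOn hθ).mul continuousOn_const)
  · rw [Complex.exp_add, ← Complex.ofReal_exp, Real.exp_log
      (lt_of_le_of_ne (norm_nonneg _) (h0' t ht).symm)]
    exact hθe t ht
  · have h2 : (θ L : ℂ) - θ 0 = 2 * π * n := by exact_mod_cast hθn
    simp only [hcl]
    linear_combination Complex.I * h2

/-! ### Counting zeros in the unit disc -/

/-- The winding number around the origin of the image of the unit circle under `f` is `n`. -/
def CircleWinding (f : ℂ → ℂ) (n : ℤ) : Prop :=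
  HasLogWinding (fun t => f (Complex.exp (t * Complex.I))) (2 * π) n

theorem norm_exp_mul_I (t : ℝ) : ‖Complex.exp (t * Complex.I)‖ = 1 :=
  Complex.norm_exp_ofReal_mul_I t

theorem exp_two_pi_mul_I : Complex.exp ((2 * π : ℝ) * Complex.I) = 1 := by
  push_cast; exact Complex.exp_two_pi_mul_I

theorem CircleWinding.congr {f g : ℂ → ℂ} {n : ℤ} (hf : CircleWinding f n)
    (h : ∀ z : ℂ, ‖z‖ = 1 → g z = f z) : CircleWinding g n :=
  HasLogWinding.congr hf fun t _ => h _ (norm_exp_mul_I t)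

theorem CircleWinding.mul {f g : ℂ → ℂ} {n m : ℤ} (hf : CircleWinding f n)
    (hg : CircleWinding g m) : CircleWinding (fun z => f z * g z) (n + m) :=
  HasLogWinding.mul hf hg

theorem CircleWinding.unique {f : ℂ → ℂ} {n m : ℤ} (hn : CircleWinding f n)
    (hm : CircleWinding f m) : n = m :=
  HasLogWinding.unique Real.two_pi_pos.le hn hm

theorem CircleWinding.ne_zero {f : ℂ → ℂ} {n : ℤ} (hn : CircleWinding f n) {z : ℂ}
    (hz : ‖z‖ = 1) : f z ≠ 0 := by
  obtain ⟨t, ht, htz⟩ : ∃ t ∈ Icc 0 (2 * π), Complex.exp (t * Complex.I) = z := by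
    obtain ⟨t, ht⟩ := (Complex.norm_eq_one_iff z).mp hz
    have hper : Function.Periodic (fun t : ℝ => Complex.exp (t * Complex.I)) (2 * π) := fun t => by
      push_cast; exact Complex.exp_mul_I_periodic t
    obtain ⟨y, hy, hyt⟩ := hper.exists_mem_Ico₀ Real.two_pi_pos t
    exact ⟨y, Ico_subset_Icc_self hy, hyt.symm.trans ht⟩
  rw [← htz]
  exact HasLogWinding.ne_zero hn ht

theorem continuous_comp_circle {f : ℂ → ℂ} (hf : ContinuousOn f (sphere 0 1)) :
    Continuous fun t : ℝ => f (Complex.exp (t * Complex.I)) :=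
  hf.comp_continuous (by fun_prop) fun t => by simp

theorem exists_circleWinding {f : ℂ → ℂ} (hf : ContinuousOn f (sphere 0 1))
    (h0 : ∀ z : ℂ, ‖z‖ = 1 → f z ≠ 0) : ∃ n, CircleWinding f n :=
  exists_hasLogWinding Real.two_pi_pos.le (continuous_comp_circle hf).continuousOn
    (fun t _ => h0 _ (norm_exp_mul_I t)) (by rw [exp_two_pi_mul_I]; simp)

theorem CircleWinding.of_norm_sub_lt {f g : ℂ → ℂ} {n : ℤ} (hn : CircleWinding f n)
    (hf : ContinuousOn f (sphere 0 1)) (hg : ContinuousOn g (sphere 0 1))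
    (h : ∀ z : ℂ, ‖z‖ = 1 → ‖g z - f z‖ < ‖f z‖) : CircleWinding g n :=
  HasLogWinding.of_norm_sub_lt hn (continuous_comp_circle hf).continuousOn
    (by rw [exp_two_pi_mul_I]; simp) (continuous_comp_circle hg).continuousOn
    (by rw [exp_two_pi_mul_I]; simp) fun t _ => h _ (norm_exp_mul_I t)

theorem circleWinding_const {a : ℂ} (ha : a ≠ 0) : CircleWinding (fun _ => a) 0 :=
  hasLogWinding_const ha _

theorem circleWinding_id : CircleWinding (fun z => z) 1 := hasLogWinding_exp

theorem circleWinding_sub_of_lt {a : ℂ} (ha : ‖a‖ < 1) : CircleWinding (fun z => z - a) 1 :=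
  circleWinding_id.of_norm_sub_lt continuousOn_id (by fun_prop) fun z hz => by simpa [hz] using ha

theorem circleWinding_sub_of_gt {a : ℂ} (ha : 1 < ‖a‖) : CircleWinding (fun z => z - a) 0 :=
  (circleWinding_const (a := -a) (by rintro h; simp_all; linarith)).of_norm_sub_lt
    continuousOn_const (by fun_prop) fun z hz => by simpa [hz] using ha

theorem CircleWinding.eq_zero_of_ne_zero {f : ℂ → ℂ} {n : ℤ} (hn : CircleWinding f n)
    (hf : ContinuousOn f (closedBall 0 1)) (h0 : ∀ z ∈ closedBall (0 : ℂ) 1, f z ≠ 0) :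
    n = 0 := by
  have hmem : ∀ r ∈ Icc (0 : ℝ) 1, ∀ t : ℝ,
      (r : ℂ) * Complex.exp (t * Complex.I) ∈ closedBall (0 : ℂ) 1 := by
    intro r hr t
    simp [abs_of_nonneg hr.1, hr.2]
  have h1 : HasLogWinding (fun t => f ((0 : ℝ) * Complex.exp (t * Complex.I))) (2 * π) n := by
    refine HasLogWinding.homotopy
      (F := fun (r : ℝ) (t : ℝ) => f (r * Complex.exp (t * Complex.I))) Real.two_pi_pos.le
      (isPreconnected_Icc (a := (0 : ℝ)) (b := 1)) ?_ ?_ ?_ (x := 1) (by simp) (by simp) ?_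
    · refine hf.comp (f := fun x : ℝ × ℝ => (x.1 : ℂ) * Complex.exp (x.2 * Complex.I))
        (by fun_prop) fun x hx => hmem _ hx.1 _
    · exact fun r hr t _ => h0 _ (hmem r hr t)
    · intro r _
      rw [exp_two_pi_mul_I]; simp
    · simpa [CircleWinding] using hn
  refine h1.unique Real.two_pi_pos.le ?_
  simpa using hasLogWinding_const (h0 0 (by simp)) (2 * π)

theorem circleWinding_prod_nonneg (m : Multiset ℂ) {n : ℤ}
    (hn : CircleWinding (fun z => (m.map fun a => z - a).prod) n) : 0 ≤ n := by
  induction m using Multiset.induction generalizing n with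
  | empty => simpa using (hn.unique (by simpa using circleWinding_const one_ne_zero)).ge
  | cons a m ih =>
    simp only [Multiset.map_cons, Multiset.prod_cons] at hn
    have h0 : ∀ z : ℂ, ‖z‖ = 1 → z - a ≠ 0 ∧ (m.map fun a => z - a).prod ≠ 0 := fun z hz =>
      mul_ne_zero_iff.mp (hn.ne_zero hz)
    obtain ⟨k, hk⟩ := exists_circleWinding (f := fun z => (m.map fun a => z - a).prod)
      (by
        refine Continuous.continuousOn ?_
        exact continuous_multiset_prod _ fun a _ => by fun_prop) fun z hz => (h0 z hz).2
    have hk0 := ih hk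
    rcases lt_trichotomy ‖a‖ 1 with ha | ha | ha
    · have := hn.unique ((circleWinding_sub_of_lt ha).mul hk)
      omega
    · exact absurd (sub_self a) (h0 a ha).1
    · have := hn.unique ((circleWinding_sub_of_gt ha).mul hk)
      omega

/-- Polynomials split, so each linear factor contributes `0` or `1`. -/
theorem circleWinding_polynomial_nonneg (P : Polynomial ℂ) {n : ℤ}
    (hn : CircleWinding (fun z => P.eval z) n) : 0 ≤ n := by
  have hP : P ≠ 0 := by
    rintro rfl
    exact hn.ne_zero (z := 1) (by simp) (by simp)
  have hlead : P.leadingCoeff ≠ 0 := by simpa using hP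
  have heq : ∀ z, P.eval z = P.leadingCoeff * (P.roots.map fun a => z - a).prod := fun z => by
    conv_lhs => rw [(IsAlgClosed.splits P).eq_prod_roots]
    simp [Polynomial.eval_multiset_prod]
  have h1 : CircleWinding (fun z => P.leadingCoeff⁻¹ * P.eval z) (0 + n) :=
    (circleWinding_const (inv_ne_zero hlead)).mul hn
  rw [zero_add] at h1
  refine circleWinding_prod_nonneg P.roots (h1.congr fun z _ => ?_)
  rw [heq, inv_mul_cancel_left₀ hlead]

/-- The winding number of a holomorphic function is nonnegative: approximate it by its Taylor
polynomials. -/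
theorem CircleWinding.nonneg {f : ℂ → ℂ} {n : ℤ} {R : ℝ} (hR : 1 < R)
    (hf : DifferentiableOn ℂ f (ball 0 R)) (hn : CircleWinding f n) : 0 ≤ n := by
  obtain ⟨r, hr1, hrR⟩ := exists_between hR
  lift r to NNReal using by linarith
  obtain ⟨r', hr1', hr'⟩ := exists_between hr1
  lift r' to NNReal using by linarith
  have hp := (hf.mono (closedBall_subset_ball hrR)).hasFPowerSeriesOnBall (R := r)
    (by exact_mod_cast zero_lt_one.trans hr1)
  have hsub : sphere (0 : ℂ) 1 ⊆ ball 0 R := fun z hz => by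
    simp only [mem_sphere_iff_norm, sub_zero] at hz; simpa [hz] using hR
  have hfc := hf.continuousOn.mono hsub
  obtain ⟨z₀, hz₀, hmin⟩ := (isCompact_sphere (0 : ℂ) 1).exists_isMinOn ⟨1, by simp⟩ hfc.norm
  have hpos : 0 < ‖f z₀‖ := norm_pos_iff.mpr (hn.ne_zero (by simpa using hz₀))
  obtain ⟨N, hN⟩ := (Metric.tendstoUniformlyOn_iff.mp
    (hp.tendstoUniformlyOn (r' := r') (by exact_mod_cast hr')) _ hpos).exists
  set p := cauchyPowerSeries f 0 r
  set P : Polynomial ℂ := ∑ k ∈ Finset.range N, Polynomial.monomial k (p.coeff k)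
  refine circleWinding_polynomial_nonneg P (hn.of_norm_sub_lt hfc P.continuous.continuousOn ?_)
  intro z hz
  have h1 := hN z (by simpa [hz] using hr1')
  rw [zero_add, dist_comm, dist_eq_norm] at h1
  have h2 : P.eval z = p.partialSum N z := by
    simp [P, Polynomial.eval_finsetSum, FormalMultilinearSeries.partialSum, mul_comm]
  rw [h2]
  exact h1.trans_le (hmin (show z ∈ sphere (0 : ℂ) 1 by simpa using hz))

theorem CircleWinding.factor {f : ℂ → ℂ} {n : ℤ} {R : ℝ} (hR : 1 < R)
    (hf : DifferentiableOn ℂ f (ball 0 R)) (hn : CircleWinding f n) {a : ℂ} (ha : ‖a‖ < 1)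
    (hfa : f a = 0) : DifferentiableOn ℂ (dslope f a) (ball 0 R) ∧
      CircleWinding (dslope f a) (n - 1) ∧ ∀ z, f z = (z - a) * dslope f a z := by
  have hd : DifferentiableOn ℂ (dslope f a) (ball 0 R) :=
    (Complex.differentiableOn_dslope (isOpen_ball.mem_nhds (by simp; linarith))).mpr hf
  have heq : ∀ z, f z = (z - a) * dslope f a z := fun z => by
    have := sub_smul_dslope f a z
    simp only [hfa, sub_zero, smul_eq_mul] at this
    exact this.symm
  have hsub : sphere (0 : ℂ) 1 ⊆ ball 0 R := fun z hz => by
    simp only [mem_sphere_iff_norm, sub_zero] at hz; simpa [hz] using hR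
  obtain ⟨k, hk⟩ := exists_circleWinding (hd.continuousOn.mono hsub) fun z hz h => by
    apply hn.ne_zero hz
    rw [heq, h, mul_zero]
  have h1 : CircleWinding f (1 + k) :=
    ((circleWinding_sub_of_lt ha).mul hk).congr fun z _ => heq z
  have h2 := hn.unique h1
  exact ⟨hd, by rwa [h2, add_sub_cancel_left], heq⟩

theorem CircleWinding.ne_zero_of_winding_zero {f : ℂ → ℂ} {R : ℝ} (hR : 1 < R)
    (hf : DifferentiableOn ℂ f (ball 0 R)) (hn : CircleWinding f 0) {z : ℂ} (hz : ‖z‖ ≤ 1) :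
    f z ≠ 0 := by
  intro h
  rcases hz.lt_or_eq with hz | hz
  · obtain ⟨hd, hw, -⟩ := hn.factor hR hf hz h
    have := hw.nonneg hR hd
    omega
  · exact hn.ne_zero hz h

theorem CircleWinding.two_le {f : ℂ → ℂ} {R : ℝ} (hR : 1 < R) {n : ℤ}
    (hf : DifferentiableOn ℂ f (ball 0 R)) (hn : CircleWinding f n) {a b : ℂ} (ha : ‖a‖ < 1)
    (hb : ‖b‖ < 1) (hab : a ≠ b) (hfa : f a = 0) (hfb : f b = 0) : 2 ≤ n := by
  obtain ⟨hd, hw, heq⟩ := hn.factor hR hf ha hfa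
  have hb0 : dslope f a b = 0 := by
    have := heq b
    rw [hfb, eq_comm, mul_eq_zero] at this
    exact this.resolve_left (sub_ne_zero.mpr hab.symm)
  obtain ⟨hd', hw', -⟩ := hw.factor hR hd hb hb0
  have := hw'.nonneg hR hd'
  omega

theorem CircleWinding.existsUnique_zero {f : ℂ → ℂ} {R : ℝ} (hR : 1 < R)
    (hf : DifferentiableOn ℂ f (ball 0 R)) (hn : CircleWinding f 1) :
    ∃ a : ℂ, ‖a‖ < 1 ∧ f a = 0 ∧ deriv f a ≠ 0 ∧ ∀ z : ℂ, ‖z‖ ≤ 1 → f z = 0 → z = a := by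
  obtain ⟨a, ha, hfa⟩ : ∃ a ∈ closedBall (0 : ℂ) 1, f a = 0 := by
    by_contra! h
    have := hn.eq_zero_of_ne_zero (hf.continuousOn.mono (closedBall_subset_ball hR)) h
    omega
  have ha1 : ‖a‖ < 1 := by
    rcases (mem_closedBall_zero_iff.mp ha).lt_or_eq with h | h
    · exact h
    · exact absurd hfa (hn.ne_zero h)
  obtain ⟨hd, hw, heq⟩ := hn.factor hR hf ha1 hfa
  have hne : ∀ z : ℂ, ‖z‖ ≤ 1 → dslope f a z ≠ 0 := fun z hz =>
    CircleWinding.ne_zero_of_winding_zero hR hd (by simpa using hw) hz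
  refine ⟨a, ha1, hfa, ?_, fun z hz hfz => ?_⟩
  · rw [← dslope_same]; exact hne a ha1.le
  · rw [heq, mul_eq_zero] at hfz
    exact sub_eq_zero.mp (hfz.resolve_right (hne z hz))

/-! ### Interior and exterior of a closed curve -/

/-- The winding number is constant on components of the complement, and zero far away. -/
theorem hasLogWinding_of_mem_outside {c : ℝ → ℂ} {L : ℝ} (hL : 0 ≤ L)
    (hc : ContinuousOn c (Icc 0 L)) (hcl : c L = c 0) {w : ℂ}
    (hw : w ∈ outside (c '' Icc 0 L)) : HasLogWinding (fun t => c t - w) L 0 := by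
  obtain ⟨hwS, hub⟩ := hw
  set C := connectedComponentIn (c '' Icc 0 L)ᶜ w
  obtain ⟨M, hM⟩ := (isCompact_Icc.image_of_continuousOn hc).isBounded.exists_norm_le
  have hwC : w ∈ C := mem_connectedComponentIn hwS
  -- a point of the component that is farther from the origin than the whole curve
  obtain ⟨w₁, hw₁, hlarge⟩ : ∃ w₁ ∈ C, M < ‖w₁‖ := by
    by_contra! h
    exact hub (isBounded_iff_forall_norm_le.mpr ⟨M, h⟩)
  have hM0 : 0 ≤ M := (norm_nonneg _).trans (hM (c 0) ⟨0, ⟨le_rfl, hL⟩, rfl⟩)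
  have hw₁0 : w₁ ≠ 0 := norm_pos_iff.mp (hM0.trans_lt hlarge)
  refine HasLogWinding.homotopy (F := fun w t => c t - w) hL isPreconnected_connectedComponentIn
    ?_ ?_ ?_ hw₁ hwC ?_
  · refine ContinuousOn.sub (hc.comp continuousOn_snd fun x hx => hx.2) continuousOn_fst
  · intro x hx t ht h
    exact connectedComponentIn_subset _ _ hx ⟨t, ht, sub_eq_zero.mp h⟩
  · simp [hcl]
  · refine (hasLogWinding_const (neg_ne_zero.mpr hw₁0) L).of_norm_sub_lt continuousOn_const rfl
      (hc.sub continuousOn_const) (by simp [hcl]) fun t ht => ?_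
    simpa using (hM _ ⟨t, ht, rfl⟩).trans_lt hlarge

theorem norm_lt_one_of_mem_inside {S : Set ℂ} (hS : S ⊆ closedBall 0 1) {w : ℂ}
    (hw : w ∈ inside S) : ‖w‖ < 1 := by
  by_contra! h
  obtain ⟨hwS, hb⟩ := hw
  -- otherwise the ray from `w` away from the origin avoids `S`
  have hray : (fun t : ℝ => (t : ℂ) * w) '' Ici 1 ⊆ connectedComponentIn Sᶜ w := by
    refine IsPreconnected.subset_connectedComponentIn
      (isPreconnected_Ici.image _ (by fun_prop)) ⟨1, by simp⟩ ?_
    rintro _ ⟨t, ht, rfl⟩ hmem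
    rcases (mem_Ici.mp ht).eq_or_lt with rfl | ht1
    · exact hwS (by simpa using hmem)
    · have h1 := mem_closedBall_zero_iff.mp (hS hmem)
      rw [norm_mul, Complex.norm_real, Real.norm_of_nonneg (by linarith)] at h1
      nlinarith
  obtain ⟨M, hM⟩ := hb.exists_norm_le
  have h1 := hM _ (hray ⟨max M 0 + 1, by simp, rfl⟩)
  have h2 := le_max_left M 0
  have h3 := le_max_right M 0
  simp only [norm_mul, Complex.norm_real] at h1
  rw [Real.norm_of_nonneg (by linarith)] at h1
  nlinarith

/-! ### Divided differences of powers -/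

/-- The divided difference `(a ^ n - b ^ n) / (a - b)`. -/
def powDiff : ℕ → ℂ → ℂ → ℂ
  | 0, _, _ => 0
  | n + 1, a, b => a * powDiff n a b + b ^ n

/-- The second divided difference of the `n`-th power at `y`, `a` and `b`. -/
def powDiff₂ : ℕ → ℂ → ℂ → ℂ → ℂ
  | 0, _, _, _ => 0
  | n + 1, y, a, b => y * powDiff₂ n y a b + powDiff n a b

theorem sub_mul_powDiff (n : ℕ) (a b : ℂ) : (a - b) * powDiff n a b = a ^ n - b ^ n := by
  induction n with
  | zero => simp [powDiff]
  | succ n ih => rw [powDiff, pow_succ, pow_succ]; linear_combination a * ih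

theorem powDiff_comm (n : ℕ) (a b : ℂ) : powDiff n a b = powDiff n b a := by
  induction n with
  | zero => rfl
  | succ n ih =>
    have := sub_mul_powDiff n a b
    rw [powDiff, powDiff, ← ih]; linear_combination this

theorem powDiff₂_comm (n : ℕ) (y a b : ℂ) : powDiff₂ n y a b = powDiff₂ n y b a := by
  induction n with
  | zero => rfl
  | succ n ih => rw [powDiff₂, powDiff₂, ih, powDiff_comm]

theorem sub_mul_powDiff₂ (n : ℕ) (y a b : ℂ) :
    (y - b) * powDiff₂ n y a b = powDiff n y a - powDiff n b a := by
  induction n with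
  | zero => simp [powDiff, powDiff₂]
  | succ n ih =>
    rw [powDiff, powDiff, powDiff₂, powDiff_comm n a b]; linear_combination y * ih

theorem norm_powDiff_le (n : ℕ) {a b : ℂ} (ha : ‖a‖ ≤ 1) (hb : ‖b‖ ≤ 1) :
    ‖powDiff n a b‖ ≤ n := by
  induction n with
  | zero => simp [powDiff]
  | succ n ih =>
    refine (norm_add_le _ _).trans ?_
    rw [norm_mul, norm_pow]
    push_cast
    have := pow_le_one₀ (n := n) (norm_nonneg b) hb
    nlinarith [norm_nonneg a, norm_nonneg (powDiff n a b)]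

theorem norm_powDiff_lt {n : ℕ} (hn : 2 ≤ n) {a b : ℂ} (ha : ‖a‖ < 1) (hb : ‖b‖ ≤ 1) :
    ‖powDiff n a b‖ < n := by
  obtain ⟨m, rfl⟩ : ∃ m, n = m + 1 := ⟨n - 1, by omega⟩
  have hm : (1 : ℝ) ≤ m := by exact_mod_cast (by omega : 1 ≤ m)
  refine (norm_add_le _ _).trans_lt ?_
  rw [norm_mul, norm_pow]
  push_cast
  have := pow_le_one₀ (n := m) (norm_nonneg b) hb
  have := norm_powDiff_le m ha.le hb
  nlinarith [norm_nonneg a, norm_nonneg (powDiff m a b)]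

theorem norm_powDiff₂_le (n : ℕ) {y a b : ℂ} (hy : ‖y‖ ≤ 1) (ha : ‖a‖ ≤ 1) (hb : ‖b‖ ≤ 1) :
    ‖powDiff₂ n y a b‖ ≤ (n : ℝ) ^ 2 := by
  induction n with
  | zero => simp [powDiff₂]
  | succ n ih =>
    refine (norm_add_le _ _).trans ?_
    rw [norm_mul]
    push_cast
    have := norm_powDiff_le n ha hb
    nlinarith [norm_nonneg y, norm_nonneg (powDiff₂ n y a b)]

theorem continuous_powDiff (n : ℕ) : Continuous fun x : ℂ × ℂ => powDiff n x.1 x.2 := by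
  induction n with
  | zero => exact continuous_const
  | succ n ih => simp only [powDiff]; fun_prop

theorem continuous_powDiff₂ (n : ℕ) :
    Continuous fun x : ℂ × ℂ × ℂ => powDiff₂ n x.1 x.2.1 x.2.2 := by
  induction n with
  | zero => exact continuous_const
  | succ n ih =>
    simp only [powDiff₂]
    exact (continuous_fst.mul ih).add ((continuous_powDiff n).comp continuous_snd)

/-! ### The weights as coefficients of a power series -/

/-- The coefficient of `x ^ i * y ^ j` in the power series `x * y - kernel p x y`. -/
def coef (p : ℤ → ℤ → ℝ) (n : ℕ × ℕ) : ℝ := p (1 - n.1) (1 - n.2)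

/-- The power of `y` by which `kernel p (u * y) y` is divisible. -/
noncomputable def defect (p : ℤ → ℤ → ℝ) : ℕ := open Classical in if p 1 1 = 0 then 1 else 0

/-- The kernel in the coordinates `u = x / y` and `y`, divided by the power `y ^ defect p`. -/
noncomputable def ratioKernel (p : ℤ → ℤ → ℝ) (u y : ℂ) : ℂ :=
  u * y ^ (2 - defect p) - ∑' n : ℕ × ℕ, (coef p n : ℂ) * u ^ n.1 * y ^ (n.1 + n.2 - defect p)

variable {p : ℤ → ℤ → ℝ}

theorem hasSum_coef_iff {E : Type*} [NormedAddCommGroup E] (f : ℤ × ℤ → E) {a : E}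
    (hf : ∀ z : ℤ × ℤ, 2 ≤ z.1 ∨ 2 ≤ z.2 → f z = 0) :
    HasSum (fun n : ℕ × ℕ => f (1 - (n.1 : ℤ), 1 - (n.2 : ℤ))) a ↔ HasSum f a := by
  refine Function.Injective.hasSum_iff
    (g := fun n : ℕ × ℕ => ((1 - (n.1 : ℤ), 1 - (n.2 : ℤ)) : ℤ × ℤ))
    (fun m n h => ?_) fun z hz => hf z ?_
  · simp only [Prod.mk.injEq] at h
    ext <;> omega
  · by_contra! h
    exact hz ⟨((1 - z.1).toNat, (1 - z.2).toNat), by ext <;> simp <;> omega⟩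

theorem tsum_coef {E : Type*} [NormedAddCommGroup E] (f : ℤ × ℤ → E)
    (hf : ∀ z : ℤ × ℤ, 2 ≤ z.1 ∨ 2 ≤ z.2 → f z = 0) :
    ∑' n : ℕ × ℕ, f (1 - (n.1 : ℤ), 1 - (n.2 : ℤ)) = ∑' z, f z := by
  refine Function.Injective.tsum_eq (g := fun n : ℕ × ℕ => ((1 - (n.1 : ℤ), 1 - (n.2 : ℤ)) : ℤ × ℤ))
    (fun m n h => ?_) fun z hz => ?_
  · simp only [Prod.mk.injEq] at h
    ext <;> omega
  · by_contra hz'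
    refine hz (hf z ?_)
    by_contra! h
    exact hz' ⟨((1 - z.1).toNat, (1 - z.2).toNat), by ext <;> simp <;> omega⟩

namespace IsWalk

theorem coef_nonneg (hp : IsWalk p) (n : ℕ × ℕ) : 0 ≤ coef p n := hp.nonneg _ _

theorem hasSum_coef (hp : IsWalk p) : HasSum (coef p) 1 :=
  (hasSum_coef_iff (fun z => p z.1 z.2) fun _ hz => hp.small_positive_jumps _ _ hz).mpr hp.sum_one

theorem hasSum_fst (hp : IsWalk p) : HasSum (fun n : ℕ × ℕ => (n.1 : ℝ) * coef p n) 1 := by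
  have h := (hasSum_coef_iff (fun z => (z.1 : ℝ) * p z.1 z.2) fun z hz => by
    rw [hp.small_positive_jumps _ _ hz, mul_zero]).mpr hp.drift_fst
  have h2 := hp.hasSum_coef.sub h
  rw [sub_zero] at h2
  refine h2.congr_fun ?_
  intro n
  simp only [coef]; push_cast; ring

theorem hasSum_snd (hp : IsWalk p) : HasSum (fun n : ℕ × ℕ => (n.2 : ℝ) * coef p n) 1 := by
  have h := (hasSum_coef_iff (fun z => (z.2 : ℝ) * p z.1 z.2) fun z hz => by
    rw [hp.small_positive_jumps _ _ hz, mul_zero]).mpr hp.drift_snd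
  have h2 := hp.hasSum_coef.sub h
  rw [sub_zero] at h2
  refine h2.congr_fun ?_
  intro n
  simp only [coef]; push_cast; ring

theorem summable_sq (hp : IsWalk p) :
    Summable fun n : ℕ × ℕ => ((n.1 + n.2 : ℕ) : ℝ) ^ 2 * coef p n := by
  have h := ((hasSum_coef_iff (fun z => ((z.1 : ℝ) ^ 2 + (z.2 : ℝ) ^ 2) * p z.1 z.2) fun z hz => by
    rw [hp.small_positive_jumps _ _ hz, mul_zero]).mpr hp.moments.hasSum).summable
  refine Summable.of_nonneg_of_le (fun n => mul_nonneg (sq_nonneg _) (hp.coef_nonneg n))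
    (fun n => ?_) ((hp.hasSum_coef.summable.mul_left 12).add (h.mul_left 3))
  have h0 := hp.coef_nonneg n
  have h1 : ((n.1 + n.2 : ℕ) : ℝ) ^ 2 ≤
      12 + 3 * ((1 - (n.1 : ℝ)) ^ 2 + (1 - (n.2 : ℝ)) ^ 2) := by
    push_cast
    nlinarith [sq_nonneg ((n.1 : ℝ) - n.2), sq_nonneg ((n.1 : ℝ) - 3), sq_nonneg ((n.2 : ℝ) - 3)]
  refine (mul_le_mul_of_nonneg_right h1 h0).trans (le_of_eq ?_)
  simp only [coef]; push_cast; ring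

end IsWalk

theorem kernel_eq (hp : IsWalk p) (x y : ℂ) :
    kernel p x y = x * y - ∑' n : ℕ × ℕ, (coef p n : ℂ) * x ^ n.1 * y ^ n.2 := by
  rw [kernel, ← tsum_coef (fun z => (p z.1 z.2 : ℂ) * x ^ (1 - z.1) * y ^ (1 - z.2))
    fun z hz => by simp [hp.small_positive_jumps _ _ hz]]
  simp [coef]

theorem aperiodic_coef (hp : IsWalk p) {x y : ℂ} (hx : ‖x‖ = 1) (hy : ‖y‖ = 1)
    (h : ‖∑' n : ℕ × ℕ, (coef p n : ℂ) * x ^ n.1 * y ^ n.2‖ = 1) : x = 1 ∧ y = 1 := by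
  have hx0 : x ≠ 0 := by rintro rfl; simp at hx
  have hy0 : y ≠ 0 := by rintro rfl; simp at hy
  have h1 := hp.aperiodic x⁻¹ y⁻¹ (by simp [hx]) (by simp [hy]) (by
    rw [← h, ← tsum_coef (fun z => (p z.1 z.2 : ℂ) * x⁻¹ ^ z.1 * y⁻¹ ^ z.2)
      fun z hz => by simp [hp.small_positive_jumps _ _ hz]]
    have : ∀ n : ℕ × ℕ, (p (1 - (n.1 : ℤ)) (1 - (n.2 : ℤ)) : ℂ) * x⁻¹ ^ (1 - (n.1 : ℤ)) *
        y⁻¹ ^ (1 - (n.2 : ℤ)) = (x⁻¹ * y⁻¹) * ((coef p n : ℂ) * x ^ n.1 * y ^ n.2) := fun n => by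
      rw [inv_zpow', inv_zpow', neg_sub, neg_sub, zpow_sub₀ hx0, zpow_sub₀ hy0]
      simp only [coef, zpow_natCast, zpow_one]
      field_simp
    simp only [this]
    rw [tsum_mul_left, norm_mul, norm_mul, norm_inv, norm_inv, hx, hy]
    simp)
  exact ⟨inv_eq_one.mp h1.1, inv_eq_one.mp h1.2⟩

theorem defect_cases (p : ℤ → ℤ → ℝ) :
    (p 1 1 ≠ 0 ∧ defect p = 0 ∧ period p = 2 * π) ∨ (p 1 1 = 0 ∧ defect p = 1 ∧ period p = π) := by
  by_cases h : p 1 1 = 0 <;> simp [defect, period, h]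

theorem defect_le_or_coef_eq_zero (p : ℤ → ℤ → ℝ) (n : ℕ × ℕ) :
    defect p ≤ n.1 + n.2 ∨ coef p n = 0 := by
  rcases defect_cases p with h | h
  · left; omega
  · rw [h.2.1]
    by_cases hn : 1 ≤ n.1 + n.2
    · exact Or.inl hn
    · right
      have h1 : n.1 = 0 := by omega
      have h2 : n.2 = 0 := by omega
      simp [coef, h1, h2, h.1]

theorem kernel_mul_self (hp : IsWalk p) (u y : ℂ) :
    kernel p (u * y) y = y ^ defect p * ratioKernel p u y := by
  have h : ∀ n : ℕ × ℕ, (coef p n : ℂ) * (u * y) ^ n.1 * y ^ n.2 =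
      y ^ defect p * ((coef p n : ℂ) * u ^ n.1 * y ^ (n.1 + n.2 - defect p)) := fun n => by
    rcases defect_le_or_coef_eq_zero p n with h | h
    · have : y ^ n.1 * y ^ n.2 = y ^ defect p * y ^ (n.1 + n.2 - defect p) := by
        rw [← pow_add, ← pow_add]; congr 1; omega
      rw [mul_pow]; linear_combination (coef p n : ℂ) * u ^ n.1 * this
    · simp [h]
  rw [kernel_eq hp, ratioKernel]
  simp only [h]
  rw [tsum_mul_left, mul_sub]
  congr 1
  have : y ^ defect p * y ^ (2 - defect p) = y ^ 2 := by
    rw [← pow_add]; congr 1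
    rcases defect_cases p with h | h <;> omega
  linear_combination (-u) * this

/-! ### Implicit functions and persistence of zeros -/

/-- The implicit function theorem for one complex equation in two complex unknowns. -/
theorem exists_hasDerivAt_implicit {F F₁ F₂ : ℂ → ℂ → ℂ} {O : Set (ℂ × ℂ)} (hO : IsOpen O)
    (h₁ : ∀ v ∈ O, HasDerivAt (fun x => F x v.2) (F₁ v.1 v.2) v.1)
    (h₂ : ∀ v ∈ O, HasDerivAt (fun y => F v.1 y) (F₂ v.1 v.2) v.2)
    (c₁ : ContinuousOn (Function.uncurry F₁) O) (c₂ : ContinuousOn (Function.uncurry F₂) O)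
    {a b : ℂ} (hab : (a, b) ∈ O) (hF : F a b = 0) (hne : F₂ a b ≠ 0) :
    ∃ ψ : ℂ → ℂ, ψ a = b ∧ (∀ᶠ x in 𝓝 a, ContinuousAt ψ x) ∧
      HasDerivAt ψ (-(F₁ a b) / F₂ a b) a ∧
      ∀ᶠ v in 𝓝 (a, b), F v.1 v.2 = 0 ↔ ψ v.1 = v.2 := by
  have hOn := hO.mem_nhds hab
  let f₁ : ℂ → ℂ → ℂ →L[ℂ] ℂ := fun x y => ContinuousLinearMap.toSpanSingleton ℂ (F₁ x y)
  let f₂ : ℂ → ℂ → ℂ →L[ℂ] ℂ := fun x y => ContinuousLinearMap.toSpanSingleton ℂ (F₂ x y)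
  have d₁ : ∀ᶠ v in 𝓝 (a, b), HasFDerivAt (fun x => F x v.2) (f₁ v.1 v.2) v.1 := by
    filter_upwards [hOn] with v hv using (h₁ v hv).hasFDerivAt
  have d₂ : ∀ᶠ v in 𝓝 (a, b), HasFDerivAt (fun y => F v.1 y) (f₂ v.1 v.2) v.2 := by
    filter_upwards [hOn] with v hv using (h₂ v hv).hasFDerivAt
  have e₁ : ContinuousAt (Function.uncurry f₁) (a, b) :=
    ((ContinuousLinearMap.toSpanSingletonCLE (𝕜 := ℂ) (E := ℂ)).continuous.continuousAt).comp
      (c₁.continuousAt hOn)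
  have e₂ : ContinuousAt (Function.uncurry f₂) (a, b) :=
    ((ContinuousLinearMap.toSpanSingletonCLE (𝕜 := ℂ) (E := ℂ)).continuous.continuousAt).comp
      (c₂.continuousAt hOn)
  let e : ℂ ≃L[ℂ] ℂ := ContinuousLinearEquiv.unitsEquivAut ℂ (Units.mk0 _ hne)
  have he : (e : ℂ →L[ℂ] ℂ) = f₂ a b := by
    ext; simp [e, f₂]
  have hinv : (f₂ a b).IsInvertible := ⟨e, he⟩
  have hs := hasStrictFDerivAt_implicitFunctionOfBivariate d₁ d₂ e₁ e₂ hinv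
  have hiff := eventually_apply_eq_iff_implicitFunctionOfBivariate d₁ d₂ e₁ e₂ hinv
  set ψ := implicitFunctionOfBivariate d₁ d₂ e₁ e₂ hinv
  rw [hF] at hiff
  refine ⟨ψ, hiff.self_of_nhds.mp hF, ?_, ?_, hiff⟩
  · obtain ⟨K, s, hs, hl⟩ := hs.exists_lipschitzOnWith
    filter_upwards [eventually_mem_nhds_iff.mpr hs] with x hx
    exact hl.continuousOn.continuousAt hx
  · refine hs.hasFDerivAt.hasDerivAt.congr_deriv ?_
    have h3 : (f₂ a b).inverse = (e.symm : ℂ →L[ℂ] ℂ) := by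
      rw [← he, ContinuousLinearMap.inverse_equiv]
    simp only [neg_apply, ContinuousLinearMap.comp_apply, h3]
    simp [e, f₁, div_eq_mul_inv]

theorem exists_analyticAt_implicit {F F₁ F₂ : ℂ → ℂ → ℂ} {O : Set (ℂ × ℂ)} (hO : IsOpen O)
    (h₁ : ∀ v ∈ O, HasDerivAt (fun x => F x v.2) (F₁ v.1 v.2) v.1)
    (h₂ : ∀ v ∈ O, HasDerivAt (fun y => F v.1 y) (F₂ v.1 v.2) v.2)
    (c₁ : ContinuousOn (Function.uncurry F₁) O) (c₂ : ContinuousOn (Function.uncurry F₂) O)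
    {a b : ℂ} (hab : (a, b) ∈ O) (hF : F a b = 0) (hne : F₂ a b ≠ 0) :
    ∃ ψ : ℂ → ℂ, ψ a = b ∧ AnalyticAt ℂ ψ a ∧
      HasDerivAt ψ (-(F₁ a b) / F₂ a b) a ∧
      ∀ᶠ v in 𝓝 (a, b), F v.1 v.2 = 0 ↔ ψ v.1 = v.2 := by
  obtain ⟨ψ, hψ, hc, hd, hiff⟩ := exists_hasDerivAt_implicit hO h₁ h₂ c₁ c₂ hab hF hne
  refine ⟨ψ, hψ, ?_, hd, hiff⟩
  rw [Complex.analyticAt_iff_eventually_differentiableAt]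
  have hgraph : Tendsto (fun x => (x, ψ x)) (𝓝 a) (𝓝 (a, b)) := by
    have := hc.self_of_nhds.tendsto
    rw [hψ] at this
    exact tendsto_id.prodMk_nhds this
  have hne' : ∀ᶠ v in 𝓝 (a, b), F₂ v.1 v.2 ≠ 0 :=
    (c₂.continuousAt (hO.mem_nhds hab)).eventually_ne hne
  filter_upwards [hc, hgraph.eventually (hO.mem_nhds hab), hgraph.eventually hne',
    hgraph.eventually hiff.eventually_nhds] with x hcx hxO hxne hxiff
  -- near `x`, the function `ψ` is the implicit function based at the point `(x, ψ x)`
  obtain ⟨χ, hχ, -, hχd, hχiff⟩ := exists_hasDerivAt_implicit hO h₁ h₂ c₁ c₂ hxO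
    (hxiff.self_of_nhds.mpr rfl) hxne
  refine (hχd.congr_of_eventuallyEq ?_).differentiableAt
  have hgx : Tendsto (fun x => (x, ψ x)) (𝓝 x) (𝓝 (x, ψ x)) := tendsto_id.prodMk_nhds hcx.tendsto
  filter_upwards [hgx.eventually hxiff, hgx.eventually hχiff] with z hz1 hz2
  exact (hz2.mp (hz1.mpr rfl)).symm

/-- Zeros of holomorphic functions persist under small perturbations. -/
theorem eventually_exists_zero {α : Type*} {l : Filter α} {F : α → ℂ → ℂ} {f : ℂ → ℂ} {c : ℂ}
    {r₀ : ℝ} (hr₀ : 0 < r₀) (hf : DifferentiableOn ℂ f (ball c r₀))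
    (hF : ∀ᶠ a in l, DifferentiableOn ℂ (F a) (ball c r₀))
    (hlim : TendstoUniformlyOn F f l (ball c r₀)) (hc : f c = 0)
    (hne : ¬ ∀ᶠ z in 𝓝 c, f z = 0) {r : ℝ} (hr : 0 < r) :
    ∀ᶠ a in l, ∃ z ∈ closedBall c r, F a z = 0 := by
  have han : AnalyticAt ℂ f c := hf.analyticAt (ball_mem_nhds c hr₀)
  have hpunct := (han.eventually_eq_zero_or_eventually_ne_zero).resolve_left hne
  rw [eventually_nhdsWithin_iff, Metric.eventually_nhds_iff] at hpunct
  obtain ⟨r₁, hr₁, hne₁⟩ := hpunct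
  obtain ⟨δ, hδ, hδlt⟩ := exists_between (lt_min hr (lt_min hr₀ hr₁))
  simp only [lt_min_iff] at hδlt
  obtain ⟨hδr, hδr₀, hδr₁⟩ := hδlt
  have hsub : closedBall c δ ⊆ ball c r₀ := closedBall_subset_ball hδr₀
  obtain ⟨z₀, hz₀, hmin⟩ := (isCompact_sphere c δ).exists_isMinOn
    (NormedSpace.sphere_nonempty.mpr hδ.le)
    ((hf.continuousOn.mono (sphere_subset_closedBall.trans hsub)).norm)
  have hm : 0 < ‖f z₀‖ := by
    refine norm_pos_iff.mpr (hne₁ ?_ ?_)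
    · rw [mem_sphere.mp hz₀]; exact hδr₁
    · intro h
      rw [mem_singleton_iff] at h
      rw [mem_sphere, h, dist_self] at hz₀
      exact hδ.ne hz₀
  filter_upwards [hF, Metric.tendstoUniformlyOn_iff.mp hlim (‖f z₀‖ / 4) (by positivity)]
    with a hFa hclose
  have hcc : ‖F a c‖ < ‖f z₀‖ / 4 := by
    have := hclose c (mem_ball_self hr₀)
    rwa [hc, dist_zero_left] at this
  have hsph : ∀ z ∈ sphere c δ, ‖f z₀‖ / 2 ≤ ‖F a z - F a c‖ := by
    intro z hz
    have h1 := hclose z (hsub (sphere_subset_closedBall hz))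
    rw [dist_eq_norm] at h1
    have h2 : ‖f z₀‖ ≤ ‖f z‖ := hmin hz
    have h3 : ‖f z‖ ≤ ‖f z - F a z‖ + ‖F a z - F a c‖ + ‖F a c‖ := by
      have : f z = (f z - F a z) + (F a z - F a c) + F a c := by ring
      conv_lhs => rw [this]
      exact norm_add₃_le
    linarith
  have hball := DiffContOnCl.ball_subset_image_closedBall (f := F a) (z₀ := c) (r := δ)
    (ε := ‖f z₀‖ / 2)
    (DifferentiableOn.diffContOnCl (hFa.mono ((closure_ball_subset_closedBall).trans hsub)))
    hδ hsph ?_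
  · obtain ⟨z, hz, hz0⟩ := hball (show (0 : ℂ) ∈ ball (F a c) (‖f z₀‖ / 2 / 2) by
      rw [mem_ball, dist_zero_left]; linarith)
    exact ⟨z, closedBall_subset_closedBall hδr.le hz, hz0⟩
  · -- a function that is constant near `c` would be constant on the circle around `c`
    intro hconst
    simp only [not_not] at hconst
    have heq := (hFa.analyticOnNhd isOpen_ball).eqOn_of_preconnected_of_eventuallyEq
      analyticOnNhd_const (convex_ball c r₀).isPreconnected (mem_ball_self hr₀) hconst
    have h1 := hsph z₀ hz₀
    rw [heq (hsub (sphere_subset_closedBall hz₀)), sub_self, norm_zero] at h1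
    linarith

/-! ### Regularity of the kernel -/

variable {p : ℤ → ℤ → ℝ}

/-- The derivative of `ratioKernel p u y` with respect to `u`. -/
noncomputable def ratioKernelDeriv₁ (p : ℤ → ℤ → ℝ) (u y : ℂ) : ℂ :=
  y ^ (2 - defect p) -
    ∑' n : ℕ × ℕ, (coef p n : ℂ) * (n.1 * u ^ (n.1 - 1)) * y ^ (n.1 + n.2 - defect p)

/-- The derivative of `ratioKernel p u y` with respect to `y`. -/
noncomputable def ratioKernelDeriv₂ (p : ℤ → ℤ → ℝ) (u y : ℂ) : ℂ :=
  u * ((2 - defect p : ℕ) * y ^ (2 - defect p - 1)) -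
    ∑' n : ℕ × ℕ, (coef p n : ℂ) * u ^ n.1 *
      ((n.1 + n.2 - defect p : ℕ) * y ^ (n.1 + n.2 - defect p - 1))

theorem norm_coef (hp : IsWalk p) (n : ℕ × ℕ) : ‖(coef p n : ℂ)‖ = coef p n := by
  rw [Complex.norm_real, Real.norm_of_nonneg (hp.coef_nonneg n)]

theorem norm_ratioKernel_term_le (hp : IsWalk p) {u y : ℂ} (hu : ‖u‖ ≤ 1) (hy : ‖y‖ ≤ 1)
    (n : ℕ × ℕ) (N : ℕ) : ‖(coef p n : ℂ) * u ^ n.1 * y ^ N‖ ≤ coef p n := by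
  rw [norm_mul, norm_mul, norm_coef hp, norm_pow, norm_pow]
  have h1 := pow_le_one₀ (n := n.1) (norm_nonneg u) hu
  have h2 := pow_le_one₀ (n := N) (norm_nonneg y) hy
  have h3 := hp.coef_nonneg n
  calc coef p n * ‖u‖ ^ n.1 * ‖y‖ ^ N ≤ coef p n * 1 * 1 := by gcongr
    _ = coef p n := by ring

theorem continuousOn_ratioKernel (hp : IsWalk p) :
    ContinuousOn (Function.uncurry (ratioKernel p)) (closedBall 0 1 ×ˢ closedBall 0 1) := by
  have h : ContinuousOn (fun v : ℂ × ℂ => ∑' n : ℕ × ℕ,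
      (coef p n : ℂ) * v.1 ^ n.1 * v.2 ^ (n.1 + n.2 - defect p))
      (closedBall 0 1 ×ˢ closedBall 0 1) :=
    continuousOn_tsum (fun n => by fun_prop) hp.hasSum_coef.summable fun n v hv =>
      norm_ratioKernel_term_le hp (mem_closedBall_zero_iff.mp hv.1)
        (mem_closedBall_zero_iff.mp hv.2) n _
  exact ContinuousOn.sub (by fun_prop) h

theorem summable_fst_coef (hp : IsWalk p) : Summable fun n : ℕ × ℕ => (n.1 : ℝ) * coef p n :=
  hp.hasSum_fst.summable

theorem summable_add_coef (hp : IsWalk p) :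
    Summable fun n : ℕ × ℕ => ((n.1 : ℝ) + n.2) * coef p n := by
  simpa only [add_mul] using hp.hasSum_fst.summable.add hp.hasSum_snd.summable

/-- The derivatives of the kernel are continuous beyond the closed unit disc in the variable `u`. -/
def kernelDomain (ρ : ℝ) : Set (ℂ × ℂ) := ball 0 ρ⁻¹ ×ˢ ball 0 ρ

theorem defect_le_one (p : ℤ → ℤ → ℝ) : defect p ≤ 1 := by
  rcases defect_cases p with h | h <;> omega

theorem norm_deriv₁_term_le (hp : IsWalk p) {ρ : ℝ} (hρ : ρ ∈ Ioo (0 : ℝ) 1) {u y : ℂ}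
    (hu : ‖u‖ < ρ⁻¹) (hy : ‖y‖ < ρ) (n : ℕ × ℕ) :
    ‖(coef p n : ℂ) * (n.1 * u ^ (n.1 - 1)) * y ^ (n.1 + n.2 - defect p)‖ ≤
      (n.1 : ℝ) * coef p n := by
  obtain ⟨hρ0, hρ1⟩ := hρ
  have h0 := hp.coef_nonneg n
  rcases Nat.eq_zero_or_pos n.1 with h | h
  · simp [h]
  have he := defect_le_one p
  rw [norm_mul, norm_mul, norm_mul, norm_coef hp, norm_pow, norm_pow, Complex.norm_natCast]
  have h1 : ‖u‖ ^ (n.1 - 1) * ‖y‖ ^ (n.1 + n.2 - defect p) ≤ 1 := by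
    have h2 : n.1 + n.2 - defect p = (n.1 - 1) + (n.2 + 1 - defect p) := by omega
    rw [h2, pow_add, ← mul_assoc, ← mul_pow]
    have h3 : ‖u‖ * ‖y‖ ≤ 1 := by
      calc ‖u‖ * ‖y‖ ≤ ρ⁻¹ * ρ := by gcongr
        _ = 1 := inv_mul_cancel₀ hρ0.ne'
    exact mul_le_one₀ (pow_le_one₀ (by positivity) h3) (by positivity)
      (pow_le_one₀ (norm_nonneg _) (hy.trans hρ1).le)
  calc coef p n * (n.1 * ‖u‖ ^ (n.1 - 1)) * ‖y‖ ^ (n.1 + n.2 - defect p)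
      = n.1 * coef p n * (‖u‖ ^ (n.1 - 1) * ‖y‖ ^ (n.1 + n.2 - defect p)) := by ring
    _ ≤ n.1 * coef p n * 1 := by gcongr
    _ = n.1 * coef p n := mul_one _

theorem norm_deriv₂_term_le (hp : IsWalk p) {ρ : ℝ} (hρ : ρ ∈ Ioo (0 : ℝ) 1) {u y : ℂ}
    (hu : ‖u‖ < ρ⁻¹) (hy : ‖y‖ < ρ) (n : ℕ × ℕ) :
    ‖(coef p n : ℂ) * u ^ n.1 *
      ((n.1 + n.2 - defect p : ℕ) * y ^ (n.1 + n.2 - defect p - 1))‖ ≤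
      ρ⁻¹ ^ 2 * (((n.1 : ℝ) + n.2) * coef p n) := by
  obtain ⟨hρ0, hρ1⟩ := hρ
  have h0 := hp.coef_nonneg n
  have hR : 1 ≤ ρ⁻¹ := (one_le_inv₀ hρ0).mpr hρ1.le
  rcases Nat.eq_zero_or_pos (n.1 + n.2 - defect p) with h | h
  · rw [h]; simp only [CharP.cast_eq_zero, zero_mul, mul_zero, norm_zero]; positivity
  have he := defect_le_one p
  rw [norm_mul, norm_mul, norm_mul, norm_coef hp, norm_pow, norm_pow, Complex.norm_natCast]
  set N := n.1 + n.2 - defect p with hN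
  have h1 : ‖u‖ ^ n.1 * ‖y‖ ^ (N - 1) ≤ ρ⁻¹ ^ 2 := by
    calc ‖u‖ ^ n.1 * ‖y‖ ^ (N - 1) ≤ ρ⁻¹ ^ n.1 * ρ ^ (N - 1) := by gcongr
      _ ≤ ρ⁻¹ ^ (N - 1 + 2) * ρ ^ (N - 1) := by
        gcongr
        · omega
      _ = ρ⁻¹ ^ 2 * (ρ⁻¹ * ρ) ^ (N - 1) := by rw [mul_pow]; ring
      _ = ρ⁻¹ ^ 2 := by rw [inv_mul_cancel₀ hρ0.ne', one_pow, mul_one]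
  have h2 : (N : ℝ) ≤ (n.1 : ℝ) + n.2 := by
    exact_mod_cast (by omega : N ≤ n.1 + n.2)
  calc coef p n * ‖u‖ ^ n.1 * (N * ‖y‖ ^ (N - 1))
      = (‖u‖ ^ n.1 * ‖y‖ ^ (N - 1)) * (N * coef p n) := by ring
    _ ≤ ρ⁻¹ ^ 2 * (((n.1 : ℝ) + n.2) * coef p n) := by gcongr

theorem hasDerivAt_ratioKernel₁ (hp : IsWalk p) {ρ : ℝ} (hρ : ρ ∈ Ioo (0 : ℝ) 1)
    {v : ℂ × ℂ} (hv : v ∈ kernelDomain ρ) :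
    HasDerivAt (fun u => ratioKernel p u v.2) (ratioKernelDeriv₁ p v.1 v.2) v.1 := by
  have hy : ‖v.2‖ < ρ := mem_ball_zero_iff.mp hv.2
  refine HasDerivAt.sub ?_ ?_
  · simpa using (hasDerivAt_id v.1).mul_const (v.2 ^ (2 - defect p))
  · refine hasDerivAt_tsum_of_isPreconnected (summable_fst_coef hp)
      (t := ball 0 ρ⁻¹) (y₀ := 0) isOpen_ball (convex_ball _ _).isPreconnected
      (g := fun n u => (coef p n : ℂ) * u ^ n.1 * v.2 ^ (n.1 + n.2 - defect p))
      (g' := fun n u => (coef p n : ℂ) * (n.1 * u ^ (n.1 - 1)) * v.2 ^ (n.1 + n.2 - defect p))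
      (fun n u hu => ?_) (fun n u hu => ?_)
      (by simpa using hρ.1) ?_ hv.1
    · exact ((hasDerivAt_pow n.1 u).const_mul _).mul_const _
    · exact norm_deriv₁_term_le hp hρ (mem_ball_zero_iff.mp hu) hy n
    · exact Summable.of_norm_bounded hp.hasSum_coef.summable fun n =>
        norm_ratioKernel_term_le hp (by simp) (hy.trans hρ.2).le n _

theorem hasDerivAt_ratioKernel₂ (hp : IsWalk p) {ρ : ℝ} (hρ : ρ ∈ Ioo (0 : ℝ) 1)
    {v : ℂ × ℂ} (hv : v ∈ kernelDomain ρ) :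
    HasDerivAt (fun y => ratioKernel p v.1 y) (ratioKernelDeriv₂ p v.1 v.2) v.2 := by
  have hu : ‖v.1‖ < ρ⁻¹ := mem_ball_zero_iff.mp hv.1
  have hR : 1 ≤ ρ⁻¹ := (one_le_inv₀ hρ.1).mpr hρ.2.le
  refine HasDerivAt.sub ?_ ?_
  · exact (hasDerivAt_pow _ v.2).const_mul _
  · refine hasDerivAt_tsum_of_isPreconnected ((summable_add_coef hp).mul_left (ρ⁻¹ ^ 2))
      (t := ball 0 ρ) (y₀ := 0) isOpen_ball (convex_ball _ _).isPreconnected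
      (g := fun n y => (coef p n : ℂ) * v.1 ^ n.1 * y ^ (n.1 + n.2 - defect p))
      (g' := fun n y => (coef p n : ℂ) * v.1 ^ n.1 *
        ((n.1 + n.2 - defect p : ℕ) * y ^ (n.1 + n.2 - defect p - 1)))
      (fun n y hy => ?_) (fun n y hy => ?_)
      (by simpa using hρ.1) ?_ hv.2
    · exact (hasDerivAt_pow _ y).const_mul _
    · exact norm_deriv₂_term_le hp hρ hu (mem_ball_zero_iff.mp hy) n
    · refine Summable.of_norm_bounded (hp.hasSum_coef.summable.mul_left ρ⁻¹) fun n => ?_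
      have h0 := hp.coef_nonneg n
      have he := defect_le_one p
      rcases Nat.eq_zero_or_pos (n.1 + n.2 - defect p) with h | h
      · rw [h, pow_zero, mul_one, norm_mul, norm_coef hp, norm_pow, mul_comm]
        gcongr
        calc ‖v.1‖ ^ n.1 ≤ ρ⁻¹ ^ n.1 := by gcongr
          _ ≤ ρ⁻¹ ^ 1 := by
            gcongr
            · omega
          _ = ρ⁻¹ := pow_one _
      · rw [zero_pow h.ne', mul_zero, norm_zero]
        have := hρ.1
        positivity

theorem continuousOn_ratioKernelDeriv₁ (hp : IsWalk p) {ρ : ℝ} (hρ : ρ ∈ Ioo (0 : ℝ) 1) :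
    ContinuousOn (Function.uncurry (ratioKernelDeriv₁ p)) (kernelDomain ρ) := by
  have h : ContinuousOn (fun v : ℂ × ℂ => ∑' n : ℕ × ℕ,
      (coef p n : ℂ) * (n.1 * v.1 ^ (n.1 - 1)) * v.2 ^ (n.1 + n.2 - defect p))
      (kernelDomain ρ) :=
    continuousOn_tsum (fun n => by fun_prop) (summable_fst_coef hp) fun n v hv =>
      norm_deriv₁_term_le hp hρ (mem_ball_zero_iff.mp hv.1) (mem_ball_zero_iff.mp hv.2) n
  exact ContinuousOn.sub (by fun_prop) h

theorem continuousOn_ratioKernelDeriv₂ (hp : IsWalk p) {ρ : ℝ} (hρ : ρ ∈ Ioo (0 : ℝ) 1) :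
    ContinuousOn (Function.uncurry (ratioKernelDeriv₂ p)) (kernelDomain ρ) := by
  have h : ContinuousOn (fun v : ℂ × ℂ => ∑' n : ℕ × ℕ, (coef p n : ℂ) * v.1 ^ n.1 *
      ((n.1 + n.2 - defect p : ℕ) * v.2 ^ (n.1 + n.2 - defect p - 1))) (kernelDomain ρ) :=
    continuousOn_tsum (fun n => by fun_prop) ((summable_add_coef hp).mul_left (ρ⁻¹ ^ 2))
      fun n v hv => norm_deriv₂_term_le hp hρ (mem_ball_zero_iff.mp hv.1)
        (mem_ball_zero_iff.mp hv.2) n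
  exact ContinuousOn.sub (by fun_prop) h

theorem isOpen_kernelDomain (ρ : ℝ) : IsOpen (kernelDomain ρ) := isOpen_ball.prod isOpen_ball

/-- Every point of the closed unit disc times the open unit disc lies in a domain of
differentiability. -/
theorem exists_kernelDomain {u y : ℂ} (hu : ‖u‖ ≤ 1) (hy : ‖y‖ < 1) :
    ∃ ρ ∈ Ioo (0 : ℝ) 1, ‖y‖ < ρ ∧ (u, y) ∈ kernelDomain ρ := by
  obtain ⟨ρ, h1, h2⟩ := exists_between hy
  have h0 : 0 < ρ := (norm_nonneg y).trans_lt h1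
  refine ⟨ρ, ⟨h0, h2⟩, h1, ?_, by simpa using h1⟩
  rw [mem_ball_zero_iff]
  exact hu.trans_lt ((one_lt_inv₀ h0).mpr h2)

theorem differentiableOn_ratioKernel (hp : IsWalk p) {ρ : ℝ} (hρ : ρ ∈ Ioo (0 : ℝ) 1) {y : ℂ}
    (hy : ‖y‖ < ρ) : DifferentiableOn ℂ (fun u => ratioKernel p u y) (ball 0 ρ⁻¹) :=
  fun u hu => (hasDerivAt_ratioKernel₁ hp hρ (v := (u, y))
    ⟨hu, mem_ball_zero_iff.mpr hy⟩).differentiableAt.differentiableWithinAt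

theorem continuousOn_ratioKernel_domain (hp : IsWalk p) {ρ : ℝ} (hρ : ρ ∈ Ioo (0 : ℝ) 1) :
    ContinuousOn (Function.uncurry (ratioKernel p)) (kernelDomain ρ) := by
  intro v hv
  have hO := (isOpen_kernelDomain ρ).mem_nhds hv
  let f₁ : ℂ → ℂ → ℂ →L[ℂ] ℂ := fun x y =>
    ContinuousLinearMap.toSpanSingleton ℂ (ratioKernelDeriv₁ p x y)
  let f₂ : ℂ → ℂ → ℂ →L[ℂ] ℂ := fun x y =>
    ContinuousLinearMap.toSpanSingleton ℂ (ratioKernelDeriv₂ p x y)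
  refine (hasStrictFDerivAt_uncurry_coprod (𝕜 := ℂ) (f := ratioKernel p) (f₁ := f₁) (f₂ := f₂)
    (u := v) ?_ ?_ ?_ ?_).hasFDerivAt.continuousAt.continuousWithinAt
  · filter_upwards [hO] with w hw using (hasDerivAt_ratioKernel₁ hp hρ hw).hasFDerivAt
  · filter_upwards [hO] with w hw using (hasDerivAt_ratioKernel₂ hp hρ hw).hasFDerivAt
  · exact ((ContinuousLinearMap.toSpanSingletonCLE (𝕜 := ℂ) (E := ℂ)).continuous.continuousAt).comp
      ((continuousOn_ratioKernelDeriv₁ hp hρ).continuousAt hO)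
  · exact ((ContinuousLinearMap.toSpanSingletonCLE (𝕜 := ℂ) (E := ℂ)).continuous.continuousAt).comp
      ((continuousOn_ratioKernelDeriv₂ hp hρ).continuousAt hO)

/-! ### Consequences of zero drift and aperiodicity -/

/-- If `f ≥ 0` wherever the coefficients do not vanish and `f` has mean zero, then `f` vanishes
wherever the coefficients do not. -/
theorem coef_eq_zero_or (hp : IsWalk p) {f : ℕ × ℕ → ℝ}
    (hf : ∀ n, coef p n ≠ 0 → 0 ≤ f n) (hs : HasSum (fun n => f n * coef p n) 0) (n : ℕ × ℕ) :
    coef p n = 0 ∨ f n = 0 := by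
  have h0 : ∀ n, 0 ≤ f n * coef p n := fun n => by
    by_cases h : coef p n = 0
    · simp [h]
    · exact mul_nonneg (hf n h) (hp.coef_nonneg n)
  have := congrFun ((hasSum_zero_iff_of_nonneg h0).mp hs) n
  rcases mul_eq_zero.mp this with h | h
  · exact Or.inr h
  · exact Or.inl h

theorem exists_two_le_fst (hp : IsWalk p) : ∃ n : ℕ × ℕ, 2 ≤ n.1 ∧ 0 < coef p n := by
  by_contra! h
  have h1 : ∀ n : ℕ × ℕ, coef p n = 0 ∨ 1 - (n.1 : ℝ) = 0 := by
    refine coef_eq_zero_or hp (fun n hn => ?_) ?_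
    · have : n.1 ≤ 1 := by
        by_contra! h2
        exact hn (le_antisymm (h n h2) (hp.coef_nonneg n))
      have : (n.1 : ℝ) ≤ 1 := by exact_mod_cast this
      linarith
    · simpa [sub_mul] using hp.hasSum_coef.sub hp.hasSum_fst
  -- then the walk would be periodic in the first coordinate
  have h2 := (aperiodic_coef hp (x := -1) (y := 1) (by simp) (by simp) ?_).1
  · norm_num at h2
  · have h3 : ∀ n : ℕ × ℕ, (coef p n : ℂ) * (-1) ^ n.1 * 1 ^ n.2 = -(coef p n : ℂ) := fun n => by
      rcases h1 n with h | h
      · simp [h]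
      · have : n.1 = 1 := by exact_mod_cast (sub_eq_zero.mp h).symm
        simp [this]
    simp only [h3]
    rw [tsum_neg, norm_neg, ← Complex.ofReal_tsum, hp.hasSum_coef.tsum_eq]
    simp

/-- Otherwise zero drift gives `k + l = 0` for all steps `(k, l)`, against aperiodicity. -/
theorem exists_three_le_add (hp : IsWalk p) : ∃ n : ℕ × ℕ, 3 ≤ n.1 + n.2 ∧ 0 < coef p n := by
  by_contra! h
  have h1 : ∀ n : ℕ × ℕ, coef p n = 0 ∨ (2 : ℝ) - (n.1 + n.2) = 0 := by
    refine coef_eq_zero_or hp (fun n hn => ?_) ?_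
    · have : n.1 + n.2 ≤ 2 := by
        by_contra! h2
        exact hn (le_antisymm (h n h2) (hp.coef_nonneg n))
      have : (n.1 : ℝ) + n.2 ≤ 2 := by exact_mod_cast this
      linarith
    · have := (hp.hasSum_coef.mul_left 2).sub (hp.hasSum_fst.add hp.hasSum_snd)
      norm_num at this
      simpa [sub_mul, add_mul] using this
  have h2 := (aperiodic_coef hp (x := -1) (y := -1) (by simp) (by simp) ?_).1
  · norm_num at h2
  · have h3 : ∀ n : ℕ × ℕ, (coef p n : ℂ) * (-1) ^ n.1 * (-1) ^ n.2 = (coef p n : ℂ) := fun n => by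
      rcases h1 n with h | h
      · simp [h]
      · have : n.1 + n.2 = 2 := by exact_mod_cast (sub_eq_zero.mp h).symm
        rw [mul_assoc, ← pow_add, this]; simp
    simp only [h3]
    rw [← Complex.ofReal_tsum, hp.hasSum_coef.tsum_eq]
    simp

/-- Strict triangle inequality for a series whose terms are bounded with total mass one. -/
theorem norm_tsum_coef_mul_lt (hp : IsWalk p) {c : ℕ × ℕ → ℂ} {m : ℕ × ℕ → ℝ}
    (hm : HasSum (fun n => m n * coef p n) 1) (hc : ∀ n, ‖c n‖ ≤ m n)
    (hlt : ∃ n, 0 < coef p n ∧ ‖c n‖ < m n) : ‖∑' n, (coef p n : ℂ) * c n‖ < 1 := by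
  obtain ⟨n, hn, hcn⟩ := hlt
  have h1 : ∀ n, ‖(coef p n : ℂ) * c n‖ ≤ m n * coef p n := fun n => by
    rw [norm_mul, norm_coef hp, mul_comm]
    exact mul_le_mul_of_nonneg_right (hc n) (hp.coef_nonneg n)
  have hsum : Summable fun n => ‖(coef p n : ℂ) * c n‖ :=
    Summable.of_nonneg_of_le (fun _ => norm_nonneg _) h1 hm.summable
  calc ‖∑' n, (coef p n : ℂ) * c n‖ ≤ ∑' n, ‖(coef p n : ℂ) * c n‖ := norm_tsum_le_tsum_norm hsum
    _ < ∑' n, m n * coef p n := by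
      refine hsum.tsum_lt_tsum h1 (i := n) ?_ hm.summable
      rw [norm_mul, norm_coef hp, mul_comm]
      exact mul_lt_mul_of_pos_right hcn hn
    _ = 1 := hm.tsum_eq

theorem norm_tsum_coef_pow_lt (hp : IsWalk p) {x y : ℂ} (hx : ‖x‖ = 1) (hy : ‖y‖ = 1)
    (h : ¬ (x = 1 ∧ y = 1)) : ‖∑' n : ℕ × ℕ, (coef p n : ℂ) * x ^ n.1 * y ^ n.2‖ < 1 := by
  refine lt_of_le_of_ne ?_ fun h1 => h (aperiodic_coef hp hx hy h1)
  have h1 := tsum_of_norm_bounded hp.hasSum_coef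
    (f := fun n : ℕ × ℕ => (coef p n : ℂ) * x ^ n.1 * y ^ n.2) fun n =>
      norm_ratioKernel_term_le hp hx.le hy.le n n.2
  exact h1

theorem eq_one_of_kernel_eq_zero (hp : IsWalk p) {x y : ℂ} (hx : ‖x‖ = 1) (hy : ‖y‖ = 1)
    (h : kernel p x y = 0) : x = 1 ∧ y = 1 := by
  refine aperiodic_coef hp hx hy ?_
  rw [kernel_eq hp, sub_eq_zero] at h
  rw [← h, norm_mul, hx, hy, one_mul]

theorem eq_one_of_ratioKernel_eq_zero (hp : IsWalk p) {u y : ℂ} (hu : ‖u‖ = 1) (hy : ‖y‖ = 1)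
    (h : ratioKernel p u y = 0) : u = 1 ∧ y = 1 := by
  obtain ⟨h1, h2⟩ := eq_one_of_kernel_eq_zero hp (x := u * y) (by rw [norm_mul, hu, hy, one_mul])
    hy (by rw [kernel_mul_self hp, h, mul_zero])
  subst h2
  exact ⟨by simpa using h1, rfl⟩

theorem ratioKernel_one_eq_zero (hp : IsWalk p) {u : ℂ} (hu : ‖u‖ ≤ 1)
    (h : ratioKernel p u 1 = 0) : u = 1 := by
  rcases hu.lt_or_eq with hu | hu
  · by_contra hne
    have h1 : u = ∑' n : ℕ × ℕ, (coef p n : ℂ) * u ^ n.1 := by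
      have := h
      simpa [ratioKernel, sub_eq_zero] using this
    have hs : Summable fun n : ℕ × ℕ => (coef p n : ℂ) * u ^ n.1 :=
      Summable.of_norm_bounded hp.hasSum_coef.summable fun n => by
        simpa using norm_ratioKernel_term_le hp hu.le (y := 1) (by simp) n 0
    have h2 : u - 1 = (u - 1) * ∑' n : ℕ × ℕ, (coef p n : ℂ) * powDiff n.1 u 1 := by
      have h3 : ∀ n : ℕ × ℕ, (u - 1) * ((coef p n : ℂ) * powDiff n.1 u 1) =
          (coef p n : ℂ) * u ^ n.1 - coef p n := fun n => by
        have := sub_mul_powDiff n.1 u 1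
        rw [one_pow] at this
        linear_combination (coef p n : ℂ) * this
      rw [← tsum_mul_left]
      simp only [h3]
      have hc := Complex.hasSum_ofReal.mpr hp.hasSum_coef
      rw [(hs.hasSum.sub hc).tsum_eq, ← h1]
      simp
    have h3 : ∑' n : ℕ × ℕ, (coef p n : ℂ) * powDiff n.1 u 1 = 1 :=
      mul_left_cancel₀ (sub_ne_zero.mpr hne) (h2.symm.trans (mul_one _).symm)
    obtain ⟨n, hn, hpn⟩ := exists_two_le_fst hp
    have h4 := norm_tsum_coef_mul_lt hp (c := fun n => powDiff n.1 u 1) hp.hasSum_fst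
      (fun n => norm_powDiff_le _ hu.le (by simp)) ⟨n, hpn, norm_powDiff_lt hn hu (by simp)⟩
    rw [h3] at h4
    simp at h4
  · exact (eq_one_of_ratioKernel_eq_zero hp hu (by simp) h).1

/-! ### Splitting off the roots on the curve -/

/-- The first divided difference in `y` of `ratioKernel p u`. -/
noncomputable def kernelDiff₁ (p : ℤ → ℤ → ℝ) (u y a : ℂ) : ℂ :=
  u * powDiff (2 - defect p) y a -
    ∑' n : ℕ × ℕ, (coef p n : ℂ) * (u ^ n.1 * powDiff (n.1 + n.2 - defect p) y a)

/-- The second divided difference in `y` of `ratioKernel p u`. -/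
noncomputable def kernelDiff₂ (p : ℤ → ℤ → ℝ) (u y a b : ℂ) : ℂ :=
  u * powDiff₂ (2 - defect p) y a b -
    ∑' n : ℕ × ℕ, (coef p n : ℂ) * (u ^ n.1 * powDiff₂ (n.1 + n.2 - defect p) y a b)

theorem norm_pow_mul_powDiff_le {u y a : ℂ} (hu : ‖u‖ ≤ 1) (hy : ‖y‖ ≤ 1) (ha : ‖a‖ ≤ 1)
    (i n : ℕ) : ‖u ^ i * powDiff n y a‖ ≤ n := by
  rw [norm_mul, norm_pow]
  exact (mul_le_of_le_one_left (norm_nonneg _) (pow_le_one₀ (norm_nonneg _) hu)).trans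
    (norm_powDiff_le n hy ha)

theorem norm_kernelDiff₁_term_le (hp : IsWalk p) {u y a : ℂ} (hu : ‖u‖ ≤ 1) (hy : ‖y‖ ≤ 1)
    (ha : ‖a‖ ≤ 1) (n : ℕ × ℕ) :
    ‖(coef p n : ℂ) * (u ^ n.1 * powDiff (n.1 + n.2 - defect p) y a)‖ ≤
      ((n.1 : ℝ) + n.2) * coef p n := by
  rw [norm_mul, norm_coef hp, mul_comm]
  refine mul_le_mul_of_nonneg_right ((norm_pow_mul_powDiff_le hu hy ha _ _).trans ?_)
    (hp.coef_nonneg n)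
  exact_mod_cast Nat.sub_le _ _

theorem norm_kernelDiff₂_term_le (hp : IsWalk p) {u y a b : ℂ} (hu : ‖u‖ ≤ 1) (hy : ‖y‖ ≤ 1)
    (ha : ‖a‖ ≤ 1) (hb : ‖b‖ ≤ 1) (n : ℕ × ℕ) :
    ‖(coef p n : ℂ) * (u ^ n.1 * powDiff₂ (n.1 + n.2 - defect p) y a b)‖ ≤
      ((n.1 + n.2 : ℕ) : ℝ) ^ 2 * coef p n := by
  rw [norm_mul, norm_coef hp, mul_comm, norm_mul, norm_pow]
  refine mul_le_mul_of_nonneg_right ((mul_le_of_le_one_left (norm_nonneg _)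
    (pow_le_one₀ (norm_nonneg _) hu)).trans ((norm_powDiff₂_le _ hy ha hb).trans ?_))
    (hp.coef_nonneg n)
  gcongr
  exact Nat.sub_le _ _

theorem sub_mul_kernelDiff₁ (hp : IsWalk p) {u y a : ℂ} (hu : ‖u‖ ≤ 1) (hy : ‖y‖ ≤ 1)
    (ha : ‖a‖ ≤ 1) :
    (y - a) * kernelDiff₁ p u y a = ratioKernel p u y - ratioKernel p u a := by
  have hs : ∀ y : ℂ, ‖y‖ ≤ 1 → Summable fun n : ℕ × ℕ =>
      (coef p n : ℂ) * u ^ n.1 * y ^ (n.1 + n.2 - defect p) := fun y hy =>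
    Summable.of_norm_bounded hp.hasSum_coef.summable fun n =>
      norm_ratioKernel_term_le hp hu hy n _
  have h3 : ∀ n : ℕ × ℕ,
      (y - a) * ((coef p n : ℂ) * (u ^ n.1 * powDiff (n.1 + n.2 - defect p) y a)) =
      (coef p n : ℂ) * u ^ n.1 * y ^ (n.1 + n.2 - defect p) -
      (coef p n : ℂ) * u ^ n.1 * a ^ (n.1 + n.2 - defect p) := fun n => by
    linear_combination (coef p n : ℂ) * u ^ n.1 * sub_mul_powDiff (n.1 + n.2 - defect p) y a
  rw [kernelDiff₁, ratioKernel, ratioKernel, mul_sub, ← tsum_mul_left]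
  simp only [h3]
  rw [(hs y hy).tsum_sub (hs a ha)]
  linear_combination u * sub_mul_powDiff (2 - defect p) y a

theorem sub_mul_kernelDiff₂ (hp : IsWalk p) {u y a b : ℂ} (hu : ‖u‖ ≤ 1) (hy : ‖y‖ ≤ 1)
    (ha : ‖a‖ ≤ 1) (hb : ‖b‖ ≤ 1) :
    (y - b) * kernelDiff₂ p u y a b = kernelDiff₁ p u y a - kernelDiff₁ p u b a := by
  have hs : ∀ y : ℂ, ‖y‖ ≤ 1 → Summable fun n : ℕ × ℕ =>
      (coef p n : ℂ) * (u ^ n.1 * powDiff (n.1 + n.2 - defect p) y a) := fun y hy =>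
    Summable.of_norm_bounded (summable_add_coef hp) fun n => norm_kernelDiff₁_term_le hp hu hy ha n
  have h3 : ∀ n : ℕ × ℕ,
      (y - b) * ((coef p n : ℂ) * (u ^ n.1 * powDiff₂ (n.1 + n.2 - defect p) y a b)) =
      (coef p n : ℂ) * (u ^ n.1 * powDiff (n.1 + n.2 - defect p) y a) -
      (coef p n : ℂ) * (u ^ n.1 * powDiff (n.1 + n.2 - defect p) b a) := fun n => by
    linear_combination (coef p n : ℂ) * u ^ n.1 * sub_mul_powDiff₂ (n.1 + n.2 - defect p) y a b
  rw [kernelDiff₂, kernelDiff₁, kernelDiff₁, mul_sub, ← tsum_mul_left]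
  simp only [h3]
  rw [(hs y hy).tsum_sub (hs b hb)]
  linear_combination u * sub_mul_powDiff₂ (2 - defect p) y a b

theorem kernelDiff₂_comm (u y a b : ℂ) : kernelDiff₂ p u y a b = kernelDiff₂ p u y b a := by
  simp only [kernelDiff₂, powDiff₂_comm _ y a b]

theorem continuousOn_kernelDiff₁ (hp : IsWalk p) :
    ContinuousOn (fun v : ℂ × ℂ × ℂ => kernelDiff₁ p v.1 v.2.1 v.2.2)
      {v | ‖v.1‖ ≤ 1 ∧ ‖v.2.1‖ ≤ 1 ∧ ‖v.2.2‖ ≤ 1} := by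
  have hc : ∀ n, Continuous fun v : ℂ × ℂ × ℂ => powDiff n v.2.1 v.2.2 := fun n =>
    (continuous_powDiff n).comp continuous_snd
  have h : ContinuousOn (fun v : ℂ × ℂ × ℂ => ∑' n : ℕ × ℕ,
      (coef p n : ℂ) * (v.1 ^ n.1 * powDiff (n.1 + n.2 - defect p) v.2.1 v.2.2))
      {v | ‖v.1‖ ≤ 1 ∧ ‖v.2.1‖ ≤ 1 ∧ ‖v.2.2‖ ≤ 1} :=
    continuousOn_tsum
      (fun n => (continuous_const.mul ((continuous_fst.pow _).mul (hc _))).continuousOn)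
      (summable_add_coef hp) fun n v hv => norm_kernelDiff₁_term_le hp hv.1 hv.2.1 hv.2.2 n
  exact ContinuousOn.sub (continuous_fst.mul (hc _)).continuousOn h

theorem continuousOn_kernelDiff₂ (hp : IsWalk p) :
    ContinuousOn (fun v : ℂ × ℂ × ℂ × ℂ => kernelDiff₂ p v.1 v.2.1 v.2.2.1 v.2.2.2)
      {v | ‖v.1‖ ≤ 1 ∧ ‖v.2.1‖ ≤ 1 ∧ ‖v.2.2.1‖ ≤ 1 ∧ ‖v.2.2.2‖ ≤ 1} := by
  have hc : ∀ n, Continuous fun v : ℂ × ℂ × ℂ × ℂ => powDiff₂ n v.2.1 v.2.2.1 v.2.2.2 := fun n =>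
    (continuous_powDiff₂ n).comp continuous_snd
  have h : ContinuousOn (fun v : ℂ × ℂ × ℂ × ℂ => ∑' n : ℕ × ℕ,
      (coef p n : ℂ) * (v.1 ^ n.1 * powDiff₂ (n.1 + n.2 - defect p) v.2.1 v.2.2.1 v.2.2.2))
      {v | ‖v.1‖ ≤ 1 ∧ ‖v.2.1‖ ≤ 1 ∧ ‖v.2.2.1‖ ≤ 1 ∧ ‖v.2.2.2‖ ≤ 1} :=
    continuousOn_tsum
      (fun n => (continuous_const.mul ((continuous_fst.pow _).mul (hc _))).continuousOn)
      hp.summable_sq fun n v hv => norm_kernelDiff₂_term_le hp hv.1 hv.2.1 hv.2.2.1 hv.2.2.2 n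
  exact ContinuousOn.sub (continuous_fst.mul (hc _)).continuousOn h

theorem differentiable_powDiff₂ (n : ℕ) (a b : ℂ) : Differentiable ℂ fun y => powDiff₂ n y a b := by
  induction n with
  | zero => exact differentiable_const _
  | succ n ih => simp only [powDiff₂]; fun_prop

theorem differentiableOn_kernelDiff₂ (hp : IsWalk p) {u a b : ℂ} (hu : ‖u‖ ≤ 1) (ha : ‖a‖ ≤ 1)
    (hb : ‖b‖ ≤ 1) : DifferentiableOn ℂ (fun y => kernelDiff₂ p u y a b) (ball 0 1) := by
  have hd := fun n => differentiable_powDiff₂ n a b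
  have h := Complex.differentiableOn_tsum_of_summable_norm (U := ball (0 : ℂ) 1)
    (F := fun (n : ℕ × ℕ) y =>
      (coef p n : ℂ) * (u ^ n.1 * powDiff₂ (n.1 + n.2 - defect p) y a b)) hp.summable_sq
    (fun n => (((hd _).const_mul _).const_mul _).differentiableOn) isOpen_ball fun n y hy =>
      norm_kernelDiff₂_term_le hp hu (mem_ball_zero_iff.mp hy).le ha hb n
  exact DifferentiableOn.sub ((hd _).const_mul _).differentiableOn h

/-- The series in `kernelDiff₁ p u y a` is of modulus less than one: its terms are bounded by
`(i + j - 1) * coef p (i, j)`, and by zero drift these numbers have sum one. -/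
theorem re_inv_mul_kernelDiff₁_pos (hp : IsWalk p) (h11 : p 1 1 = 0) {u y a : ℂ} (hu : ‖u‖ = 1)
    (hy : ‖y‖ < 1) (ha : ‖a‖ ≤ 1) : 0 < (u⁻¹ * kernelDiff₁ p u y a).re := by
  have hd : defect p = 1 := by simp [defect, h11]
  have hu0 : u ≠ 0 := norm_pos_iff.mp (by rw [hu]; exact one_pos)
  have hsum : HasSum (fun n : ℕ × ℕ => ((n.1 + n.2 - defect p : ℕ) : ℝ) * coef p n) 1 := by
    have h := (hp.hasSum_fst.add hp.hasSum_snd).sub hp.hasSum_coef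
    norm_num at h
    refine h.congr_fun fun n => ?_
    rcases defect_le_or_coef_eq_zero p n with h1 | h1
    · rw [Nat.cast_sub h1, hd]; push_cast; ring
    · simp [h1]
  obtain ⟨n, hn, hpn⟩ := exists_three_le_add hp
  have hlt := norm_tsum_coef_mul_lt hp
    (c := fun n => u ^ n.1 * powDiff (n.1 + n.2 - defect p) y a) hsum
    (fun n => norm_pow_mul_powDiff_le hu.le hy.le ha _ _) ⟨n, hpn, by
      rw [norm_mul, norm_pow, hu, one_pow, one_mul]
      exact norm_powDiff_lt (by omega) hy ha⟩
  rw [kernelDiff₁, mul_sub, hd]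
  rw [hd] at hlt
  have h1 : powDiff (2 - 1) y a = 1 := by simp [powDiff]
  rw [h1, mul_one, inv_mul_cancel₀ hu0, Complex.sub_re, Complex.one_re, sub_pos]
  refine (Complex.re_le_norm _).trans_lt ?_
  rwa [norm_mul, norm_inv, hu, inv_one, one_mul]

variable {η : ℂ → ℂ}

/-! ### The roots of the kernel with unimodular ratio -/

/-- The point `η(s) s⁻¹` of the curve `S₂ η`. -/
noncomputable def curvePoint (η : ℂ → ℂ) (s : ℂ) : ℂ := η s * s⁻¹

theorem ne_zero_of_norm_eq_one {s : ℂ} (hs : ‖s‖ = 1) : s ≠ 0 :=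
  norm_pos_iff.mp (by rw [hs]; exact one_pos)

theorem curvePoint_one (hη : IsRootFunction p η) : curvePoint η 1 = 1 := by
  simp [curvePoint, hη.map_one]

theorem norm_curvePoint_le (hη : IsRootFunction p η) {s : ℂ} (hs : ‖s‖ = 1) :
    ‖curvePoint η s‖ ≤ 1 := by
  rw [curvePoint, norm_mul, norm_inv, hs, inv_one, mul_one]
  exact hη.norm_le s hs

theorem sq_mul_curvePoint {s : ℂ} (hs : ‖s‖ = 1) : s ^ 2 * curvePoint η s = η s * s := by
  have := ne_zero_of_norm_eq_one hs
  rw [curvePoint]; field_simp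

theorem continuousOn_curvePoint (hη : IsRootFunction p η) :
    ContinuousOn (curvePoint η) (sphere 0 1) :=
  hη.continuousOn.mul (continuousOn_id.inv₀ fun _ hs =>
    ne_zero_of_norm_eq_one (mem_sphere_zero_iff_norm.mp hs))

theorem continuous_curve₂ (hη : IsRootFunction p η) : Continuous (curve₂ η) :=
  continuous_comp_circle (continuousOn_curvePoint hη)

theorem reducedKernel_eq (hp : IsWalk p) (h11 : p 1 1 = 0) {s : ℂ} (hs : ‖s‖ = 1) (r : ℂ) :
    reducedKernel p r s = s⁻¹ * ratioKernel p (s ^ 2) (r * s⁻¹) := by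
  have hs0 := ne_zero_of_norm_eq_one hs
  have hd : defect p = 1 := by simp [defect, h11]
  rw [reducedKernel, ratioKernel, ← tsum_coef (fun z => (p z.1 z.2 : ℂ) * r ^ (1 - z.1 - z.2) *
    s ^ (z.2 - z.1)) fun z hz => by simp [hp.small_positive_jumps _ _ hz], mul_sub, ← tsum_mul_left]
  congr 1
  · rw [hd, pow_one]; field_simp
  · congr 1
    ext n
    change (coef p n : ℂ) * _ * _ = _
    rcases defect_le_or_coef_eq_zero p n with h | h
    · rw [hd] at h ⊢
      obtain ⟨m, hm⟩ := Nat.exists_eq_add_of_le h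
      have e1 : (1 - (1 - (n.1 : ℤ)) - (1 - (n.2 : ℤ))) = (m : ℤ) := by omega
      have e2 : (1 - (n.2 : ℤ)) - (1 - (n.1 : ℤ)) = ((2 * n.1 : ℕ) : ℤ) - ((m + 1 : ℕ) : ℤ) := by
        push_cast; omega
      have e3 : n.1 + n.2 - 1 = m := by omega
      rw [e1, e2, e3, zpow_sub₀ hs0, zpow_natCast, zpow_natCast, zpow_natCast, mul_pow, inv_pow,
        pow_mul, pow_succ s m]
      field_simp
    · simp [h]

theorem ratioKernel_curvePoint (hp : IsWalk p) (hη : IsRootFunction p η) {s : ℂ} (hs : ‖s‖ = 1) :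
    ratioKernel p (s ^ 2) (curvePoint η s) = 0 := by
  have hs0 := ne_zero_of_norm_eq_one hs
  by_cases h11 : p 1 1 = 0
  · have h := hη.reduced_root h11 s hs
    rw [reducedKernel_eq hp h11 hs] at h
    exact (mul_eq_zero.mp h).resolve_left (inv_ne_zero hs0)
  · have h := hη.root s hs
    have hd : defect p = 0 := by simp [defect, h11]
    have h2 := kernel_mul_self hp (s ^ 2) (curvePoint η s)
    rw [sq_mul_curvePoint hs, hd, pow_zero, one_mul] at h2
    rw [← h2]; exact h

theorem kernelDiff₁_ne_zero (hp : IsWalk p) (h11 : p 1 1 = 0) {u y a : ℂ} (hu : ‖u‖ = 1)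
    (hy : ‖y‖ < 1) (ha : ‖a‖ ≤ 1) : kernelDiff₁ p u y a ≠ 0 := by
  intro h
  have := re_inv_mul_kernelDiff₁_pos hp h11 hu hy ha
  simp [h] at this

theorem ratioKernel_eq_sub_mul (hp : IsWalk p) (hη : IsRootFunction p η)
    {s : ℂ} (hs : ‖s‖ = 1) {y : ℂ} (hy : ‖y‖ ≤ 1) :
    ratioKernel p (s ^ 2) y =
      (y - curvePoint η s) * kernelDiff₁ p (s ^ 2) y (curvePoint η s) := by
  rw [sub_mul_kernelDiff₁ hp (by simp [hs]) hy (norm_curvePoint_le hη hs),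
    ratioKernel_curvePoint hp hη hs, sub_zero]

/-- If `p 1 1 = 0` there is only one root `y` with given unimodular ratio. -/
theorem eq_curvePoint_of_p_eq_zero (hp : IsWalk p) (hη : IsRootFunction p η) (h11 : p 1 1 = 0)
    {s : ℂ} (hs : ‖s‖ = 1) {y : ℂ} (hy : ‖y‖ ≤ 1) (h : ratioKernel p (s ^ 2) y = 0) :
    y = curvePoint η s := by
  have hu : ‖s ^ 2‖ = 1 := by simp [hs]
  rcases hy.lt_or_eq with hy1 | hy1
  · rw [ratioKernel_eq_sub_mul hp hη hs hy, mul_eq_zero] at h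
    exact sub_eq_zero.mp (h.resolve_right
      (kernelDiff₁_ne_zero hp h11 hu hy1 (norm_curvePoint_le hη hs)))
  · obtain ⟨hu1, hy2⟩ := eq_one_of_ratioKernel_eq_zero hp hu hy1 h
    subst hy2
    rcases (norm_curvePoint_le hη hs).lt_or_eq with h1 | h1
    · have h2 := sub_mul_kernelDiff₁ hp hu.le h1.le (a := 1) (by simp)
      rw [h, ratioKernel_curvePoint hp hη hs, sub_zero, mul_eq_zero] at h2
      exact (sub_eq_zero.mp (h2.resolve_right (kernelDiff₁_ne_zero hp h11 hu h1 (by simp)))).symm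
    · exact (eq_one_of_ratioKernel_eq_zero hp hu h1 (ratioKernel_curvePoint hp hη hs)).2.symm

theorem curvePoint_neg (hp : IsWalk p) (hη : IsRootFunction p η) (h11 : p 1 1 = 0) {s : ℂ}
    (hs : ‖s‖ = 1) : curvePoint η (-s) = curvePoint η s := by
  refine eq_curvePoint_of_p_eq_zero hp hη h11 hs (norm_curvePoint_le hη (by simp [hs])) ?_
  have := ratioKernel_curvePoint hp hη (s := -s) (by simp [hs])
  rwa [neg_sq] at this

/-- The curve `S₂ η` is non-self-intersecting: `s` runs through it once, or twice if
`p 1 1 = 0`. -/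
def SimpleCurve (p : ℤ → ℤ → ℝ) (η : ℂ → ℂ) : Prop :=
  ∀ s t : ℂ, ‖s‖ = 1 → ‖t‖ = 1 → curvePoint η s = curvePoint η t → s = t ∨ (p 1 1 = 0 ∧ s = -t)

theorem curvePoint_ne_neg (hs₂ : SimpleCurve p η) (h11 : p 1 1 ≠ 0) {s : ℂ} (hs : ‖s‖ = 1) :
    curvePoint η s ≠ curvePoint η (-s) := by
  intro h
  rcases hs₂ s (-s) hs (by simp [hs]) h with h | h
  · exact ne_zero_of_norm_eq_one hs (self_eq_neg.mp h)
  · exact h11 h.1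

theorem ratioKernel_eq_sub_mul_sub_mul (hp : IsWalk p) (hη : IsRootFunction p η)
    (hs₂ : SimpleCurve p η) (h11 : p 1 1 ≠ 0) {s : ℂ} (hs : ‖s‖ = 1) {y : ℂ} (hy : ‖y‖ ≤ 1) :
    ratioKernel p (s ^ 2) y = (y - curvePoint η s) * (y - curvePoint η (-s)) *
      kernelDiff₂ p (s ^ 2) y (curvePoint η s) (curvePoint η (-s)) := by
  have hu : ‖s ^ 2‖ = 1 := by simp [hs]
  have ha := norm_curvePoint_le hη hs
  have hb := norm_curvePoint_le hη (s := -s) (by simp [hs])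
  have h1 := sub_mul_kernelDiff₁ hp hu.le hy ha
  have h2 := sub_mul_kernelDiff₁ hp hu.le hb ha
  have h3 := sub_mul_kernelDiff₂ hp hu.le hy ha hb
  have h4 := ratioKernel_curvePoint hp hη (s := -s) (by simp [hs])
  rw [neg_sq] at h4
  rw [ratioKernel_curvePoint hp hη hs, sub_zero] at h1 h2
  rw [h4] at h2
  have h5 := (mul_eq_zero.mp h2).resolve_left (sub_ne_zero.mpr (curvePoint_ne_neg hs₂ h11 hs).symm)
  rw [h5, sub_zero] at h3
  rw [mul_assoc, h3, h1]

theorem norm_curvePoint_lt (hp : IsWalk p) (hη : IsRootFunction p η) {s : ℂ} (hs : ‖s‖ = 1)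
    (h1 : s ^ 2 ≠ 1) : ‖curvePoint η s‖ < 1 := by
  refine lt_of_le_of_ne (norm_curvePoint_le hη hs) fun h => h1 ?_
  exact (eq_one_of_ratioKernel_eq_zero hp (by simp [hs]) h (ratioKernel_curvePoint hp hη hs)).1

/-- By Rouché's theorem, comparing with `u * y ^ 2`, the function `ratioKernel p u` has two zeros in
the unit disc if `u ≠ 1`. These are the two points of the curve, so the cofactor has no zeros. -/
theorem kernelDiff₂_ne_zero_of_sq_ne_one (hp : IsWalk p) (hη : IsRootFunction p η)
    (hs₂ : SimpleCurve p η) (h11 : p 1 1 ≠ 0) {s : ℂ} (hs : ‖s‖ = 1) (h1 : s ^ 2 ≠ 1) {y : ℂ}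
    (hy : ‖y‖ < 1) : kernelDiff₂ p (s ^ 2) y (curvePoint η s) (curvePoint η (-s)) ≠ 0 := by
  have hu : ‖s ^ 2‖ = 1 := by simp [hs]
  have hd : defect p = 0 := by simp [defect, h11]
  have ha := norm_curvePoint_lt hp hη hs h1
  have hb := norm_curvePoint_lt hp hη (s := -s) (by simp [hs]) (by rwa [neg_sq])
  set u := s ^ 2
  set a := curvePoint η s
  set b := curvePoint η (-s)
  let S : ℂ → ℂ := fun y => ∑' n : ℕ × ℕ, (coef p n : ℂ) * u ^ n.1 * y ^ (n.1 + n.2)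
  have hratio : ∀ y, ratioKernel p u y = u * y ^ 2 - S y := fun y => by
    simp only [ratioKernel, hd]; rfl
  have hSc : ContinuousOn S (closedBall 0 1) :=
    continuousOn_tsum (fun n => by fun_prop) hp.hasSum_coef.summable fun n v hv =>
      norm_ratioKernel_term_le hp hu.le (mem_closedBall_zero_iff.mp hv) n _
  have hS1 : ∀ y : ℂ, ‖y‖ = 1 → ‖S y‖ < ‖y‖ ^ 2 := fun y hy => by
    rw [hy, one_pow]
    have h2 := norm_tsum_coef_pow_lt hp (x := u * y) (y := y) (by rw [norm_mul, hu, hy, one_mul]) hy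
      (by rintro ⟨h3, rfl⟩; exact h1 (by simpa using h3))
    have h3 : ∀ n : ℕ × ℕ, (coef p n : ℂ) * (u * y) ^ n.1 * y ^ n.2 =
        (coef p n : ℂ) * u ^ n.1 * y ^ (n.1 + n.2) := fun n => by rw [mul_pow, pow_add]; ring
    simpa only [h3] using h2
  -- the estimate on the unit circle persists on slightly smaller circles
  obtain ⟨ρ₀, hρ₀, hS⟩ : ∃ ρ₀ < 1, ∀ y : ℂ, ρ₀ < ‖y‖ → ‖y‖ ≤ 1 → ‖S y‖ < ‖y‖ ^ 2 := by
    have hK : IsCompact {y ∈ closedBall (0 : ℂ) 1 | 0 ≤ ‖S y‖ - ‖y‖ ^ 2} := by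
      have : IsClosed {y ∈ closedBall (0 : ℂ) 1 | 0 ≤ ‖S y‖ - ‖y‖ ^ 2} :=
        (hSc.norm.sub (by fun_prop)).preimage_isClosed_of_isClosed isClosed_closedBall isClosed_Ici
      exact (isCompact_closedBall (0 : ℂ) 1).of_isClosed_subset this fun y hy => hy.1
    rcases Set.eq_empty_or_nonempty {y ∈ closedBall (0 : ℂ) 1 | 0 ≤ ‖S y‖ - ‖y‖ ^ 2} with he | hne
    · refine ⟨0, one_pos, fun y _ hy => ?_⟩
      by_contra! h
      have : y ∈ {y ∈ closedBall (0 : ℂ) 1 | 0 ≤ ‖S y‖ - ‖y‖ ^ 2} :=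
        ⟨by simpa using hy, by linarith⟩
      rw [he] at this
      exact this
    · obtain ⟨z, hz, hmax⟩ := hK.exists_isMaxOn hne continuous_norm.continuousOn
      refine ⟨‖z‖, lt_of_le_of_ne (mem_closedBall_zero_iff.mp hz.1) fun h => ?_, fun y hy hy1 => ?_⟩
      · linarith [hS1 z h, hz.2]
      · by_contra! h
        exact absurd (hmax (show y ∈ {y ∈ closedBall (0 : ℂ) 1 | 0 ≤ ‖S y‖ - ‖y‖ ^ 2} from
          ⟨by simpa using hy1, by linarith⟩)) (not_le.mpr hy)
  obtain ⟨ρ, hρ, hρ1⟩ := exists_between (max_lt hρ₀ (max_lt ha (max_lt hb hy)))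
  simp only [max_lt_iff] at hρ
  obtain ⟨hρρ, haρ, hbρ, hyρ⟩ := hρ
  have hρ0 : 0 < ρ := (norm_nonneg y).trans_lt hyρ
  have hρ0' : (ρ : ℂ) ≠ 0 := by exact_mod_cast hρ0.ne'
  have hnorm : ∀ z : ℂ, ‖ρ * z‖ = ρ * ‖z‖ := fun z => by
    rw [norm_mul, Complex.norm_real, Real.norm_of_nonneg hρ0.le]
  have hsub : MapsTo (fun z : ℂ => ρ * z) (sphere 0 1) (closedBall 0 1) := fun z hz => by
    rw [mem_closedBall_zero_iff, hnorm, mem_sphere_zero_iff_norm.mp hz]; linarith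
  have w1 : CircleWinding (fun z => ratioKernel p u (ρ * z)) 2 := by
    have h2 : CircleWinding (fun z => (u * ρ ^ 2) * (z * z)) (0 + (1 + 1)) :=
      (circleWinding_const (mul_ne_zero (ne_zero_of_norm_eq_one hu) (pow_ne_zero 2 hρ0'))).mul
        (circleWinding_id.mul circleWinding_id)
    refine h2.of_norm_sub_lt (by fun_prop) ?_ fun z hz => ?_
    · simp only [hratio]
      exact ContinuousOn.sub (by fun_prop) (hSc.comp (by fun_prop) hsub)
    · have h3 := hS (ρ * z) (by rw [hnorm, hz, mul_one]; exact hρρ)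
        (by rw [hnorm, hz, mul_one]; exact hρ1.le)
      rw [hnorm, hz, mul_one] at h3
      rw [hratio]
      have h4 : u * (ρ * z) ^ 2 - S (ρ * z) - u * ρ ^ 2 * (z * z) = - S (ρ * z) := by ring
      rw [h4, norm_neg]
      simpa [hu, hz, abs_of_pos hρ0] using h3
  have hlin : ∀ c : ℂ, ‖c‖ < ρ → CircleWinding (fun z => ρ * z - c) 1 := fun c hc => by
    have h2 : CircleWinding (fun z => ρ * (z - c / ρ)) (0 + 1) :=
      (circleWinding_const hρ0').mul (circleWinding_sub_of_lt (by
        rw [norm_div, Complex.norm_real, Real.norm_of_nonneg hρ0.le, div_lt_one hρ0]; exact hc))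
    exact h2.congr fun z _ => by field_simp
  set D : ℂ → ℂ := fun z => kernelDiff₂ p u (ρ * z) a b
  have hDd : DifferentiableOn ℂ D (ball 0 ρ⁻¹) := by
    refine (differentiableOn_kernelDiff₂ hp hu.le ha.le hb.le).comp
      (by fun_prop : Differentiable ℂ fun z : ℂ => (ρ : ℂ) * z).differentiableOn fun z hz => ?_
    rw [mem_ball_zero_iff] at hz ⊢
    rw [hnorm]
    calc ρ * ‖z‖ < ρ * ρ⁻¹ := by gcongr
      _ = 1 := mul_inv_cancel₀ hρ0.ne'
  have hR : 1 < ρ⁻¹ := (one_lt_inv₀ hρ0).mpr hρ1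
  have hfac : ∀ z : ℂ, ‖z‖ = 1 →
      ratioKernel p u (ρ * z) = (ρ * z - a) * (ρ * z - b) * D z := fun z hz =>
    ratioKernel_eq_sub_mul_sub_mul hp hη hs₂ h11 hs (by rw [hnorm, hz]; linarith)
  obtain ⟨k, hk⟩ := exists_circleWinding (f := D)
    (hDd.continuousOn.mono fun z hz => by
      rw [mem_ball_zero_iff, mem_sphere_zero_iff_norm.mp hz]; exact hR) fun z hz h => by
      apply w1.ne_zero hz
      rw [hfac z hz, h, mul_zero]
  have hk0 : k = 0 := by
    have := w1.unique ((((hlin a haρ).mul (hlin b hbρ)).mul hk).congr hfac)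
    omega
  subst hk0
  have := hk.ne_zero_of_winding_zero hR hDd (z := y / ρ) (by
    rw [norm_div, Complex.norm_real, Real.norm_of_nonneg hρ0.le, div_le_one hρ0]; exact hyρ.le)
  simpa only [D, mul_div_cancel₀ y hρ0'] using this

/-- For `s ^ 2 = 1` the estimate for Rouché's theorem fails at `y = 1`; this case follows by
persistence of zeros. -/
theorem kernelDiff₂_ne_zero (hp : IsWalk p) (hη : IsRootFunction p η)
    (hs₂ : SimpleCurve p η) (h11 : p 1 1 ≠ 0) {s : ℂ} (hs : ‖s‖ = 1) {y : ℂ}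
    (hy : ‖y‖ < 1) : kernelDiff₂ p (s ^ 2) y (curvePoint η s) (curvePoint η (-s)) ≠ 0 := by
  by_cases h1 : s ^ 2 = 1
  swap
  · exact kernelDiff₂_ne_zero_of_sq_ne_one hp hη hs₂ h11 hs h1 hy
  -- a zero would persist for the nearby points `s * exp (i t)` with `t > 0`
  intro hzero
  set e : ℝ → ℂ := fun t => s * Complex.exp (t * Complex.I)
  have he : ∀ t, ‖e t‖ = 1 := fun t => by simp [e, hs]
  have hec : Continuous e := by fun_prop
  have he0 : e 0 = s := by simp [e]
  set F : ℝ → ℂ → ℂ := fun t y =>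
    kernelDiff₂ p (e t ^ 2) y (curvePoint η (e t)) (curvePoint η (-(e t)))
  have hFd : ∀ t, DifferentiableOn ℂ (F t) (ball 0 1) := fun t =>
    differentiableOn_kernelDiff₂ hp (by simp [he]) (norm_curvePoint_le hη (he t))
      (norm_curvePoint_le hη (by simp [he]))
  obtain ⟨r, hr, hr1⟩ := exists_between (sub_pos.mpr hy)
  have hsub : closedBall y r ⊆ ball 0 1 := fun z hz => by
    rw [mem_closedBall, dist_eq_norm] at hz
    rw [mem_ball_zero_iff]
    have := norm_add_le (z - y) y
    rw [sub_add_cancel] at this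
    linarith
  have hcp : Continuous fun t => curvePoint η (e t) :=
    (continuousOn_curvePoint hη).comp_continuous hec fun t => by simp [he]
  have hcn : Continuous fun t => curvePoint η (-(e t)) :=
    (continuousOn_curvePoint hη).comp_continuous hec.neg fun t => by simp [he]
  have hFc : ContinuousOn (Function.uncurry F) (univ ×ˢ closedBall y r) := by
    refine (continuousOn_kernelDiff₂ hp).comp (f := fun v : ℝ × ℂ =>
      (e v.1 ^ 2, v.2, curvePoint η (e v.1), curvePoint η (-(e v.1)))) ?_ fun v hv =>
      ⟨by simp [he], (mem_ball_zero_iff.mp (hsub hv.2)).le, norm_curvePoint_le hη (he _),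
        norm_curvePoint_le hη (by simp [he])⟩
    exact (((hec.comp continuous_fst).pow 2).prodMk (continuous_snd.prodMk
      ((hcp.comp continuous_fst).prodMk (hcn.comp continuous_fst)))).continuousOn
  have hlim : TendstoUniformlyOn F (F 0) (𝓝 0) (ball y r) := by
    refine TendstoUniformlyOn.mono (fun W hW => ?_) ball_subset_closedBall
    obtain ⟨v, hv, hvu⟩ := (isCompact_closedBall y r).mem_uniformity_of_prod hFc (mem_univ 0)
      (symm_le_uniformity hW)
    rw [nhdsWithin_univ] at hv
    filter_upwards [hv] with t ht z hz using hvu t ht z hz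
  have hev := eventually_exists_zero hr ((hFd 0).mono (ball_subset_closedBall.trans hsub))
    (Eventually.of_forall fun t => (hFd t).mono (ball_subset_closedBall.trans hsub))
    (fun W hW => nhdsWithin_le_nhds (hlim W hW) :
      TendstoUniformlyOn F (F 0) (𝓝[>] 0) (ball y r))
    (by simpa only [F, he0] using hzero) ?_ hr
  · have hsmall : ∀ᶠ t : ℝ in 𝓝[>] 0, t < π / 2 :=
      nhdsWithin_le_nhds (Iio_mem_nhds Real.pi_div_two_pos)
    obtain ⟨t, ⟨z, hz, hz0⟩, ht, ht0⟩ := (hev.and (hsmall.and self_mem_nhdsWithin)).exists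
    refine kernelDiff₂_ne_zero_of_sq_ne_one hp hη hs₂ h11 (he t) ?_
      (mem_ball_zero_iff.mp (hsub hz)) hz0
    intro h2
    have h3 : Complex.exp ((2 * t : ℝ) * Complex.I) = 1 := by
      have : Complex.exp ((2 * t : ℝ) * Complex.I) = Complex.exp (t * Complex.I) ^ 2 := by
        rw [← Complex.exp_nat_mul]; congr 1; push_cast; ring
      rw [this, ← h2, mul_pow, h1, one_mul]
    have h4 : Real.sin (2 * t) = 0 := by
      have := congrArg Complex.im h3
      rwa [Complex.exp_ofReal_mul_I_im, Complex.one_im] at this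
    exact (Real.sin_pos_of_pos_of_lt_pi (by linarith [show 0 < t from ht0]) (by linarith)).ne' h4
  · -- otherwise `ratioKernel p 1` would vanish identically, but its value at `0` is `-p 1 1`
    intro hid
    have h2 := ((hFd 0).analyticOnNhd isOpen_ball).eqOn_of_preconnected_of_eventuallyEq
      analyticOnNhd_const (convex_ball (0 : ℂ) 1).isPreconnected (mem_ball_zero_iff.mpr hy) hid
    have h3 := h2 (mem_ball_self one_pos)
    have h4 := ratioKernel_eq_sub_mul_sub_mul hp hη hs₂ h11 hs (y := 0) (by simp)
    simp only [F, he0] at h3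
    rw [h3, mul_zero] at h4
    have h5 := kernel_mul_self hp (s ^ 2) 0
    rw [h4, mul_zero, mul_zero, kernel_eq hp, mul_zero, zero_sub, neg_eq_zero,
      tsum_eq_single (0 : ℕ × ℕ)] at h5
    · simp [coef, h11] at h5
    · intro n hn
      rcases Nat.eq_zero_or_pos n.1 with h | h
      · rcases Nat.eq_zero_or_pos n.2 with h' | h'
        · exact absurd (Prod.ext h h') hn
        · simp [h'.ne']
      · simp [h.ne']

/-- The zeros of the kernel with unimodular ratio are exactly the points of the curve. -/
theorem exists_curvePoint_of_ratioKernel_eq_zero (hp : IsWalk p) (hη : IsRootFunction p η)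
    (hs₂ : SimpleCurve p η) {u y : ℂ} (hu : ‖u‖ = 1) (hy : ‖y‖ ≤ 1) (h : ratioKernel p u y = 0) :
    ∃ s : ℂ, ‖s‖ = 1 ∧ s ^ 2 = u ∧ y = curvePoint η s := by
  obtain ⟨s, hsu⟩ := IsAlgClosed.exists_pow_nat_eq u two_pos
  have hs : ‖s‖ = 1 := by
    have : ‖s‖ ^ 2 = 1 := by rw [← norm_pow, hsu, hu]
    exact (pow_eq_one_iff_of_nonneg (norm_nonneg s) two_ne_zero).mp this
  rw [← hsu] at h
  by_cases h11 : p 1 1 = 0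
  · exact ⟨s, hs, hsu, eq_curvePoint_of_p_eq_zero hp hη h11 hs hy h⟩
  rcases hy.lt_or_eq with hy1 | hy1
  · rw [ratioKernel_eq_sub_mul_sub_mul hp hη hs₂ h11 hs hy, mul_eq_zero, mul_eq_zero] at h
    rcases h with (h | h) | h
    · exact ⟨s, hs, hsu, sub_eq_zero.mp h⟩
    · exact ⟨-s, by simp [hs], by simp [hsu], sub_eq_zero.mp h⟩
    · exact absurd h (kernelDiff₂_ne_zero hp hη hs₂ h11 hs hy1)
  · obtain ⟨h1, h2⟩ := eq_one_of_ratioKernel_eq_zero hp (by simp [hs]) hy1 h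
    exact ⟨1, by simp, by rw [← hsu, h1, one_pow], by rw [h2, curvePoint_one hη]⟩

theorem mem_S₂_iff (hp : IsWalk p) (hη : IsRootFunction p η) (hs₂ : SimpleCurve p η) {y : ℂ} :
    y ∈ S₂ η ↔ ‖y‖ ≤ 1 ∧ ∃ u : ℂ, ‖u‖ = 1 ∧ ratioKernel p u y = 0 := by
  constructor
  · rintro ⟨s, hs, rfl⟩
    have hs := mem_sphere_zero_iff_norm.mp hs
    exact ⟨norm_curvePoint_le hη hs, s ^ 2, by simp [hs], ratioKernel_curvePoint hp hη hs⟩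
  · rintro ⟨hy, u, hu, h⟩
    obtain ⟨s, hs, -, rfl⟩ := exists_curvePoint_of_ratioKernel_eq_zero hp hη hs₂ hu hy h
    exact ⟨s, by simpa using hs, rfl⟩

/-- As the curve is non-self-intersecting, each of its points has only one unimodular ratio. -/
theorem ratio_unique (hp : IsWalk p) (hη : IsRootFunction p η) (hs₂ : SimpleCurve p η)
    {u v y : ℂ} (hy : ‖y‖ ≤ 1) (hu : ‖u‖ = 1) (hv : ‖v‖ = 1) (h : ratioKernel p u y = 0)
    (h' : ratioKernel p v y = 0) : u = v := by
  obtain ⟨s, hs, rfl, hys⟩ := exists_curvePoint_of_ratioKernel_eq_zero hp hη hs₂ hu hy h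
  obtain ⟨t, ht, rfl, hyt⟩ := exists_curvePoint_of_ratioKernel_eq_zero hp hη hs₂ hv hy h'
  rcases hs₂ s t hs ht (hys.symm.trans hyt) with rfl | ⟨-, rfl⟩
  · rfl
  · ring

/-- The roots on the curve are simple in the variable `y`. -/
theorem ratioKernelDeriv₂_curvePoint_ne_zero (hp : IsWalk p) (hη : IsRootFunction p η)
    (hs₂ : SimpleCurve p η) {s : ℂ} (hs : ‖s‖ = 1) (h1 : ‖curvePoint η s‖ < 1) :
    ratioKernelDeriv₂ p (s ^ 2) (curvePoint η s) ≠ 0 := by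
  have hu : ‖s ^ 2‖ = 1 := by simp [hs]
  have hns : ‖-s‖ = 1 := by simp [hs]
  set a := curvePoint η s with ha
  obtain ⟨g, hgc, hga, hg⟩ : ∃ g : ℂ → ℂ, ContinuousAt g a ∧ g a ≠ 0 ∧
      ∀ y : ℂ, ‖y‖ ≤ 1 → ratioKernel p (s ^ 2) y = (y - a) * g y := by
    have hnhds : closedBall (0 : ℂ) 1 ∈ 𝓝 a :=
      mem_of_superset (isOpen_ball.mem_nhds (mem_ball_zero_iff.mpr h1)) ball_subset_closedBall
    by_cases h11 : p 1 1 = 0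
    · refine ⟨fun y => kernelDiff₁ p (s ^ 2) y a, ?_, kernelDiff₁_ne_zero hp h11 hu h1 h1.le,
        fun y hy => ratioKernel_eq_sub_mul hp hη hs hy⟩
      refine ContinuousOn.continuousAt (s := closedBall 0 1) ?_ hnhds
      exact (continuousOn_kernelDiff₁ hp).comp (f := fun y : ℂ => (s ^ 2, y, a)) (by fun_prop)
        fun y hy => ⟨hu.le, mem_closedBall_zero_iff.mp hy, h1.le⟩
    · refine ⟨fun y => (y - curvePoint η (-s)) * kernelDiff₂ p (s ^ 2) y a (curvePoint η (-s)), ?_,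
        mul_ne_zero (sub_ne_zero.mpr (curvePoint_ne_neg hs₂ h11 hs))
          (kernelDiff₂_ne_zero hp hη hs₂ h11 hs h1), fun y hy => ?_⟩
      · refine ContinuousOn.continuousAt (s := closedBall 0 1) ?_ hnhds
        refine ContinuousOn.mul (by fun_prop) ?_
        exact (continuousOn_kernelDiff₂ hp).comp
          (f := fun y : ℂ => (s ^ 2, y, a, curvePoint η (-s))) (by fun_prop)
          fun y hy => ⟨hu.le, mem_closedBall_zero_iff.mp hy, h1.le, norm_curvePoint_le hη hns⟩
      · rw [ratioKernel_eq_sub_mul_sub_mul hp hη hs₂ h11 hs hy, mul_assoc]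
  obtain ⟨ρ, hρ, -, hmem⟩ := exists_kernelDomain hu.le h1
  have hd : HasDerivAt (fun y => ratioKernel p (s ^ 2) y) (g a) a := by
    rw [hasDerivAt_iff_tendsto_slope]
    refine (hgc.tendsto.mono_left nhdsWithin_le_nhds).congr' ?_
    have hball : ∀ᶠ y in 𝓝[≠] a, y ∈ ball (0 : ℂ) 1 :=
      nhdsWithin_le_nhds (isOpen_ball.mem_nhds (mem_ball_zero_iff.mpr h1))
    filter_upwards [hball, self_mem_nhdsWithin] with y hy hya
    have hya' : y - a ≠ 0 := sub_ne_zero.mpr hya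
    rw [slope_def_field, hg y (mem_ball_zero_iff.mp hy).le, hg a h1.le, sub_self, zero_mul,
      sub_zero, mul_div_cancel_left₀ _ hya']
  rw [(hasDerivAt_ratioKernel₂ hp hρ hmem).unique hd]
  exact hga

/-! ### Winding number of the curve and number of roots -/

theorem period_pos (p : ℤ → ℤ → ℝ) : 0 < period p := by
  rcases defect_cases p with h | h <;> rw [h.2.2] <;> positivity

theorem curve₂_add_pi (t : ℝ) :
    curve₂ η (t + π) = curvePoint η (-Complex.exp (t * Complex.I)) := by
  have : Complex.exp ((t + π : ℝ) * Complex.I) = -Complex.exp (t * Complex.I) := by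
    push_cast; rw [add_mul, Complex.exp_add, Complex.exp_pi_mul_I, mul_neg_one]
  rw [← this]; rfl

theorem curve₂_add_two_pi (t : ℝ) : curve₂ η (t + 2 * π) = curve₂ η t := by
  rw [two_mul, ← add_assoc, curve₂_add_pi, Complex.ofReal_add, add_mul, Complex.exp_add,
    Complex.exp_pi_mul_I, mul_neg_one, neg_neg]; rfl

theorem curve₂_add_period (hp : IsWalk p) (hη : IsRootFunction p η) (t : ℝ) :
    curve₂ η (t + period p) = curve₂ η t := by
  rcases defect_cases p with h | h <;> rw [h.2.2]
  · exact curve₂_add_two_pi t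
  · rw [curve₂_add_pi, curvePoint_neg hp hη h.1 (norm_exp_mul_I t)]; rfl

theorem curve₂_period (hp : IsWalk p) (hη : IsRootFunction p η) :
    curve₂ η (period p) = curve₂ η 0 := by
  simpa using curve₂_add_period hp hη 0

theorem curve₂_mem (t : ℝ) : curve₂ η t ∈ S₂ η :=
  ⟨Complex.exp (t * Complex.I), by simp, rfl⟩

theorem image_curve₂ (hp : IsWalk p) (hη : IsRootFunction p η) :
    curve₂ η '' Icc 0 (period p) = S₂ η := by
  refine Subset.antisymm (by rintro _ ⟨t, -, rfl⟩; exact curve₂_mem t) ?_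
  rintro _ ⟨s, hs, rfl⟩
  obtain ⟨t, ht⟩ := (Complex.norm_eq_one_iff s).mp (mem_sphere_zero_iff_norm.mp hs)
  have hper : Function.Periodic (curve₂ η) (period p) := curve₂_add_period hp hη
  obtain ⟨t', ht', htt⟩ := hper.exists_mem_Ico₀ (period_pos p) t
  refine ⟨t', Ico_subset_Icc_self ht', ?_⟩
  rw [← htt, ← ht]; rfl

theorem HasLogWinding.half_speed {c : ℝ → ℂ} {T : ℝ} {n : ℤ} (h : HasLogWinding c T n) :
    HasLogWinding (fun t => c (t / 2)) (2 * T) n := by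
  obtain ⟨g, hg, hge, hn⟩ := h
  have hmem : ∀ t ∈ Icc 0 (2 * T), t / 2 ∈ Icc 0 T := fun t ht =>
    ⟨by linarith [ht.1], by linarith [ht.2]⟩
  refine ⟨fun t => g (t / 2), hg.comp (by fun_prop) hmem, fun t ht => hge _ (hmem t ht), ?_⟩
  simpa only [mul_div_cancel_left₀ T two_ne_zero, zero_div] using hn

/-- A closed curve winds as often as the product of its two halves. -/
theorem HasLogWinding.mul_halves {c : ℝ → ℂ} {T : ℝ} {n : ℤ} (hT : 0 ≤ T)
    (h : HasLogWinding c (2 * T) n) :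
    HasLogWinding (fun t => c (t / 2) * c (t / 2 + T)) (2 * T) n := by
  obtain ⟨g, hg, hge, hn⟩ := h
  have hmem : ∀ t ∈ Icc 0 (2 * T), t / 2 ∈ Icc 0 (2 * T) := fun t ht =>
    ⟨by linarith [ht.1], by linarith [ht.2]⟩
  have hmem' : ∀ t ∈ Icc 0 (2 * T), t / 2 + T ∈ Icc 0 (2 * T) := fun t ht =>
    ⟨by linarith [ht.1], by linarith [ht.2]⟩
  refine ⟨fun t => g (t / 2) + g (t / 2 + T), (hg.comp (by fun_prop) hmem).add
    (hg.comp (by fun_prop) hmem'), fun t ht => ?_, ?_⟩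
  · rw [Complex.exp_add, ← hge _ (hmem t ht), ← hge _ (hmem' t ht)]
  · simp only [mul_div_cancel_left₀ T two_ne_zero, zero_div, zero_add, ← two_mul]
    linear_combination hn

theorem exp_half_sq (t : ℝ) :
    Complex.exp ((t / 2 : ℝ) * Complex.I) ^ 2 = Complex.exp (t * Complex.I) := by
  rw [← Complex.exp_nat_mul]; congr 1; push_cast; ring

theorem circleWinding_ratioKernel_neg_one (hp : IsWalk p) (h11 : p 1 1 ≠ 0) :
    CircleWinding (fun u => ratioKernel p u (-1)) 1 := by
  have hd : defect p = 0 := by simp [defect, h11]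
  have hc : ContinuousOn (fun u => ratioKernel p u (-1)) (sphere 0 1) :=
    (continuousOn_ratioKernel hp).comp (f := fun u : ℂ => (u, (-1 : ℂ))) (by fun_prop) fun u hu =>
      ⟨sphere_subset_closedBall hu, by simp⟩
  refine circleWinding_id.of_norm_sub_lt continuousOn_id hc fun u hu => ?_
  have h1 := norm_tsum_coef_pow_lt hp (x := u * -1) (y := -1) (by simp [hu]) (by simp)
    (by rintro ⟨-, h⟩; norm_num at h)
  have h2 : ratioKernel p u (-1) - u =
      -∑' n : ℕ × ℕ, (coef p n : ℂ) * (u * -1) ^ n.1 * (-1) ^ n.2 := by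
    have := kernel_mul_self hp u (-1)
    rw [hd, pow_zero, one_mul, kernel_eq hp] at this
    rw [← this]; ring
  rw [h2, norm_neg, hu]
  exact h1

theorem circleWinding_of_kernelDiff₂ (hp : IsWalk p) (hη : IsRootFunction p η)
    (hs₂ : SimpleCurve p η) (h11 : p 1 1 ≠ 0) {y : ℂ} (hy : ‖y‖ ≤ 1) {n m : ℤ}
    (hn : HasLogWinding (fun t => curve₂ η t - y) (2 * π) n)
    (hm : HasLogWinding (fun t => kernelDiff₂ p (Complex.exp (t * Complex.I)) y
      (curve₂ η (t / 2)) (curve₂ η (t / 2 + π))) (2 * π) m) :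
    CircleWinding (fun u => ratioKernel p u y) (n + m) := by
  refine ((hn.mul_halves Real.pi_pos.le).mul hm).congr fun t _ => ?_
  have h := ratioKernel_eq_sub_mul_sub_mul hp hη hs₂ h11 (norm_exp_mul_I (t / 2)) hy
  rw [exp_half_sq, ← curve₂_add_pi] at h
  refine h.trans ?_
  change (y - curve₂ η (t / 2)) * _ * kernelDiff₂ p _ _ (curve₂ η (t / 2)) _ = _
  ring

/-- The cofactor of the two roots on the curve winds once: this is clear at `y = -1`, and the
cofactor does not vanish as `y` moves there. -/
theorem hasLogWinding_kernelDiff₂ (hp : IsWalk p) (hη : IsRootFunction p η)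
    (hs₂ : SimpleCurve p η) (h11 : p 1 1 ≠ 0) {y : ℂ} (hy : ‖y‖ < 1) :
    HasLogWinding (fun t => kernelDiff₂ p (Complex.exp (t * Complex.I)) y
        (curve₂ η (t / 2)) (curve₂ η (t / 2 + π))) (2 * π) 1 := by
  set D : ℂ → ℝ → ℂ := fun w t => kernelDiff₂ p (Complex.exp (t * Complex.I)) w
        (curve₂ η (t / 2)) (curve₂ η (t / 2 + π)) with hD
  have hle : ∀ t, ‖curve₂ η t‖ ≤ 1 := fun t => norm_curvePoint_le hη (norm_exp_mul_I t)
  have hDeq : ∀ w t, D w t = kernelDiff₂ p (Complex.exp ((t / 2 : ℝ) * Complex.I) ^ 2) w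
      (curvePoint η (Complex.exp ((t / 2 : ℝ) * Complex.I)))
      (curvePoint η (-Complex.exp ((t / 2 : ℝ) * Complex.I))) := fun w t => by
    rw [exp_half_sq, ← curve₂_add_pi]; rfl
  have hns : (-1 : ℂ) ∉ S₂ η := by
    rw [mem_S₂_iff hp hη hs₂]
    rintro ⟨-, u, hu, h⟩
    have := (eq_one_of_ratioKernel_eq_zero hp hu (by simp) h).2
    norm_num at this
  have hcurve := continuous_curve₂ hη
  set S : Set ℂ := insert (-1) (ball 0 1)
  have hSle : ∀ w ∈ S, ‖w‖ ≤ 1 := by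
    rintro w (rfl | hw)
    · simp
    · exact (mem_ball_zero_iff.mp hw).le
  have hS : IsPreconnected S := by
    refine IsPreconnected.subset_closure (s := ball (0 : ℂ) 1)
      (convex_ball (0 : ℂ) 1).isPreconnected (subset_insert _ _) ?_
    rw [closure_ball _ one_ne_zero]
    exact fun w hw => mem_closedBall_zero_iff.mpr (hSle w hw)
  have hcont : ContinuousOn (Function.uncurry D) (S ×ˢ Icc 0 (2 * π)) := by
    refine (continuousOn_kernelDiff₂ hp).comp (f := fun v : ℂ × ℝ =>
      (Complex.exp (v.2 * Complex.I), v.1, curve₂ η (v.2 / 2), curve₂ η (v.2 / 2 + π)))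
      (by fun_prop) fun v hv => ⟨by simp, hSle _ hv.1, hle _, hle _⟩
  have hne : ∀ w ∈ S, ∀ t ∈ Icc 0 (2 * π), D w t ≠ 0 := by
    rintro w (rfl | hw) t -
    · intro h
      rw [hDeq] at h
      have h2 := ratioKernel_eq_sub_mul_sub_mul hp hη hs₂ h11
        (norm_exp_mul_I (t / 2)) (y := -1) (by simp)
      rw [h, mul_zero, exp_half_sq] at h2
      have := (eq_one_of_ratioKernel_eq_zero hp (norm_exp_mul_I t) (by simp) h2).2
      norm_num at this
    · rw [hDeq]
      exact kernelDiff₂_ne_zero hp hη hs₂ h11 (norm_exp_mul_I _) (mem_ball_zero_iff.mp hw)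
  have hcl : ∀ w ∈ S, D w (2 * π) = D w 0 := fun w _ => by
    simp only [hD]
    rw [mul_div_cancel_left₀ π two_ne_zero, ← two_mul, zero_div, zero_add, exp_two_pi_mul_I,
      kernelDiff₂_comm]
    have := curve₂_add_two_pi (η := η) 0
    rw [zero_add] at this
    rw [this]; simp
  obtain ⟨m, hm⟩ := exists_hasLogWinding Real.two_pi_pos.le
    (hcont.comp (f := fun t : ℝ => ((-1 : ℂ), t)) (by fun_prop) fun t ht => ⟨Or.inl rfl, ht⟩)
    (hne (-1) (Or.inl rfl)) (hcl _ (Or.inl rfl))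
  have hw0 : HasLogWinding (fun t => curve₂ η t - -1) (2 * π) 0 := by
    refine hasLogWinding_zero_of_re_pos (by fun_prop) (fun t _ => ?_) ?_
    · have h1 := hle t
      have h2 : curve₂ η t ≠ -1 := fun h => hns (h ▸ curve₂_mem t)
      -- a point of the closed disc with real part `-1` is `-1`
      by_contra! h
      simp only [sub_neg_eq_add, Complex.add_re, Complex.one_re] at h
      have h3 : ‖curve₂ η t‖ ^ 2 ≤ 1 := pow_le_one₀ (norm_nonneg _) h1
      rw [← Complex.normSq_eq_norm_sq, Complex.normSq_apply] at h3
      have h4 : (curve₂ η t).im = 0 := by nlinarith [sq_nonneg (curve₂ η t).im]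
      have h5 : (curve₂ η t).re = -1 := by nlinarith [sq_nonneg (curve₂ η t).im]
      exact h2 (Complex.ext (by simpa using h5) (by simpa using h4))
    · have := curve₂_add_two_pi (η := η) 0
      rw [zero_add] at this
      rw [this]
  have hm1 : m = 1 := by
    have := (circleWinding_of_kernelDiff₂ hp hη hs₂ h11 (by simp) hw0 hm).unique
      (circleWinding_ratioKernel_neg_one hp h11)
    omega
  subst hm1
  exact hm.homotopy Real.two_pi_pos.le hS hcont hne hcl (Or.inl rfl)
    (Or.inr (mem_ball_zero_iff.mpr hy))

/-- The number of roots in the unit disc is one plus the winding number of the curve `S₂ η`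
around `y`. -/
theorem circleWinding_ratioKernel (hp : IsWalk p) (hη : IsRootFunction p η)
    (hs₂ : SimpleCurve p η) {y : ℂ} (hy : ‖y‖ < 1) {w : ℤ}
    (hw : HasLogWinding (fun t => curve₂ η t - y) (period p) w) :
    CircleWinding (fun u => ratioKernel p u y) (w + 1) := by
  rcases defect_cases p with ⟨h11, hd, hper⟩ | ⟨h11, hd, hper⟩
  · rw [hper] at hw
    exact circleWinding_of_kernelDiff₂ hp hη hs₂ h11 hy.le hw
      (hasLogWinding_kernelDiff₂ hp hη hs₂ h11 hy)
  · rw [hper] at hw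
    have hle : ∀ t, ‖curve₂ η t‖ ≤ 1 := fun t => norm_curvePoint_le hη (norm_exp_mul_I t)
    have hcurve := continuous_curve₂ hη
    have hexp : ∀ t : ℝ, Complex.exp (t * Complex.I) ≠ 0 := fun t => Complex.exp_ne_zero _
    have h0 : HasLogWinding (fun t => (Complex.exp (t * Complex.I))⁻¹ *
        kernelDiff₁ p (Complex.exp (t * Complex.I)) y (curve₂ η (t / 2))) (2 * π) 0 := by
      refine hasLogWinding_zero_of_re_pos (ContinuousOn.mul ?_ ?_) (fun t _ =>
        re_inv_mul_kernelDiff₁_pos hp h11 (norm_exp_mul_I t) hy (hle _)) ?_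
      · exact (Continuous.inv₀ (by fun_prop) hexp).continuousOn
      · exact (continuousOn_kernelDiff₁ hp).comp (f := fun t : ℝ =>
          (Complex.exp (t * Complex.I), y, curve₂ η (t / 2))) (by fun_prop)
          fun t _ => ⟨by simp, hy.le, hle _⟩
      · rw [mul_div_cancel_left₀ π two_ne_zero, exp_two_pi_mul_I, zero_div]
        have := curve₂_period hp hη
        rw [hper] at this
        rw [this]; simp
    have h1 := (((hasLogWinding_const (neg_ne_zero.mpr one_ne_zero) _).mul hw.half_speed).mul
      hasLogWinding_exp).mul h0
    rw [zero_add, add_zero] at h1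
    refine h1.congr fun t _ => ?_
    have := ratioKernel_eq_sub_mul hp hη (norm_exp_mul_I (t / 2)) hy.le
    rw [exp_half_sq] at this
    refine this.trans ?_
    change (y - curve₂ η (t / 2)) * kernelDiff₁ p _ _ (curve₂ η (t / 2)) = _
    field_simp [hexp t]
    ring

theorem hasLogWinding_of_mem_outside_S₂ (hp : IsWalk p) (hη : IsRootFunction p η) {y : ℂ}
    (hy : y ∈ outside (S₂ η)) : HasLogWinding (fun t => curve₂ η t - y) (period p) 0 := by
  rw [← image_curve₂ hp hη] at hy
  exact hasLogWinding_of_mem_outside (period_pos p).le (continuous_curve₂ hη).continuousOn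
    (curve₂_period hp hη) hy

theorem hasLogWinding_of_mem_inside_S₂ (hp : IsWalk p) (hη : IsRootFunction p η) {ε : ℤ}
    (hε : HasOrientation (curve₂ η) (period p) ε) {y : ℂ} (hy : y ∈ inside (S₂ η)) :
    HasLogWinding (fun t => curve₂ η t - y) (period p) ε := by
  refine HasWindingNumber.hasLogWinding (hε y (by rwa [image_curve₂ hp hη]))
    (continuous_curve₂ hη).continuousOn (curve₂_period hp hη) fun t _ h => hy.1 ?_
  rw [← h]; exact curve₂_mem t

theorem mem_inside_or_mem_outside {S : Set ℂ} {y : ℂ} (hy : y ∉ S) :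
    y ∈ inside S ∨ y ∈ outside S := by
  by_cases h : Bornology.IsBounded (connectedComponentIn Sᶜ y)
  · exact Or.inl ⟨hy, h⟩
  · exact Or.inr ⟨hy, h⟩

/-! ### The kernel near a point of the curve -/

/-- Where the curve `S₂ η` is differentiable, its derivative does not vanish, except possibly at
the parameters of the point `1`. -/
def RegularCurve (p : ℤ → ℤ → ℝ) (η : ℂ → ℂ) : Prop :=
  ∀ φ : ℝ, Complex.exp (φ * Complex.I) ≠ 1 → (p 1 1 = 0 → Complex.exp (φ * Complex.I) ≠ -1) →
    ∀ v : ℂ, HasDerivAt (curve₂ η) v φ → v ≠ 0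

theorem norm_lt_one_of_mem_S₂ (hp : IsWalk p) (hη : IsRootFunction p η) {s : ℂ} (hs : ‖s‖ = 1)
    (h1 : curvePoint η s ≠ 1) : ‖curvePoint η s‖ < 1 := by
  refine lt_of_le_of_ne (norm_curvePoint_le hη hs) fun h => h1 ?_
  exact (eq_one_of_ratioKernel_eq_zero hp (by simp [hs]) h (ratioKernel_curvePoint hp hη hs)).2

/-- Near a point of the curve, the equation of the kernel can be solved for `y`. -/
theorem exists_solution_snd (hp : IsWalk p) (hη : IsRootFunction p η) (hs₂ : SimpleCurve p η)
    {s : ℂ} (hs : ‖s‖ = 1) (h1 : curvePoint η s ≠ 1) :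
    ∃ χ : ℂ → ℂ, χ (s ^ 2) = curvePoint η s ∧
      HasDerivAt χ (-(ratioKernelDeriv₁ p (s ^ 2) (curvePoint η s)) /
        ratioKernelDeriv₂ p (s ^ 2) (curvePoint η s)) (s ^ 2) ∧
      ∀ᶠ v in 𝓝 (s ^ 2, curvePoint η s), ratioKernel p v.1 v.2 = 0 ↔ χ v.1 = v.2 := by
  have hy := norm_lt_one_of_mem_S₂ hp hη hs h1
  obtain ⟨ρ, hρ, -, hmem⟩ := exists_kernelDomain (u := s ^ 2) (by simp [hs]) hy
  obtain ⟨χ, h1, -, h2, h3⟩ := exists_hasDerivAt_implicit (isOpen_kernelDomain ρ)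
    (fun v hv => hasDerivAt_ratioKernel₁ hp hρ hv) (fun v hv => hasDerivAt_ratioKernel₂ hp hρ hv)
    (continuousOn_ratioKernelDeriv₁ hp hρ) (continuousOn_ratioKernelDeriv₂ hp hρ) hmem
    (ratioKernel_curvePoint hp hη hs) (ratioKernelDeriv₂_curvePoint_ne_zero hp hη hs₂ hs hy)
  exact ⟨χ, h1, h2, h3⟩

/-- As the curve has nonvanishing derivative, the roots on the curve are simple in `u`. -/
theorem ratioKernelDeriv₁_curvePoint_ne_zero (hp : IsWalk p) (hη : IsRootFunction p η)
    (hs₂ : SimpleCurve p η) (hd₂ : RegularCurve p η) {s : ℂ} (hs : ‖s‖ = 1)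
    (h1 : curvePoint η s ≠ 1) : ratioKernelDeriv₁ p (s ^ 2) (curvePoint η s) ≠ 0 := by
  intro hzero
  obtain ⟨χ, hχ, hχd, hev⟩ := exists_solution_snd hp hη hs₂ hs h1
  rw [hzero, neg_zero, zero_div] at hχd
  obtain ⟨φ, rfl⟩ := (Complex.norm_eq_one_iff s).mp hs
  -- the curve is `χ (exp (2iφ))`, so its derivative would vanish
  have hexp : HasDerivAt (fun t : ℝ => Complex.exp (t * Complex.I) ^ 2)
      (2 * Complex.exp (φ * Complex.I) ^ (2 - 1) *
        (Complex.exp (φ * Complex.I) * Complex.I)) φ := by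
    have h2 : HasDerivAt (fun t : ℝ => (t : ℂ) * Complex.I) Complex.I φ := by
      simpa using (Complex.ofRealCLM.hasDerivAt (x := φ)).mul_const Complex.I
    exact (h2.cexp).pow 2
  have hcd : HasDerivAt (fun t : ℝ => χ (Complex.exp (t * Complex.I) ^ 2)) 0 φ := by
    have := hχd.comp φ hexp
    rwa [zero_mul] at this
  have hgraph : Tendsto (fun t : ℝ => (Complex.exp (t * Complex.I) ^ 2, curve₂ η t)) (𝓝 φ)
      (𝓝 (Complex.exp (φ * Complex.I) ^ 2, curvePoint η (Complex.exp (φ * Complex.I)))) :=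
    hexp.continuousAt.tendsto.prodMk_nhds (continuous_curve₂ hη).continuousAt.tendsto
  refine hd₂ φ (fun h => h1 (by rw [h, curvePoint_one hη])) (fun h11 h => h1 ?_) 0
    (hcd.congr_of_eventuallyEq ?_) rfl
  · rw [h, curvePoint_neg hp hη h11 (by simp), curvePoint_one hη]
  · filter_upwards [hgraph.eventually hev] with t ht
    exact (ht.mp (ratioKernel_curvePoint hp hη (norm_exp_mul_I t))).symm

/-- Near a simple root, the equation of the kernel can be solved for `u`. -/
theorem exists_solution_fst (hp : IsWalk p) {u y : ℂ} (hu : ‖u‖ ≤ 1) (hy : ‖y‖ < 1)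
    (h : ratioKernel p u y = 0) (hd : ratioKernelDeriv₁ p u y ≠ 0) :
    ∃ φ : ℂ → ℂ, φ y = u ∧ AnalyticAt ℂ φ y ∧
      ∀ᶠ v in 𝓝 (u, y), ratioKernel p v.1 v.2 = 0 ↔ φ v.2 = v.1 := by
  obtain ⟨ρ, hρ, -, hmem⟩ := exists_kernelDomain hu hy
  have hsw : Continuous fun v : ℂ × ℂ => (v.2, v.1) := continuous_swap
  obtain ⟨φ, h1, h2, -, h3⟩ := exists_analyticAt_implicit
    (F := fun y u => ratioKernel p u y) (F₁ := fun y u => ratioKernelDeriv₂ p u y)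
    (F₂ := fun y u => ratioKernelDeriv₁ p u y) ((isOpen_kernelDomain ρ).preimage hsw)
    (fun v hv => hasDerivAt_ratioKernel₂ hp hρ hv) (fun v hv => hasDerivAt_ratioKernel₁ hp hρ hv)
    ((continuousOn_ratioKernelDeriv₂ hp hρ).comp hsw.continuousOn fun v hv => hv)
    ((continuousOn_ratioKernelDeriv₁ hp hρ).comp hsw.continuousOn fun v hv => hv)
    (a := y) (b := u) hmem h hd
  refine ⟨φ, h1, h2, ?_⟩
  have : Tendsto (fun v : ℂ × ℂ => (v.2, v.1)) (𝓝 (u, y)) (𝓝 (y, u)) := hsw.tendsto _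
  exact this.eventually h3

/-- Roots depend on `y` upper semicontinuously. -/
theorem exists_thickening_roots_subset (hp : IsWalk p) {K V : Set ℂ} (hK : IsCompact K)
    (hK1 : K ⊆ closedBall 0 1) (hV : IsOpen V) {y₀ : ℂ} (hy₀ : ‖y₀‖ < 1)
    (h : ∀ u ∈ K, ratioKernel p u y₀ = 0 → u ∈ V) :
    ∃ δ > 0, ∀ u y, u ∈ thickening δ K → ‖y - y₀‖ < δ → ratioKernel p u y = 0 → u ∈ V := by
  obtain ⟨ρ, hρ, hyρ, -⟩ := exists_kernelDomain (u := 0) (by simp) hy₀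
  have hR : 1 < ρ⁻¹ := (one_lt_inv₀ hρ.1).mpr hρ.2
  have hopen : IsOpen (kernelDomain ρ ∩ Function.uncurry (ratioKernel p) ⁻¹' {0}ᶜ) :=
    (continuousOn_ratioKernel_domain hp hρ).isOpen_inter_preimage (isOpen_kernelDomain ρ)
      isOpen_compl_singleton
  obtain ⟨A, B, hA, hB, hKA, hyB, hAB⟩ := generalized_tube_lemma hK (isCompact_singleton (x := y₀))
    ((hV.prod isOpen_univ).union hopen) (by
      rintro ⟨u, y⟩ ⟨hu, rfl : y = y₀⟩
      by_cases h0 : ratioKernel p u y = 0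
      · exact Or.inl ⟨h u hu h0, mem_univ _⟩
      · exact Or.inr ⟨⟨closedBall_subset_ball hR (hK1 hu), mem_ball_zero_iff.mpr hyρ⟩, h0⟩)
  obtain ⟨δ₁, hδ₁, hδA⟩ := hK.exists_thickening_subset_open hA hKA
  obtain ⟨δ₂, hδ₂, hδB⟩ := Metric.isOpen_iff.mp hB y₀ (hyB rfl)
  refine ⟨min δ₁ δ₂, lt_min hδ₁ hδ₂, fun u y hu hy h0 => ?_⟩
  have hmem : (u, y) ∈ V ×ˢ univ ∪ _ := hAB ⟨hδA (thickening_mono (min_le_left _ _) K hu),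
    hδB (mem_ball_iff_norm.mpr (hy.trans_le (min_le_right _ _)))⟩
  rcases hmem with hmem | hmem
  · exact hmem.1
  · exact absurd h0 hmem.2

/-- A unique simple root in the closed unit disc extends to an analytic function of `y`, and stays
unique in a slightly larger disc. -/
theorem exists_unique_root_nhds (hp : IsWalk p) {u₀ y₀ : ℂ} (hu₀ : ‖u₀‖ ≤ 1) (hy₀ : ‖y₀‖ < 1)
    (h : ratioKernel p u₀ y₀ = 0) (hd : ratioKernelDeriv₁ p u₀ y₀ ≠ 0)
    (huniq : ∀ u : ℂ, ‖u‖ ≤ 1 → ratioKernel p u y₀ = 0 → u = u₀) :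
    ∃ δ > 0, ∃ R > 1, ∃ φ : ℂ → ℂ, φ y₀ = u₀ ∧ ∀ y ∈ ball y₀ δ, ‖y‖ < 1 ∧ AnalyticAt ℂ φ y ∧
      ‖φ y‖ ≤ R ∧ ∀ u : ℂ, ‖u‖ ≤ R → (ratioKernel p u y = 0 ↔ u = φ y) := by
  obtain ⟨φ, hφ, hφa, hev⟩ := exists_solution_fst hp hu₀ hy₀ h hd
  rw [nhds_prod_eq] at hev
  obtain ⟨P, hP, Q, hQ, hPQ⟩ := eventually_prod_iff.mp hev
  obtain ⟨V, hVP, hV, huV⟩ := _root_.mem_nhds_iff.mp hP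
  obtain ⟨δ₁, hδ₁, hroots⟩ := exists_thickening_roots_subset hp (isCompact_closedBall (0 : ℂ) 1)
    subset_rfl hV hy₀ fun u hu h0 => by
      rw [huniq u (mem_closedBall_zero_iff.mp hu) h0]; exact huV
  have hφV : ∀ᶠ y in 𝓝 y₀, φ y ∈ V ∩ ball 0 (1 + δ₁ / 2) := by
    refine hφa.continuousAt.eventually_mem ?_
    rw [hφ]
    refine (hV.inter isOpen_ball).mem_nhds ⟨huV, ?_⟩
    rw [mem_ball_zero_iff]; linarith
  have hball : ∀ᶠ y in 𝓝 y₀, ‖y‖ < 1 := continuous_norm.continuousAt.eventually_lt_const hy₀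
  have hclose : ∀ᶠ y in 𝓝 y₀, ‖y - y₀‖ < δ₁ := by
    filter_upwards [ball_mem_nhds y₀ hδ₁] with y hy using mem_ball_iff_norm.mp hy
  obtain ⟨δ, hδ, hall⟩ := Metric.eventually_nhds_iff_ball.mp
    (hφV.and (hball.and (hclose.and (hφa.eventually_analyticAt.and hQ))))
  refine ⟨δ, hδ, 1 + δ₁ / 2, by linarith, φ, hφ, fun y hy => ?_⟩
  obtain ⟨⟨hyV, hyR⟩, hy1, hyδ, hya, hyQ⟩ := hall y hy
  refine ⟨hy1, hya, (mem_ball_zero_iff.mp hyR).le, fun u hu => ⟨fun h0 => ?_, fun h0 => ?_⟩⟩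
  · have huV : u ∈ V := hroots u y (by
      rw [thickening_closedBall hδ₁ zero_le_one, mem_ball_zero_iff]; linarith) hyδ h0
    exact ((hPQ (hVP huV) hyQ).mp h0).symm
  · exact (hPQ (hVP (h0 ▸ hyV)) hyQ).mpr h0.symm

theorem not_forall_ratioKernel_eq_zero (hp : IsWalk p) (hη : IsRootFunction p η)
    (hs₂ : SimpleCurve p η) {y : ℂ} (hy : ‖y‖ ≤ 1) :
    ¬ ∀ u : ℂ, ‖u‖ = 1 → ratioKernel p u y = 0 := by
  intro h
  have := ratio_unique hp hη hs₂ hy (by simp) (by simp) (h 1 (by simp)) (h (-1) (by simp))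
  norm_num at this

theorem tendsto_solution_snd {u₀ y₀ : ℂ} {χ : ℂ → ℂ} (hχ : χ u₀ = y₀)
    (hc : ContinuousAt χ u₀)
    (hev : ∀ᶠ v in 𝓝 (u₀, y₀), ratioKernel p v.1 v.2 = 0 ↔ χ v.1 = v.2) :
    Tendsto (fun t : ℝ => ((1 - t) * u₀, χ ((1 - t) * u₀))) (𝓝 0) (𝓝 (u₀, y₀)) ∧
      ∀ᶠ t : ℝ in 𝓝 0, ratioKernel p ((1 - t) * u₀) (χ ((1 - t) * u₀)) = 0 := by
  have h1 : Tendsto (fun t : ℝ => (1 - (t : ℂ)) * u₀) (𝓝 0) (𝓝 u₀) := by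
    have : Continuous fun t : ℝ => (1 - (t : ℂ)) * u₀ := by fun_prop
    simpa using this.tendsto 0
  have h2 : Tendsto (fun t : ℝ => ((1 - (t : ℂ)) * u₀, χ ((1 - t) * u₀))) (𝓝 0) (𝓝 (u₀, y₀)) := by
    refine h1.prodMk_nhds ?_
    have := hc.tendsto.comp h1
    rwa [hχ] at this
  refine ⟨h2, ?_⟩
  filter_upwards [h2.eventually hev] with t ht using ht.mpr rfl

/-! ### Sign of the orientation -/

theorem differentiableOn_ratioKernel_disc (hp : IsWalk p) {y : ℂ} (hy : ‖y‖ < 1) :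
    ∃ R > 1, DifferentiableOn ℂ (fun u => ratioKernel p u y) (ball 0 R) := by
  obtain ⟨ρ, hρ, hyρ, -⟩ := exists_kernelDomain (u := 0) (by simp) hy
  exact ⟨ρ⁻¹, (one_lt_inv₀ hρ.1).mpr hρ.2, differentiableOn_ratioKernel hp hρ hyρ⟩

theorem ratioKernel_zero_right (p : ℤ → ℤ → ℝ) (h11 : p 1 1 = 0) (u : ℂ) :
    ratioKernel p u 0 = -(coef p (1, 0) * u + coef p (0, 1)) := by
  have hd : defect p = 1 := by simp [defect, h11]
  rw [ratioKernel, hd, tsum_eq_sum (s := {(1, 0), (0, 1)})]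
  · rw [Finset.sum_pair (by simp)]; simp
  · rintro ⟨i, j⟩ hn
    by_cases h : i + j - 1 = 0
    · have h0 : i = 0 ∧ j = 0 := by
        simp only [Finset.mem_insert, Finset.mem_singleton, Prod.mk.injEq] at hn
        omega
      obtain ⟨rfl, rfl⟩ := h0
      simp [coef, h11]
    · simp [h]

theorem ratioKernel_zero_right_of_ne (h11 : p 1 1 ≠ 0) (u : ℂ) :
    ratioKernel p u 0 ≠ 0 := by
  have hd : defect p = 0 := by simp [defect, h11]
  rw [ratioKernel, hd, tsum_eq_single (0 : ℕ × ℕ)]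
  · simpa [coef] using h11
  · intro n hn
    have : n.1 + n.2 ≠ 0 := fun h => hn (Prod.ext (by simp; omega) (by simp; omega))
    rw [Nat.sub_zero, zero_pow this, mul_zero]

/-- If `p 1 1 = 0`, the second alternative in `h` says that `ratioKernel p · 0`, if not identically
zero, has no root in the open unit disc. If it has one on the unit
circle, that root leaves the disc for some `y` close to `0`. -/
theorem exists_forall_ratioKernel_ne_zero (hp : IsWalk p) (hη : IsRootFunction p η)
    (hs₂ : SimpleCurve p η) (hd₂ : RegularCurve p η)
    (h : p 1 1 ≠ 0 ∨ coef p (1, 0) ≤ coef p (0, 1)) :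
    ∃ y : ℂ, ‖y‖ < 1 ∧ ∀ u : ℂ, ‖u‖ ≤ 1 → ratioKernel p u y ≠ 0 := by
  by_cases h11 : p 1 1 = 0
  swap
  · exact ⟨0, by simp, fun u _ => ratioKernel_zero_right_of_ne h11 u⟩
  have h := h.resolve_left (not_not_intro h11)
  have hn1 := hp.coef_nonneg (1, 0)
  rcases h.lt_or_eq with hlt | heq
  · refine ⟨0, by simp, fun u hu h0 => ?_⟩
    rw [ratioKernel_zero_right p h11, neg_eq_zero, add_eq_zero_iff_eq_neg] at h0
    have h1 := congrArg norm h0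
    rw [norm_neg, norm_mul, norm_coef hp, norm_coef hp] at h1
    nlinarith [norm_nonneg u]
  -- here `0` is on the curve, with ratio `-1`; move the root across the unit circle
  have hr : ∀ u, ratioKernel p u 0 = -(coef p (1, 0) * (u + 1)) := fun u => by
    rw [ratioKernel_zero_right p h11, ← heq]; ring
  have hne : coef p (1, 0) ≠ 0 := fun h0 => not_forall_ratioKernel_eq_zero hp hη hs₂ (y := 0)
    (by simp) fun u _ => by rw [hr, h0]; simp
  have huniq : ∀ u : ℂ, ratioKernel p u 0 = 0 → u = -1 := fun u h0 => by
    rw [hr, neg_eq_zero, mul_eq_zero] at h0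
    exact eq_neg_of_add_eq_zero_left (h0.resolve_left (by exact_mod_cast hne))
  obtain ⟨s, hs, hs1, hs0⟩ := exists_curvePoint_of_ratioKernel_eq_zero hp hη hs₂ (u := -1) (y := 0)
    (by simp) (by simp) (by rw [hr]; simp)
  have hs01 : curvePoint η s ≠ 1 := by rw [← hs0]; simp
  obtain ⟨χ, hχ, hχd, hev⟩ := exists_solution_snd hp hη hs₂ hs hs01
  have hd := ratioKernelDeriv₁_curvePoint_ne_zero hp hη hs₂ hd₂ hs hs01
  rw [hs1, ← hs0] at hχ hχd hev hd
  obtain ⟨δ, hδ, R, hR, φ, -, hφ⟩ := exists_unique_root_nhds hp (by simp) (by simp)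
    (by rw [hr]; simp) hd fun u _ h0 => huniq u h0
  obtain ⟨ht1, ht2⟩ := tendsto_solution_snd hχ hχd.continuousAt hev
  have ht3 : ∀ᶠ t : ℝ in 𝓝 0, χ ((1 - t) * -1) ∈ ball (0 : ℂ) δ :=
    ((continuous_snd.tendsto _).comp ht1).eventually (ball_mem_nhds _ hδ)
  have ht4 : ∀ᶠ t : ℝ in 𝓝 0, ‖(1 - (t : ℂ)) * -1‖ < R :=
    ((continuous_fst.tendsto _).comp ht1).norm.eventually_lt_const (by simpa using hR)
  obtain ⟨t, ⟨⟨ht2, ht3⟩, ht4⟩, ht0⟩ :=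
    ((((ht2.and ht3).and ht4).filter_mono nhdsWithin_le_nhds).and
      (self_mem_nhdsWithin (s := Iio (0 : ℝ)))).exists
  obtain ⟨hy1, -, -, hiff⟩ := hφ _ ht3
  refine ⟨_, hy1, fun u hu h0 => ?_⟩
  have h1 := (hiff u (hu.trans hR.le)).mp h0
  rw [← (hiff _ ht4.le).mp ht2] at h1
  have ht0 : t < 0 := ht0
  rw [h1, norm_mul, norm_neg, norm_one, mul_one] at hu
  have h2 : ((1 - t : ℝ) : ℂ) = 1 - (t : ℂ) := by push_cast; rfl
  rw [← h2, Complex.norm_real, Real.norm_of_nonneg (by linarith)] at hu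
  linarith

/-- At a point `y` without roots in the disc the winding number of the curve is `-1`. -/
theorem orientation_eq_neg_one (hp : IsWalk p) (hη : IsRootFunction p η)
    (hs₂ : SimpleCurve p η) (hd₂ : RegularCurve p η)
    (h : p 1 1 ≠ 0 ∨ coef p (1, 0) ≤ coef p (0, 1)) {ε : ℤ}
    (hε : HasOrientation (curve₂ η) (period p) ε) : ε = -1 := by
  obtain ⟨y, hy, hne⟩ := exists_forall_ratioKernel_ne_zero hp hη hs₂ hd₂ h
  have hyS : y ∉ S₂ η := fun hyS => by
    obtain ⟨-, u, hu, h0⟩ := (mem_S₂_iff hp hη hs₂).mp hyS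
    exact hne u hu.le h0
  have key : ∀ w, HasLogWinding (fun t => curve₂ η t - y) (period p) w → w = -1 := fun w hw => by
    have h1 := circleWinding_ratioKernel hp hη hs₂ hy hw
    obtain ⟨R, hR, hdiff⟩ := differentiableOn_ratioKernel_disc hp hy
    have := h1.eq_zero_of_ne_zero (hdiff.continuousOn.mono (closedBall_subset_ball hR))
      fun u hu => hne u (mem_closedBall_zero_iff.mp hu)
    omega
  rcases mem_inside_or_mem_outside hyS with hi | ho
  · exact key ε (hasLogWinding_of_mem_inside_S₂ hp hη hε hi)
  · have := key 0 (hasLogWinding_of_mem_outside_S₂ hp hη ho)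
    omega

/-! ### The unique root and the continuation -/

/-- In the interior of the curve the number of roots in the closed disc is `1 + (-1) = 0`. -/
theorem ratioKernel_ne_zero_of_mem_inside (hp : IsWalk p) (hη : IsRootFunction p η)
    (hs₂ : SimpleCurve p η) (hε : HasOrientation (curve₂ η) (period p) (-1)) {u y : ℂ}
    (hy : y ∈ inside (S₂ η)) (hu : ‖u‖ ≤ 1) : ratioKernel p u y ≠ 0 := by
  have hy1 : ‖y‖ < 1 := norm_lt_one_of_mem_inside (by
    rintro _ ⟨s, hs, rfl⟩
    exact mem_closedBall_zero_iff.mpr (norm_curvePoint_le hη (mem_sphere_zero_iff_norm.mp hs))) hy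
  have h1 := circleWinding_ratioKernel hp hη hs₂ hy1 (hasLogWinding_of_mem_inside_S₂ hp hη hε hy)
  obtain ⟨R, hR, hdiff⟩ := differentiableOn_ratioKernel_disc hp hy1
  exact CircleWinding.ne_zero_of_winding_zero hR hdiff (by simpa using h1) hu

/-- A second root at a point of the curve would persist at nearby points off the curve where the
root on the curve has moved into the disc, in contradiction to the number of roots there. -/
theorem ratioKernel_curvePoint_ne_zero_of_norm_lt (hp : IsWalk p) (hη : IsRootFunction p η)
    (hs₂ : SimpleCurve p η) (hd₂ : RegularCurve p η)
    (hε : HasOrientation (curve₂ η) (period p) (-1)) {s : ℂ} (hs : ‖s‖ = 1)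
    (h1 : curvePoint η s ≠ 1) {u : ℂ} (hu : ‖u‖ < 1) : ratioKernel p u (curvePoint η s) ≠ 0 := by
  intro h0
  have hy₀ := norm_lt_one_of_mem_S₂ hp hη hs h1
  have hu₀ : ‖s ^ 2‖ = 1 := by simp [hs]
  have hF₀ := ratioKernel_curvePoint hp hη hs
  obtain ⟨χ, hχ, hχd, hev⟩ := exists_solution_snd hp hη hs₂ hs h1
  have hd := ratioKernelDeriv₁_curvePoint_ne_zero hp hη hs₂ hd₂ hs h1
  obtain ⟨φ, hφ, hφa, hφev⟩ := exists_solution_fst hp hu₀.le hy₀ hF₀ hd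
  set y₀ := curvePoint η s
  set u₀ := s ^ 2
  obtain ⟨ρ, hρ, hyρ, -⟩ := exists_kernelDomain (u := 0) (by simp) hy₀
  have hR : 1 < ρ⁻¹ := (one_lt_inv₀ hρ.1).mpr hρ.2
  obtain ⟨r, hr, hr1⟩ := exists_between (sub_pos.mpr hu)
  have hsub : closedBall u r ⊆ ball 0 1 := fun z hz => by
    rw [mem_closedBall, dist_eq_norm] at hz
    rw [mem_ball_zero_iff]
    have := norm_add_le (z - u) u
    rw [sub_add_cancel] at this
    linarith
  have hsubR : closedBall u r ⊆ ball 0 ρ⁻¹ := hsub.trans (ball_subset_ball hR.le)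
  -- the root `u` persists
  have hpersist : ∀ᶠ y in 𝓝 y₀, ∃ z ∈ closedBall u r, ratioKernel p z y = 0 := by
    refine eventually_exists_zero (F := fun y u => ratioKernel p u y)
      (f := fun u => ratioKernel p u y₀) hr
      ((differentiableOn_ratioKernel hp hρ hyρ).mono (ball_subset_closedBall.trans hsubR)) ?_ ?_
      h0 ?_ hr
    · filter_upwards [continuous_norm.continuousAt.eventually_lt_const hyρ] with y hy
      exact (differentiableOn_ratioKernel hp hρ hy).mono (ball_subset_closedBall.trans hsubR)
    · refine TendstoUniformlyOn.mono (fun W hW => ?_) ball_subset_closedBall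
      have hc : ContinuousOn (Function.uncurry fun y u => ratioKernel p u y)
          (ball 0 ρ ×ˢ closedBall u r) :=
        (continuousOn_ratioKernel_domain hp hρ).comp continuous_swap.continuousOn
          fun v hv => ⟨hsubR hv.2, hv.1⟩
      have hyb : y₀ ∈ ball (0 : ℂ) ρ := mem_ball_zero_iff.mpr hyρ
      obtain ⟨v, hv, hvu⟩ := (isCompact_closedBall u r).mem_uniformity_of_prod hc hyb
        (symm_le_uniformity hW)
      rw [isOpen_ball.nhdsWithin_eq hyb] at hv
      filter_upwards [hv] with y hy z hz using hvu y hy z hz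
    · intro hid
      refine not_forall_ratioKernel_eq_zero hp hη hs₂ hy₀.le fun z hz => ?_
      exact (((differentiableOn_ratioKernel hp hρ hyρ).analyticOnNhd
        isOpen_ball).eqOn_of_preconnected_of_eventuallyEq analyticOnNhd_const
        (convex_ball (0 : ℂ) ρ⁻¹).isPreconnected
        (mem_ball_zero_iff.mpr (hu.trans hR)) hid) (mem_ball_zero_iff.mpr (hz.trans_lt hR))
  -- unimodular roots stay close to `u₀`
  rw [nhds_prod_eq] at hφev
  obtain ⟨P, hP, Q, hQ, hPQ⟩ := eventually_prod_iff.mp hφev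
  obtain ⟨V, hVP, hV, huV⟩ := _root_.mem_nhds_iff.mp hP
  obtain ⟨δ, hδ, hroots⟩ := exists_thickening_roots_subset hp (isCompact_sphere (0 : ℂ) 1)
    sphere_subset_closedBall hV hy₀ fun v hv hv0 => by
      rw [ratio_unique hp hη hs₂ hy₀.le (mem_sphere_zero_iff_norm.mp hv) hu₀ hv0 hF₀]; exact huV
  obtain ⟨ht1, ht2⟩ := tendsto_solution_snd hχ hχd.continuousAt hev
  have hfst := (continuous_fst.tendsto _).comp ht1
  have hsnd := (continuous_snd.tendsto _).comp ht1
  have hball : ∀ᶠ y in 𝓝 y₀, y ∈ ball y₀ δ := ball_mem_nhds y₀ hδ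
  have ht3 := hsnd.eventually (hpersist.and (hQ.and (hball.and
    (continuous_norm.continuousAt.eventually_lt_const hy₀))))
  have hnotin : ∀ᶠ v in 𝓝 u₀, v ∈ (closedBall u r)ᶜ :=
    isClosed_closedBall.isOpen_compl.mem_nhds fun h => by
    have := mem_ball_zero_iff.mp (hsub h)
    linarith
  have hVev : ∀ᶠ v in 𝓝 u₀, v ∈ V := hV.mem_nhds huV
  have ht4 := hfst.eventually (hnotin.and hVev)
  have hIoo : ∀ᶠ t in 𝓝[>] (0 : ℝ), t ∈ Ioo 0 1 := Ioo_mem_nhdsGT one_pos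
  obtain ⟨t, ⟨⟨ht2, ht3⟩, ht4⟩, ht0, htl⟩ :=
    ((((ht2.and ht3).and ht4).filter_mono nhdsWithin_le_nhds).and hIoo).exists
  simp only [Function.comp] at ht3 ht4
  obtain ⟨⟨z, hz, hz0⟩, htQ, htδ, hty⟩ := ht3
  set ut : ℂ := (1 - t) * u₀
  set yt := χ ut
  have hutn : ‖ut‖ < 1 := by
    have h2 : ((1 - t : ℝ) : ℂ) = 1 - (t : ℂ) := by push_cast; rfl
    rw [norm_mul, hu₀, mul_one, ← h2, Complex.norm_real, Real.norm_of_nonneg (by linarith)]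
    linarith
  have hφt : φ yt = ut := (hPQ (hVP ht4.2) htQ).mp ht2
  have hyS : yt ∉ S₂ η := fun hyS => by
    obtain ⟨-, v, hv, hv0⟩ := (mem_S₂_iff hp hη hs₂).mp hyS
    have hvV := hroots v yt (self_subset_thickening hδ _ (mem_sphere_zero_iff_norm.mpr hv))
      (mem_ball_iff_norm.mp htδ) hv0
    have hvt : φ yt = v := (hPQ (hVP hvV) htQ).mp hv0
    rw [← hvt, hφt] at hv
    linarith
  have hzne : z ≠ ut := fun h => ht4.1 (h ▸ hz)
  obtain ⟨R', hR', hdiff⟩ := differentiableOn_ratioKernel_disc hp hty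
  have key : ∀ w, HasLogWinding (fun t => curve₂ η t - yt) (period p) w → 2 ≤ w + 1 := fun w hw =>
    (circleWinding_ratioKernel hp hη hs₂ hty hw).two_le hR' hdiff
      (mem_ball_zero_iff.mp (hsub hz)) hutn hzne hz0 ht2
  rcases mem_inside_or_mem_outside hyS with hi | ho
  · have := key _ (hasLogWinding_of_mem_inside_S₂ hp hη hε hi)
    omega
  · have := key _ (hasLogWinding_of_mem_outside_S₂ hp hη ho)
    omega

/-- On the curve and in its exterior, the kernel has exactly one root `|x| ≤ |y|`. -/
theorem exists_unique_root (hp : IsWalk p) (hη : IsRootFunction p η)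
    (hs₂ : SimpleCurve p η) (hd₂ : RegularCurve p η)
    (hε : HasOrientation (curve₂ η) (period p) (-1)) {y : ℂ}
    (hy : y ∈ (outside (S₂ η) ∩ ball 0 1) ∪ (S₂ η \ {1})) :
    ‖y‖ < 1 ∧ ∃ u : ℂ, ‖u‖ ≤ 1 ∧ (y ∉ S₂ η → ‖u‖ < 1) ∧ ratioKernel p u y = 0 ∧
      ratioKernelDeriv₁ p u y ≠ 0 ∧ ∀ v : ℂ, ‖v‖ ≤ 1 → ratioKernel p v y = 0 → v = u := by
  rcases hy with ⟨hyo, hyb⟩ | ⟨⟨s, hs, rfl⟩, hy1⟩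
  · have hy1 := mem_ball_zero_iff.mp hyb
    refine ⟨hy1, ?_⟩
    have hw := circleWinding_ratioKernel hp hη hs₂ hy1 (hasLogWinding_of_mem_outside_S₂ hp hη hyo)
    obtain ⟨R, hR, hdiff⟩ := differentiableOn_ratioKernel_disc hp hy1
    obtain ⟨u, hu, hu0, hud, huniq⟩ := CircleWinding.existsUnique_zero hR hdiff (by simpa using hw)
    obtain ⟨ρ, hρ, -, hmem⟩ := exists_kernelDomain hu.le hy1
    rw [(hasDerivAt_ratioKernel₁ hp hρ hmem).deriv] at hud
    exact ⟨u, hu.le, fun _ => hu, hu0, hud, huniq⟩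
  · have hs := mem_sphere_zero_iff_norm.mp hs
    change curvePoint η s ∉ ({1} : Set ℂ) at hy1
    change ‖curvePoint η s‖ < 1 ∧ _
    have hn := norm_lt_one_of_mem_S₂ hp hη hs hy1
    have hu : ‖s ^ 2‖ = 1 := by simp [hs]
    refine ⟨hn, s ^ 2, hu.le, fun h => absurd ⟨s, by simpa using hs, rfl⟩ h,
      ratioKernel_curvePoint hp hη hs,
      ratioKernelDeriv₁_curvePoint_ne_zero hp hη hs₂ hd₂ hs hy1, fun v hv hv0 => ?_⟩
    rcases hv.lt_or_eq with hv | hv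
    · exact absurd hv0 (ratioKernel_curvePoint_ne_zero_of_norm_lt hp hη hs₂ hd₂ hε hs hy1 hv)
    · exact ratio_unique hp hη hs₂ hn.le hv hu hv0 (ratioKernel_curvePoint hp hη hs)

/-- The function `X` maps `η(s) s⁻¹` to `η(s) s`. -/
theorem eq_of_mem_zeroSet (hp : IsWalk p) (hη : IsRootFunction p η) (hs₂ : SimpleCurve p η)
    {s x : ℂ} (hs : ‖s‖ = 1) (h : (x, curvePoint η s) ∈ zeroSet p) :
    x = s ^ 2 * curvePoint η s := by
  obtain ⟨h0, hn, h1⟩ := h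
  simp only at h0 hn h1
  by_cases hy : curvePoint η s = 0
  · rw [hy, norm_zero, norm_eq_zero] at hn
    rw [hn, hy, mul_zero]
  · have hx : x = x / curvePoint η s * curvePoint η s := (div_mul_cancel₀ _ hy).symm
    rw [hx, kernel_mul_self hp, mul_eq_zero] at h0
    have h2 := h0.resolve_left (pow_ne_zero _ hy)
    have h3 : ‖x / curvePoint η s‖ = 1 := by
      rw [norm_div, hn, div_self (norm_ne_zero_iff.mpr hy)]
    rw [← ratio_unique hp hη hs₂ h1 h3 (by simp [hs]) h2 (ratioKernel_curvePoint hp hη hs)]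
    exact hx

/-- As `y` tends to `1`, all roots in the closed disc tend to `1`. -/
theorem eventually_root_mem (hp : IsWalk p) {V : Set ℂ} (hV : V ∈ 𝓝 1) :
    ∀ᶠ y in 𝓝[closedBall 0 1] (1 : ℂ), ∀ u : ℂ, ‖u‖ ≤ 1 → ratioKernel p u y = 0 → u ∈ V := by
  have hK : IsCompact (closedBall (0 : ℂ) 1 \ interior V) :=
    (isCompact_closedBall _ _).diff isOpen_interior
  have h1 : ∀ᶠ y in 𝓝 (1 : ℂ), ∀ u ∈ closedBall (0 : ℂ) 1 \ interior V,
      u ∈ closedBall (0 : ℂ) 1 → y ∈ closedBall (0 : ℂ) 1 → ratioKernel p u y ≠ 0 := by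
    refine hK.eventually_forall_of_forall_eventually fun u hu => ?_
    have hne : ratioKernel p u 1 ≠ 0 := fun h => hu.2 (by
      rw [ratioKernel_one_eq_zero hp (mem_closedBall_zero_iff.mp hu.1) h]
      exact mem_interior_iff_mem_nhds.mpr hV)
    have hc : ContinuousWithinAt (Function.uncurry (ratioKernel p))
        (closedBall 0 1 ×ˢ closedBall 0 1) (u, 1) :=
      continuousOn_ratioKernel hp (u, 1) ⟨hu.1, by simp⟩
    have h2 := eventually_nhdsWithin_iff.mp (hc.eventually_ne hne)
    have hsw : Tendsto (fun v : ℂ × ℂ => (v.2, v.1)) (𝓝 (1, u)) (𝓝 (u, 1)) :=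
      continuous_swap.tendsto _
    filter_upwards [hsw.eventually h2] with v hv hv2 hv1 using hv ⟨hv2, hv1⟩
  rw [eventually_nhdsWithin_iff]
  filter_upwards [h1] with y hy hyb u hu h0
  by_contra hV'
  exact hy u ⟨mem_closedBall_zero_iff.mpr hu, fun h => hV' (interior_subset h)⟩
    (mem_closedBall_zero_iff.mpr hu) hyb h0

/-- The continuation of `X` is `y ↦ y u(y)` with the unique root `u(y)` in the closed disc. -/
theorem continuesOutside_S₂ (hp : IsWalk p) (hη : IsRootFunction p η)
    (hs₂ : SimpleCurve p η) (hd₂ : RegularCurve p η)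
    (hε : HasOrientation (curve₂ η) (period p) (-1)) {X : ℂ → ℂ}
    (hX : ∀ y ∈ S₂ η, (X y, y) ∈ zeroSet p) :
    ContinuesOutside (S₂ η) X fun x y => kernel p x y = 0 := by
  set T : Set ℂ := (outside (S₂ η) ∩ ball 0 1) ∪ (S₂ η \ {1}) with hT
  have hroot : ∀ y ∈ T, ∃ u : ℂ, ‖u‖ ≤ 1 ∧ (y ∉ S₂ η → ‖u‖ < 1) ∧ ratioKernel p u y = 0 ∧
      ∃ δ > 0, ∃ R > 1, ∃ φ : ℂ → ℂ, φ y = u ∧ ∀ z ∈ ball y δ, ‖z‖ < 1 ∧ AnalyticAt ℂ φ z ∧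
        ‖φ z‖ ≤ R ∧ ∀ u : ℂ, ‖u‖ ≤ R → (ratioKernel p u z = 0 ↔ u = φ z) := fun y hy => by
    obtain ⟨hy1, u, hu, hu1, h0, hd, huniq⟩ := exists_unique_root hp hη hs₂ hd₂ hε hy
    exact ⟨u, hu, hu1, h0, exists_unique_root_nhds hp hu hy1 h0 hd huniq⟩
  choose! u hu hu1 hu0 δ hδ R hR φ hφ hφz using hroot
  -- the local solutions agree where their domains overlap
  have hagree : ∀ a ∈ T, ∀ b ∈ T, ∀ z ∈ ball a (δ a) ∩ ball b (δ b), φ a z = φ b z := by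
    rintro a ha b hb z ⟨hza, hzb⟩
    obtain ⟨-, -, hna, hia⟩ := hφz a ha z hza
    obtain ⟨-, -, hnb, hib⟩ := hφz b hb z hzb
    rcases le_total (R a) (R b) with h | h
    · exact (hib _ (hna.trans h)).mp ((hia _ hna).mpr rfl)
    · exact ((hia _ (hnb.trans h)).mp ((hib _ hnb).mpr rfl)).symm
  set W : Set ℂ := ⋃ y ∈ T, ball y (δ y) with hW
  have hWo : IsOpen W := isOpen_biUnion fun y _ => isOpen_ball
  have hchoice : ∀ z ∈ W, ∃ y ∈ T, z ∈ ball y (δ y) := fun z hz => by simpa [hW] using hz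
  choose! c hcT hcb using hchoice
  have h1W : (1 : ℂ) ∉ W := fun h => by
    have := (hφz _ (hcT 1 h) 1 (hcb 1 h)).1
    simp at this
  have hTW : T ⊆ W := fun y hy => mem_biUnion hy (mem_ball_self (hδ y hy))
  let G : ℂ → ℂ := fun z => if z = 1 then 1 else z * φ (c z) z
  have hGloc : ∀ y ∈ T, ∀ z ∈ ball y (δ y), G z = z * φ y z := fun y hy z hz => by
    have hzW : z ∈ W := mem_biUnion hy hz
    have hz1 : z ≠ 1 := fun h => h1W (h ▸ hzW)
    simp only [G, if_neg hz1]
    rw [hagree _ (hcT z hzW) _ hy z ⟨hcb z hzW, hz⟩]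
  have hGT : ∀ y ∈ T, G y = y * u y := fun y hy => by
    rw [hGloc y hy y (mem_ball_self (hδ y hy)), hφ y hy]
  have hGan : AnalyticOnNhd ℂ G W := fun z hz => by
    have hev : (fun w => w * φ (c z) w) =ᶠ[𝓝 z] G := by
      filter_upwards [isOpen_ball.mem_nhds (hcb z hz)] with w hw
      exact (hGloc _ (hcT z hz) w hw).symm
    exact (analyticAt_id.mul (hφz _ (hcT z hz) z (hcb z hz)).2.1).congr hev
  have hXeq : ∀ s : ℂ, ‖s‖ = 1 → X (curvePoint η s) = s ^ 2 * curvePoint η s := fun s hs =>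
    eq_of_mem_zeroSet hp hη hs₂ hs (hX _ ⟨s, by simpa using hs, rfl⟩)
  refine ⟨W, G, hWo, hTW, hGan, ?_, ?_, ?_⟩
  · intro y hy
    by_cases hy1 : y = 1
    · subst hy1
      have hG1 : G 1 = 1 := by simp [G]
      have hTn : ∀ z ∈ outside (S₂ η) ∩ ball 0 1 ∪ S₂ η, z = 1 ∨ z ∈ T := by
        rintro z (hz | hz)
        · exact Or.inr (Or.inl hz)
        · by_cases h : z = 1
          · exact Or.inl h
          · exact Or.inr (Or.inr ⟨hz, h⟩)
      have hsub : outside (S₂ η) ∩ ball 0 1 ∪ S₂ η ⊆ closedBall 0 1 := by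
        intro z hz
        rcases hTn z hz with rfl | hz
        · simp
        · have := (hφz z hz z (mem_ball_self (hδ z hz))).1
          exact mem_closedBall_zero_iff.mpr this.le
      -- `G z / z` is a root in the closed disc, also for `z = 1`
      have hlim : Tendsto (fun z => if z = 1 then 1 else u z)
          (𝓝[outside (S₂ η) ∩ ball 0 1 ∪ S₂ η] (1 : ℂ)) (𝓝 1) := by
        refine tendsto_def.mpr fun V hV => ?_
        filter_upwards [nhdsWithin_mono _ hsub (eventually_root_mem hp hV), self_mem_nhdsWithin]
          with z hz hzT
        by_cases h : z = 1
        · simpa [h] using mem_of_mem_nhds hV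
        · have hzT' := (hTn z hzT).resolve_left h
          simpa [h] using hz _ (hu z hzT') (hu0 z hzT')
      have hmul := (tendsto_nhdsWithin_of_tendsto_nhds tendsto_id).mul hlim
      simp only [id, mul_one] at hmul
      rw [ContinuousWithinAt, hG1]
      refine hmul.congr' ?_
      filter_upwards [self_mem_nhdsWithin] with z hz
      by_cases h : z = 1
      · simp [h, G]
      · rw [hGT z ((hTn z hz).resolve_left h)]; simp [h]
    · have hyT : y ∈ T := by
        rcases hy with hy | hy
        · exact Or.inl hy
        · exact Or.inr ⟨hy, hy1⟩
      exact (hGan y (hTW hyT)).continuousAt.continuousWithinAt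
  · rintro _ ⟨s, hs, rfl⟩
    have hs := mem_sphere_zero_iff_norm.mp hs
    change G (curvePoint η s) = X (curvePoint η s)
    rw [hXeq s hs]
    have hs2 : ‖s ^ 2‖ = 1 := by simp [hs]
    by_cases h1 : curvePoint η s = 1
    · have h2 := ratioKernel_curvePoint hp hη hs
      rw [h1] at h2 ⊢
      rw [ratioKernel_one_eq_zero hp hs2.le h2]
      simp [G]
    · have hyT : curvePoint η s ∈ T := Or.inr ⟨⟨s, by simpa using hs, rfl⟩, h1⟩
      have hmem := mem_ball_self (x := curvePoint η s) (hδ _ hyT)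
      obtain ⟨-, -, -, hi⟩ := hφz _ hyT _ hmem
      rw [hGloc _ hyT _ hmem,
        ← (hi (s ^ 2) (hs2.le.trans (hR _ hyT).le)).mp (ratioKernel_curvePoint hp hη hs), mul_comm]
  · intro y hy
    have hyT : y ∈ T := Or.inl hy
    have hyb := mem_ball_zero_iff.mp hy.2
    refine ⟨?_, ?_⟩
    · rw [hGT y hyT, norm_mul]
      have := hu1 y hyT hy.1.1
      nlinarith [norm_nonneg y, norm_nonneg (u y)]
    · change kernel p (G y) y = 0
      rw [hGT y hyT, mul_comm, kernel_mul_self hp, hu0 y hyT, mul_zero]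

/-! ### Exchanging the two coordinates -/

/-- The weights of the walk reflected in the diagonal. -/
def swapWeights (p : ℤ → ℤ → ℝ) : ℤ → ℤ → ℝ := fun k l => p l k

/-- The root function of the reflected walk. -/
noncomputable def swapRoot (η : ℂ → ℂ) : ℂ → ℂ := fun s => η s⁻¹

theorem kernel_swapWeights (x y : ℂ) : kernel (swapWeights p) x y = kernel p y x := by
  unfold kernel swapWeights
  rw [← (Equiv.prodComm ℤ ℤ).tsum_eq, mul_comm x y]
  congr 1
  refine tsum_congr fun z => ?_
  simp only [Equiv.prodComm_apply, Prod.fst_swap, Prod.snd_swap]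
  ring

theorem reducedKernel_swapWeights (r s : ℂ) :
    reducedKernel (swapWeights p) r s = reducedKernel p r s⁻¹ := by
  unfold reducedKernel swapWeights
  rw [← (Equiv.prodComm ℤ ℤ).tsum_eq]
  congr 1
  refine tsum_congr fun z => ?_
  simp only [Equiv.prodComm_apply, Prod.fst_swap, Prod.snd_swap]
  rw [inv_zpow', neg_sub, sub_right_comm]

theorem IsWalk.swap (hp : IsWalk p) : IsWalk (swapWeights p) where
  nonneg k l := hp.nonneg l k
  sum_one := (Equiv.prodComm ℤ ℤ).hasSum_iff.mpr hp.sum_one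
  small_positive_jumps k l h := hp.small_positive_jumps l k h.symm
  aperiodic x y hx hy h := by
    refine (hp.aperiodic y x hy hx ?_).symm
    rw [← h, ← (Equiv.prodComm ℤ ℤ).tsum_eq]
    congr 1
    refine tsum_congr fun z => ?_
    simp only [Equiv.prodComm_apply, Prod.fst_swap, Prod.snd_swap, swapWeights]
    ring
  moments := by
    have := (Equiv.prodComm ℤ ℤ).summable_iff.mpr hp.moments
    refine this.congr fun z => ?_
    simp only [Function.comp, Equiv.prodComm_apply, Prod.fst_swap, Prod.snd_swap, swapWeights]
    ring
  drift_fst := (Equiv.prodComm ℤ ℤ).hasSum_iff.mpr hp.drift_snd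
  drift_snd := (Equiv.prodComm ℤ ℤ).hasSum_iff.mpr hp.drift_fst

theorem IsRootFunction.swap (hη : IsRootFunction p η) :
    IsRootFunction (swapWeights p) (swapRoot η) where
  continuousOn := hη.continuousOn.comp
    (continuousOn_inv₀.mono fun s hs => ne_zero_of_norm_eq_one (mem_sphere_zero_iff_norm.mp hs))
    fun s hs => by simpa using hs
  map_one := by simp [swapRoot, hη.map_one]
  norm_le s hs := hη.norm_le _ (by simp [hs])
  root s hs := by
    have := hη.root s⁻¹ (by simp [hs])
    rw [inv_inv] at this
    rwa [kernel_swapWeights]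
  reduced_root h s hs := by
    rw [reducedKernel_swapWeights]
    exact hη.reduced_root h s⁻¹ (by simp [hs])

theorem S₂_swapRoot (η : ℂ → ℂ) : S₂ (swapRoot η) = S₁ η := by
  ext x
  constructor
  · rintro ⟨s, hs, rfl⟩
    exact ⟨s⁻¹, by simpa using hs, rfl⟩
  · rintro ⟨s, hs, rfl⟩
    exact ⟨s⁻¹, by simpa using hs, by simp [swapRoot]⟩

theorem curve₂_swapRoot (φ : ℝ) : curve₂ (swapRoot η) φ = curve₁ η (-φ) := by
  simp only [curve₂, curve₁, swapRoot, Complex.ofReal_neg, neg_mul, Complex.exp_neg]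

theorem CurveCondition.simpleCurve (hK : CurveCondition p η) : SimpleCurve p η := hK.simple₂

theorem CurveCondition.regularCurve (hK : CurveCondition p η) : RegularCurve p η :=
  hK.deriv_ne_zero₂

theorem CurveCondition.simpleCurve_swap (hK : CurveCondition p η) :
    SimpleCurve (swapWeights p) (swapRoot η) := fun s t hs ht h => by
  rcases hK.simple₁ s⁻¹ t⁻¹ (by simp [hs]) (by simp [ht]) h with h | ⟨h, h'⟩
  · exact Or.inl (inv_injective h)
  · exact Or.inr ⟨h, inv_injective (by rw [h', inv_neg])⟩

theorem CurveCondition.regularCurve_swap (hK : CurveCondition p η) :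
    RegularCurve (swapWeights p) (swapRoot η) := fun φ h1 h2 v hv => by
  have hexp : Complex.exp ((-φ : ℝ) * Complex.I) = (Complex.exp (φ * Complex.I))⁻¹ := by
    rw [← Complex.exp_neg]; push_cast; ring_nf
  have hd : HasDerivAt (curve₁ η) (-v) (-φ) := by
    have h := HasDerivAt.scomp (-φ) (g₁ := curve₂ (swapRoot η)) (h := fun t : ℝ => -t)
      (by simpa using hv) (hasDerivAt_neg (-φ))
    have he : curve₂ (swapRoot η) ∘ (fun t : ℝ => -t) = curve₁ η := by
      funext t; simp [curve₂_swapRoot]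
    rw [he] at h
    simpa using h
  refine neg_ne_zero.mp (hK.deriv_ne_zero₁ (-φ) ?_ (fun h h' => ?_) _ hd)
  · rwa [hexp, Ne, inv_eq_one]
  · rw [hexp, inv_eq_iff_eq_inv, inv_neg, inv_one] at h'
    exact h2 h h'

theorem period_swapWeights (p : ℤ → ℤ → ℝ) : period (swapWeights p) = period p := rfl

theorem curve₁_add_period (hp : IsWalk p) (hη : IsRootFunction p η) (t : ℝ) :
    curve₁ η (t + period p) = curve₁ η t := by
  have h := curve₂_add_period hp.swap hη.swap (-t - period p)
  rw [period_swapWeights, curve₂_swapRoot, curve₂_swapRoot] at h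
  rw [show -(-t - period p) = t + period p by ring,
    show -(-t - period p + period p) = t by ring] at h
  exact h.symm

theorem image_curve₁ (hp : IsWalk p) (hη : IsRootFunction p η) :
    curve₁ η '' Icc 0 (period p) = S₁ η := by
  rw [← S₂_swapRoot, ← image_curve₂ hp.swap hη.swap, period_swapWeights]
  ext x
  constructor <;> rintro ⟨t, ht, rfl⟩ <;>
    refine ⟨period p - t, ⟨by linarith [ht.2], by linarith [ht.1]⟩, ?_⟩
  · rw [curve₂_swapRoot, neg_sub, ← curve₁_add_period hp hη, sub_add_cancel]
  · rw [curve₂_swapRoot, ← curve₁_add_period hp hη (-t)]; ring_nf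

/-- Reflection reverses the direction in which the curve is run through. -/
theorem HasOrientation.swap (hp : IsWalk p) (hη : IsRootFunction p η) {ε : ℤ}
    (h : HasOrientation (curve₁ η) (period p) ε) :
    HasOrientation (curve₂ (swapRoot η)) (period (swapWeights p)) (-ε) := by
  intro w hw
  rw [image_curve₂ hp.swap hη.swap, S₂_swapRoot, ← image_curve₁ hp hη] at hw
  obtain ⟨θ, hθ, hc, hn⟩ := h w hw
  rw [period_swapWeights]
  have hmaps : ∀ t ∈ Icc 0 (period p), period p - t ∈ Icc 0 (period p) := fun t ht =>
    ⟨by linarith [ht.2], by linarith [ht.1]⟩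
  refine ⟨fun t => θ (period p - t), hθ.comp (by fun_prop) hmaps, fun t ht => ?_, ?_⟩
  · have := hc _ (hmaps t ht)
    have he : curve₂ (swapRoot η) t = curve₁ η (period p - t) := by
      rw [curve₂_swapRoot, ← curve₁_add_period hp hη (-t)]; ring_nf
    rwa [he]
  · simp only [sub_self, sub_zero]
    push_cast
    linarith

/-! ### Both curves together -/

/-- Both curves `s ↦ η(s) s⁻¹` and `s ↦ η(s⁻¹) s⁻¹` are run through clockwise. The criterion
`orientation_eq_neg_one` applies to the walk or to its reflection, and as the orientations of `S₁`
and `S₂` are opposite, one of the two determines the other. -/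
theorem hasOrientation_neg_one (hp : IsWalk p) (hη : IsRootFunction p η)
    (hK : CurveCondition p η) :
    HasOrientation (curve₂ η) (period p) (-1) ∧
      HasOrientation (curve₂ (swapRoot η)) (period (swapWeights p)) (-1) := by
  obtain ⟨ε, -, h₁, h₂⟩ := hK.opposite_orientations
  have h₁' := h₁.swap hp hη
  have hε : -ε = -1 := by
    rcases le_total (coef p (1, 0)) (coef p (0, 1)) with h | h
    · exact orientation_eq_neg_one hp hη hK.simpleCurve hK.regularCurve (Or.inr h) h₂
    · exact orientation_eq_neg_one hp.swap hη.swap hK.simpleCurve_swap hK.regularCurve_swap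
        (Or.inr h) h₁'
  rw [hε] at h₁' h₂
  exact ⟨h₂, h₁'⟩

theorem kernel_ne_zero_of_norm_le (hp : IsWalk p) (hη : IsRootFunction p η)
    (hs₂ : SimpleCurve p η) (hε : HasOrientation (curve₂ η) (period p) (-1)) {x y : ℂ}
    (hy : y ∈ inside (S₂ η)) (hy0 : y ≠ 0) (hxy : ‖x‖ ≤ ‖y‖) : kernel p x y ≠ 0 := fun h => by
  rw [← div_mul_cancel₀ x hy0, kernel_mul_self hp, mul_eq_zero] at h
  refine ratioKernel_ne_zero_of_mem_inside hp hη hs₂ hε hy ?_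
    (h.resolve_left (pow_ne_zero _ hy0))
  rw [norm_div]
  exact div_le_one_of_le₀ hxy (norm_nonneg _)

/-- If `p 1 1 = 0`, the root at the origin is `-coef p (0, 1) / coef p (1, 0)`, and it must not be
in the closed unit disc. -/
theorem coef_lt_of_zero_mem_inside (hp : IsWalk p) (hη : IsRootFunction p η)
    (hs₂ : SimpleCurve p η) (hε : HasOrientation (curve₂ η) (period p) (-1)) (h11 : p 1 1 = 0)
    (h0 : 0 ∈ inside (S₂ η)) : coef p (1, 0) < coef p (0, 1) := by
  by_contra! hle
  rcases (IsWalk.coef_nonneg hp (1, 0)).eq_or_lt with h | h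
  · refine ratioKernel_ne_zero_of_mem_inside hp hη hs₂ hε h0 (u := 0) (by simp) ?_
    have h' : coef p (0, 1) = 0 := le_antisymm (hle.trans h.ge) (IsWalk.coef_nonneg hp _)
    rw [ratioKernel_zero_right p h11, h']
    simp
  · have hc : (coef p (1, 0) : ℂ) ≠ 0 := Complex.ofReal_ne_zero.mpr h.ne'
    refine ratioKernel_ne_zero_of_mem_inside hp hη hs₂ hε h0
      (u := -(coef p (0, 1) / coef p (1, 0))) ?_ ?_
    · rw [norm_neg, norm_div, Complex.norm_real, Complex.norm_real,
        Real.norm_of_nonneg (IsWalk.coef_nonneg hp _), Real.norm_of_nonneg h.le]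
      exact div_le_one_of_le₀ hle h.le
    · rw [ratioKernel_zero_right p h11]
      field_simp
      ring

theorem kernel_zero_zero (p : ℤ → ℤ → ℝ) : kernel p 0 0 = -(p 1 1 : ℂ) := by
  have h : ∀ z : ℤ × ℤ, z ≠ (1, 1) →
      (p z.1 z.2 : ℂ) * (0 : ℂ) ^ (1 - z.1) * (0 : ℂ) ^ (1 - z.2) = 0 := fun z hz => by
    by_cases h1 : z.1 = 1
    · have h2 : 1 - z.2 ≠ 0 := fun h => hz (Prod.ext h1 (by simp; omega))
      rw [zero_zpow _ h2, mul_zero]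
    · rw [zero_zpow _ (by omega), mul_zero, zero_mul]
  rw [kernel, tsum_eq_single _ h]
  simp

/-- The origin of `ℂ × ℂ`, where neither ratio is defined, is excluded because the coefficients
`coef p (1, 0)` and `coef p (0, 1)` would each be smaller than the other. -/
theorem kernel_ne_zero_of_mem_inside (hp : IsWalk p) (hη : IsRootFunction p η)
    (hK : CurveCondition p η) {x y : ℂ} (hx : x ∈ inside (S₁ η)) (hy : y ∈ inside (S₂ η)) :
    kernel p x y ≠ 0 := by
  obtain ⟨h₂, h₁⟩ := hasOrientation_neg_one hp hη hK
  rw [← S₂_swapRoot] at hx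
  by_cases h00 : x = 0 ∧ y = 0
  · obtain ⟨rfl, rfl⟩ := h00
    rw [kernel_zero_zero, neg_ne_zero, Complex.ofReal_ne_zero]
    intro h11
    exact lt_asymm (coef_lt_of_zero_mem_inside hp hη hK.simpleCurve h₂ h11 hy)
      (coef_lt_of_zero_mem_inside hp.swap hη.swap hK.simpleCurve_swap h₁ h11 hx)
  · rcases le_total ‖x‖ ‖y‖ with h | h
    · refine kernel_ne_zero_of_norm_le hp hη hK.simpleCurve h₂ hy (fun hy0 => h00 ⟨?_, hy0⟩) h
      rwa [hy0, norm_zero, norm_le_zero_iff] at h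
    · rw [← kernel_swapWeights]
      refine kernel_ne_zero_of_norm_le hp.swap hη.swap hK.simpleCurve_swap h₁ hx
        (fun hx0 => h00 ⟨hx0, ?_⟩) h
      rwa [hx0, norm_zero, norm_le_zero_iff] at h

theorem mem_zeroSet_swap {x y : ℂ} (h : (x, y) ∈ zeroSet p) :
    (y, x) ∈ zeroSet (swapWeights p) := by
  obtain ⟨h0, hn, h1⟩ := h
  exact ⟨(kernel_swapWeights _ _).trans h0, hn.symm, hn.le.trans h1⟩

end QuadrantWalk

open QuadrantWalk Set Metric in
theorem proposition1 (p : ℤ → ℤ → ℝ) (hp : QuadrantWalk.IsWalk p)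
    (η : ℂ → ℂ) (hη : QuadrantWalk.IsRootFunction p η)
    (hK : QuadrantWalk.CurveCondition p η)
    (X Y : ℂ → ℂ)
    (hX : ∀ y ∈ QuadrantWalk.S₂ η, (X y, y) ∈ QuadrantWalk.zeroSet p)
    (hY : ∀ x ∈ QuadrantWalk.S₁ η, (x, Y x) ∈ QuadrantWalk.zeroSet p) :
    (Set.BijOn X (QuadrantWalk.S₂ η) (QuadrantWalk.S₁ η) ∧
      Set.InvOn Y X (QuadrantWalk.S₂ η) (QuadrantWalk.S₁ η)) ∧
    (QuadrantWalk.ContinuesOutside (QuadrantWalk.S₂ η) X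
        (fun x y => QuadrantWalk.kernel p x y = 0) ∧
      QuadrantWalk.ContinuesOutside (QuadrantWalk.S₁ η) Y
        (fun y x => QuadrantWalk.kernel p x y = 0)) ∧
    (∀ x ∈ QuadrantWalk.inside (QuadrantWalk.S₁ η),
      ∀ y ∈ QuadrantWalk.inside (QuadrantWalk.S₂ η),
        QuadrantWalk.kernel p x y ≠ 0) := by
  obtain ⟨h₂, h₁⟩ := hasOrientation_neg_one hp hη hK
  have hY' : ∀ x ∈ S₂ (swapRoot η), (Y x, x) ∈ zeroSet (swapWeights p) := fun x hx =>
    mem_zeroSet_swap (hY x (S₂_swapRoot η ▸ hx))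
  have hXs : ∀ s : ℂ, ‖s‖ = 1 → X (η s * s⁻¹) = η s * s := fun s hs =>
    (eq_of_mem_zeroSet hp hη hK.simpleCurve hs
      (hX _ ⟨s, mem_sphere_zero_iff_norm.mpr hs, rfl⟩)).trans (sq_mul_curvePoint hs)
  have hYs : ∀ s : ℂ, ‖s‖ = 1 → Y (η s * s) = η s * s⁻¹ := fun s hs => by
    have hs' : ‖s⁻¹‖ = 1 := by simp [hs]
    have h := (eq_of_mem_zeroSet hp.swap hη.swap hK.simpleCurve_swap hs'
      (hY' _ ⟨s⁻¹, mem_sphere_zero_iff_norm.mpr hs', rfl⟩)).trans (sq_mul_curvePoint hs')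
    simpa [curvePoint, swapRoot] using h
  have hinv : InvOn Y X (S₂ η) (S₁ η) := by
    constructor
    · rintro _ ⟨s, hs, rfl⟩
      have hs := mem_sphere_zero_iff_norm.mp hs
      simp only [hXs s hs, hYs s hs]
    · rintro _ ⟨s, hs, rfl⟩
      have hs := mem_sphere_zero_iff_norm.mp hs
      simp only [hXs s hs, hYs s hs]
  refine ⟨⟨hinv.bijOn ?_ ?_, hinv⟩, ⟨?_, ?_⟩, fun x hx y hy =>
    kernel_ne_zero_of_mem_inside hp hη hK hx hy⟩
  · rintro _ ⟨s, hs, rfl⟩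
    exact ⟨s, hs, (hXs s (mem_sphere_zero_iff_norm.mp hs)).symm⟩
  · rintro _ ⟨s, hs, rfl⟩
    exact ⟨s, hs, (hYs s (mem_sphere_zero_iff_norm.mp hs)).symm⟩
  · exact continuesOutside_S₂ hp hη hK.simpleCurve hK.regularCurve h₂ hX
  · have h := continuesOutside_S₂ hp.swap hη.swap hK.simpleCurve_swap hK.regularCurve_swap h₁ hY'
    rw [S₂_swapRoot] at h
    simpa only [kernel_swapWeights] using h
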